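/- For $x\in\mathbb Z$, $u>0$, $z\in\mathbb C$ put $G(z;x,u)=\dfrac{u^z}{\Gamma(z+1)\sin(\frac{\pi}{2}(z+x))}$. For $x_1,x_2\in\mathbb Z$ and $u_1,u_2>0$ let $$K_{\rm edge}(x_1,u_1;x_2,u_2)=\mathbf 1_{\{u_2<u_1,\;x_2<x_1\}}\frac{(u_2-u_1)^{x_1-x_2-1}}{(x_1-x_2-1)!}+\frac{1}{(2\pi i)^2}\oint_{C_z}dz\oint_{C_w}dw\;\frac{\pi}{2}\cdot\frac{G(w;x_1,u_1)\,G(z;x_2,u_2)}{w+z+x_2-x_1+1}.$$ Here $C_z$ and $C_w$ are piecewise $C^1$ contours with the following properties. Each contains an unbounded curve which lies in a horizontal strip of finite height, whose two ends go to $+\infty$ to the right, and along which $\int e^{-\operatorname{Re}\zeta}\,|d\zeta|<\infty$. $C_z$ is this single curve; $C_w$ may consist of such a curve together with finitely many closed curves of finite length. Each of $C_z$ and $C_w$ stays uniformly away from the integers, has winding number $1$ (counter-clockwise) around each non-negative integer and winding number $0$ around each negative integer. Finally $|w+z+x_2-x_1+1|$ is bounded away from $0$ for $z\in C_z$, $w\in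 C_w$. For $u_1,u_2\ge 0$ with $u_1=0$ or $u_2=0$, $K_{\rm edge}$ is understood as the limit of its values at positive arguments tending to $(u_1,u_2)$. **Proposition 4.3.** For all $x_1,x_2\in\mathbb Z$ such contours exist, and for every choice of them and all $u_1,u_2>0$ the double contour integral converges absolutely. For all $x_1,x_2\in\mathbb Z$ and $u_1,u_2\ge 0$ that do not satisfy both $u_1=u_2$ and $x_2=x_1-1$ (for $u_1u_2=0$ this includes that the limit exists), $$K_{\rm edge}(x_1,u_1;x_2,u_2)=\begin{cases}\displaystyle\frac2\pi\int_0^1 t^{x_2-x_1}\cos\!\left(tu_1+\tfrac{\pi}{2}x_1\right)\cos\!\left(tu_2+\tfrac{\pi}{2}x_2\right)dt,& x_2\ge x_1,\\[2ex]\displaystyle-\frac2\pi\int_1^\infty t^{x_2-x_1}\cos\!\left(tu_1+\tfrac{\pi}{2}x_1\right)\cos\!\left(tu_2+\tfrac{\pi}{2}x_2\right)dt,& x_2<x_1,\end{cases}$$ where $\int_1^\infty=\lim_{R\to\infty}\int_1^R$ is a convergent improper integral (for all $u_1,u_2\ge0$). The exceptional set $\{u_1=u_2,\ x_2=x_1-1\}$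 is null for the square of the measure (counting measure on $\mathbb Z$) $\otimes$ (Lebesgue measure on $\mathbb R_{\ge0}$), so the two forms of the kernel agree after modification on a null set. -/

import Mathlib

open MeasureTheory Filter Topology

noncomputable section

namespace EdgeKernel

/-- A continuous curve that is continuously differentiable on the open set `U` of parameters apart
from finitely many breakpoints. -/
def PiecewiseC1On (γ : ℝ → ℂ) (U : Set ℝ) : Prop :=
  ∃ S : Finset ℝ, (∀ t ∈ U \ (S : Set ℝ), DifferentiableAt ℝ γ t) ∧
    ContinuousOn (deriv γ) (U \ (S : Set ℝ))

/-- An unbounded oriented curve `γ : ℝ → ℂ`, both of whose ends go to infinity to the right, inside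
a horizontal strip of finite height.  The last field says that the length element of the
curve is integrable against `exp (- Re)`; it holds for instance for curves of bounded speed whose
real part grows linearly. -/
structure IsUnboundedCurve (γ : ℝ → ℂ) : Prop where
  continuous : Continuous γ
  piecewiseC1 : PiecewiseC1On γ Set.univ
  tendsto_re : Tendsto (fun t => (γ t).re) (cocompact ℝ) atTop
  bounded_im : ∃ B : ℝ, ∀ t, |(γ t).im| ≤ B
  integrable_length : Integrable (fun t => Real.exp (-(γ t).re) * ‖deriv γ t‖)

/-- A closed curve of finite length, parametrized by `[0, 1]`. -/
structure IsClosedCurve (γ : ℝ → ℂ) : Prop where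
  continuousOn : ContinuousOn γ (Set.Icc 0 1)
  closed : γ 0 = γ 1
  piecewiseC1 : PiecewiseC1On γ (Set.Ioo 0 1)
  integrable_length : IntegrableOn (fun t => ‖deriv γ t‖) (Set.Icc 0 1)

/-- An unbounded contour: one unbounded curve together with finitely many (possibly no)
closed curves. -/
structure Contour where
  arm : ℝ → ℂ
  numLoops : ℕ
  loop : Fin numLoops → ℝ → ℂ
  isUnboundedCurve_arm : IsUnboundedCurve arm
  isClosedCurve_loop : ∀ i, IsClosedCurve (loop i)

namespace Contour

/-- The pieces of a contour: `none` stands for the unbounded curve, `some i` for a closed one. -/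
def piece (C : Contour) : Option (Fin C.numLoops) → ℝ → ℂ
  | none => C.arm
  | some i => C.loop i

/-- The parameter interval of each piece of a contour. -/
def dom (C : Contour) : Option (Fin C.numLoops) → Set ℝ
  | none => Set.univ
  | some _ => Set.Icc 0 1

/-- The set of points on the contour. -/
def support (C : Contour) : Set ℂ := ⋃ c, C.piece c '' C.dom c

/-- The contour integral `∮_C f(ζ) dζ`. -/
def integral (C : Contour) (f : ℂ → ℂ) : ℂ :=
  ∑ c, ∫ t in C.dom c, f (C.piece c t) * deriv (C.piece c) t

/-- The contour `C` has winding number `n` around `p`: the total change of `arg (ζ - p)` as `ζ` runs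
through `C` is `2 π n`.  (Both ends of the unbounded curve have limiting argument `0` modulo `2 π`,
so this total change is a multiple of `2 π`.) -/
def HasWindingNumber (C : Contour) (p : ℂ) (n : ℤ) : Prop :=
  Tendsto (fun T : ℝ => ∑ c, ∫ t in C.dom c ∩ Set.Icc (-T) T,
    (deriv (C.piece c) t / (C.piece c t - p)).im) atTop (𝓝 (2 * Real.pi * n))

/-- `C` is a contour `C[0,∞)`: it stays uniformly away from the integers, it encloses
each non-negative integer once counter-clockwise, and it encloses no negative integer. -/
structure EnclosesNonnegIntegers (C : Contour) : Prop where
  away : ∃ δ : ℝ, 0 < δ ∧ ∀ ζ ∈ C.support, ∀ n : ℤ, δ ≤ ‖ζ - n‖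
  nonneg : ∀ n : ℤ, 0 ≤ n → C.HasWindingNumber n 1
  neg : ∀ n : ℤ, n < 0 → C.HasWindingNumber n 0

end Contour

/-- The iterated contour integral `(2πi)⁻² ∮_{Cz} dz ∮_{Cw} dw F(z, w)`. -/
def doubleIntegral (Cz Cw : Contour) (F : ℂ → ℂ → ℂ) : ℂ :=
  1 / (2 * Real.pi * Complex.I) ^ 2 * Cz.integral (fun z => Cw.integral (fun w => F z w))

/-- Absolute convergence of the double contour integral of `F` over `Cz × Cw`. -/
def DoubleIntegrable (Cz Cw : Contour) (F : ℂ → ℂ → ℂ) : Prop :=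
  ∀ a b, Integrable (fun p : ℝ × ℝ => F (Cz.piece a p.1) (Cw.piece b p.2) *
      (deriv (Cz.piece a) p.1 * deriv (Cw.piece b) p.2))
    ((volume.restrict (Cz.dom a)).prod (volume.restrict (Cw.dom b)))

/-- The contours over which the double contour kernel at `(x₁, ·; x₂, ·)` is taken. The `z`-contour is
a single curve; the `w`-contour may consist of several curves (for `x₂ < x₁` two single curves
`Cz`, `Cw` with `w + z + x₂ - x₁ + 1 ≠ 0` do not exist). -/
structure Admissible (x₁ x₂ : ℤ) (Cz Cw : Contour) : Prop where
  enclosesZ : Cz.EnclosesNonnegIntegers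
  enclosesW : Cw.EnclosesNonnegIntegers
  singleZ : Cz.numLoops = 0
  away : ∃ δ : ℝ, 0 < δ ∧ ∀ z ∈ Cz.support, ∀ w ∈ Cw.support, δ ≤ ‖w + z + x₂ - x₁ + 1‖

/-- `G(z; x, u) = u ^ z / (Γ(z + 1) sin (π (z + x) / 2))`. -/
def G (z : ℂ) (x : ℤ) (u : ℝ) : ℂ :=
  (u : ℂ) ^ z / (Complex.Gamma (z + 1) * Complex.sin (Real.pi / 2 * (z + x)))

/-- The integrand of the double contour integral. -/
def contourIntegrand (x₁ : ℤ) (u₁ : ℝ) (x₂ : ℤ) (u₂ : ℝ) (z w : ℂ) : ℂ :=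
  Real.pi / 2 * (G w x₁ u₁ * G z x₂ u₂ / (w + z + x₂ - x₁ + 1))

/-- The double contour form of `K_edge(x₁, u₁; x₂, u₂)`, for `u₁, u₂ > 0`. -/
def contourKernel (Cz Cw : Contour) (x₁ : ℤ) (u₁ : ℝ) (x₂ : ℤ) (u₂ : ℝ) : ℂ :=
  (if u₂ < u₁ ∧ x₂ < x₁ then
      (((u₂ - u₁) ^ (x₁ - x₂ - 1).toNat / (x₁ - x₂ - 1).toNat.factorial : ℝ) : ℂ)
    else 0) +
  doubleIntegral Cz Cw (contourIntegrand x₁ u₁ x₂ u₂)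

/-- `t ^ (x₂ - x₁) cos (t u₁ + π x₁ / 2) cos (t u₂ + π x₂ / 2)`. -/
def realIntegrand (x₁ : ℤ) (u₁ : ℝ) (x₂ : ℤ) (u₂ : ℝ) (t : ℝ) : ℝ :=
  t ^ (x₂ - x₁) * Real.cos (t * u₁ + Real.pi / 2 * x₁) * Real.cos (t * u₂ + Real.pi / 2 * x₂)

/-- The real integral form of the kernel. The integral over `[1, ∞)` is an improper Riemann integral,
since for `x₂ = x₁ - 1` it converges only conditionally. -/
def realKernel (x₁ : ℤ) (u₁ : ℝ) (x₂ : ℤ) (u₂ : ℝ) : ℝ :=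
  if x₁ ≤ x₂ then
    2 / Real.pi * ∫ t in (0 : ℝ)..1, realIntegrand x₁ u₁ x₂ u₂ t
  else
    -(2 / Real.pi) * limUnder atTop (fun R : ℝ => ∫ t in (1 : ℝ)..R, realIntegrand x₁ u₁ x₂ u₂ t)

/-- The set of pairs of points `((x₁, u₁), (x₂, u₂))` with `u₁ = u₂` and `x₂ = x₁ - 1`. -/
def exceptionalSet : Set ((ℤ × ℝ) × (ℤ × ℝ)) :=
  {p | p.1.2 = p.2.2 ∧ p.2.1 = p.1.1 - 1}

/-- The reference measure on `ℤ × ℝ≥0`: counting measure times Lebesgue measure. -/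
def refMeasure : Measure (ℤ × ℝ) :=
  (Measure.count : Measure ℤ).prod (volume.restrict (Set.Ici (0 : ℝ)))

end EdgeKernel

end

noncomputable section

namespace EdgeKernel

/-! ### The power series of `cos` shifted by a phase and its moments -/

/-! Both forms of the kernel are expressed through one family of entire functions, E_m(a) =
`cosMoment m a`. Put m = x₁ - x₂ and S = (E_m(u₁ - u₂) + (-1)^x₁ E_m(-(u₁ + u₂)))/π, which is
`seriesPart`.

Real form. The product of cosines splits into two terms t^(-m) cos(ta + πm/2), with a = u₁ - u₂ and
a = -(u₁ + u₂), and t^(1-m) E_m(ta) is an antiderivative of such a term. For m ≤ 0 the integral over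
[0, 1] is E_m(a), and the kernel is S. For m = k + 1 ≥ 1 the integral over [1, R] also has a
boundary term at R, whose limit is -(π/2) sgn(a) (-a)^k/k!. This is the Dirichlet integral for k = 0
and follows for larger k from the recursion `cosMoment_recursion`.

Contour form. In the w-integral only the poles of G at w = 0, 1, 2, … count: as z runs along its
curve, the pole x₁ - x₂ - 1 - z moves off to the left without meeting C_w, so its winding number is
0 (`Admissible.integral_w`). The z-integral then collects the poles of G at l ≥ 0 and those of 1/(z
- (x₁ - x₂ - 1 - k)). The first kind gives a double series which the binomial theorem sums to S
(`tsum_doubleTerm`). The second kind is a finite sum, equal after the prefactors to -((u₂ - u₁)^j +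
(-1)^x₁ (u₁ + u₂)^j)/(2 j!) with j = x₁ - x₂ - 1 (`hasSum_extraResidue_of_lt`). Since 1_{u₂ < u₁} -
1/2 = sgn(u₁ - u₂)/2 for u₁ ≠ u₂, the indicator term of the kernel turns this sum into the boundary
terms of the real form (`Admissible.contourKernel_eq`). The values at u₁u₂ = 0 follow by continuity
of the real form.

The residue theorem for unbounded contours, `integral_eq_tsum`, subtracts principal parts built from
exp(p - w)/(w - p), which decays to the right. What remains is entire, hence has a primitive, and
this primitive takes asymptotically equal values at the two ends of the curve. -/

theorem hasSum_cos_add (c y : ℝ) :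
    HasSum (fun N : ℕ => Real.cos (c + Real.pi / 2 * N) * (y ^ N / N.factorial))
      (Real.cos (y + c)) := by
  have h := (NormedSpace.expSeries_div_hasSum_exp (𝔸 := ℂ) (y * Complex.I)).mul_left
    (Complex.exp (c * Complex.I))
  rw [← Complex.exp_eq_exp_ℂ, ← Complex.exp_add] at h
  have h2 := Complex.hasSum_re h
  have e : (Complex.exp (c * Complex.I + y * Complex.I)).re = Real.cos (y + c) := by
    rw [← add_mul, ← Complex.ofReal_add, Complex.exp_ofReal_mul_I_re, add_comm]
  rw [e] at h2
  refine h2.congr_fun ?_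
  intro N
  have hI : (Complex.I : ℂ) ^ N = Complex.exp ((Real.pi / 2 * N : ℝ) * Complex.I) := by
    rw [show (((Real.pi / 2 * N : ℝ) : ℂ) * Complex.I) = N * (Real.pi / 2 * Complex.I) by
      push_cast; ring, Complex.exp_nat_mul, Complex.exp_pi_div_two_mul_I]
  have : Complex.exp (c * Complex.I) * ((y * Complex.I) ^ N / N.factorial)
      = Complex.exp ((c + Real.pi / 2 * N : ℝ) * Complex.I) * ((y ^ N / N.factorial : ℝ) : ℂ) := by
    rw [mul_pow, hI, Complex.ofReal_add, add_mul, Complex.exp_add]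
    push_cast
    ring
  rw [this, Complex.re_mul_ofReal, Complex.exp_ofReal_mul_I_re]

/-- The power series `∑ cos (π (N + m) / 2) a ^ N / (N! (N - m + 1))`; the term `N = m - 1` is zero. -/
def cosMoment (m : ℤ) (a : ℝ) : ℝ :=
  ∑' N : ℕ, Real.cos (Real.pi / 2 * (N + m)) * (a ^ N / N.factorial) / (N - m + 1)

/-- Since `0⁻¹ = 0`, the bound needs no exception, so the series below may keep the index at which
the denominator vanishes. -/
theorem abs_inv_int_le_one (k : ℤ) : |((k : ℝ))⁻¹| ≤ 1 := by
  rcases eq_or_ne k 0 with rfl | hk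
  · simp
  · rw [abs_inv]
    apply inv_le_one_of_one_le₀
    exact_mod_cast Int.one_le_abs hk

theorem cosMoment_term_bound (m : ℤ) (a : ℝ) (N : ℕ) :
    ‖Real.cos (Real.pi / 2 * (N + m)) * (a ^ N / N.factorial) / (N - m + 1)‖
      ≤ |a| ^ N / N.factorial := by
  have h1 := abs_inv_int_le_one ((N : ℤ) - m + 1)
  push_cast at h1
  have h2 := Real.abs_cos_le_one (Real.pi / 2 * (N + m))
  rw [div_eq_mul_inv _ ((N : ℝ) - m + 1), norm_mul, norm_mul, norm_div, norm_pow]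
  simp only [Real.norm_eq_abs, Nat.abs_cast]
  have h3 : 0 ≤ |a| ^ N / (N.factorial : ℝ) := by positivity
  calc _ ≤ 1 * (|a| ^ N / N.factorial) * 1 := by gcongr
    _ = _ := by ring

theorem summable_cosMoment (m : ℤ) (a : ℝ) :
    Summable fun N : ℕ =>
      Real.cos (Real.pi / 2 * (N + m)) * (a ^ N / N.factorial) / (N - m + 1) :=
  Summable.of_norm_bounded (Real.summable_pow_div_factorial |a|) (cosMoment_term_bound m a)

/-- The factor `N - m + 1` cancels, since the cosine vanishes where it does. -/
theorem cos_mul_div_cancel (m : ℤ) (N : ℕ) (y : ℝ) :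
    Real.cos (Real.pi / 2 * (N + m)) * y / (N - m + 1) * (N - m + 1) =
      Real.cos (Real.pi / 2 * (N + m)) * y := by
  rcases eq_or_ne ((N : ℝ) - m + 1) 0 with h | h
  · have : (N : ℝ) = m - 1 := by linarith
    have : Real.cos (Real.pi / 2 * (N + m)) = 0 := by
      rw [this, Real.cos_eq_zero_iff]
      exact ⟨m - 1, by push_cast; ring⟩
    rw [this]; simp
  · field_simp

/-- Raising N and lowering m by one leaves the denominator unchanged and shifts the phase by π.
Summed over N, this makes -E_{m-1} the derivative of E_m. -/
theorem cosMoment_term_shift (m : ℤ) (a : ℝ) (N : ℕ) :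
    Real.cos (Real.pi / 2 * (((N + 1 : ℕ) : ℝ) + m)) *
        (((N + 1 : ℕ) : ℝ) * a ^ N / (N + 1).factorial) / (((N + 1 : ℕ) : ℝ) - m + 1) =
      -(Real.cos (Real.pi / 2 * (N + ((m - 1 : ℤ) : ℝ))) * (a ^ N / N.factorial) /
        (N - ((m - 1 : ℤ) : ℝ) + 1)) := by
  have hc : Real.cos (Real.pi / 2 * (((N + 1 : ℕ) : ℝ) + m)) =
      - Real.cos (Real.pi / 2 * (N + ((m - 1 : ℤ) : ℝ))) := by
    rw [← Real.cos_add_pi]; push_cast; congr 1; ring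
  rw [hc, Nat.factorial_succ]
  push_cast
  have e : (N : ℝ) + 1 - m + 1 = N - (m - 1) + 1 := by ring
  rw [e]
  have : (N : ℝ) + 1 ≠ 0 := by positivity
  field_simp

theorem hasSum_cosMoment_deriv (m : ℤ) (a : ℝ) :
    HasSum (fun N : ℕ =>
      Real.cos (Real.pi / 2 * (N + m)) * (N * a ^ (N - 1) / N.factorial) / (N - m + 1))
      (-cosMoment (m - 1) a) := by
  rw [← hasSum_nat_add_iff' 1]
  simp only [Finset.range_one, Finset.sum_singleton, Nat.cast_zero, zero_mul, zero_div, mul_zero,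
    sub_zero]
  exact (summable_cosMoment (m - 1) a).hasSum.neg.congr_fun (cosMoment_term_shift m a)

/-- In a E_m' - (m - 1) E_m the N-th term acquires the factor N - m + 1, which cancels the
denominator and leaves the series of the cosine. -/
theorem cosMoment_recursion (m : ℤ) (a : ℝ) :
    (m - 1) * cosMoment m a = -Real.cos (a + Real.pi / 2 * m) - a * cosMoment (m - 1) a := by
  have h0 := hasSum_cos_add (Real.pi / 2 * m) a
  have h1 := (summable_cosMoment m a).hasSum
  have h3 := (hasSum_cosMoment_deriv m a).mul_left a
  have h5 := (h3.sub (h1.mul_left ((m : ℝ) - 1))).unique (h0.congr_fun ?_)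
  · change a * _ - (m - 1) * cosMoment m a = _ at h5
    linarith
  · intro N
    have := cos_mul_div_cancel m N (a ^ N / N.factorial)
    rw [show Real.pi / 2 * (m : ℝ) + Real.pi / 2 * N = Real.pi / 2 * (N + m) by ring]
    refine Eq.trans ?_ this
    rcases N with _ | N
    · simp; ring
    · rw [Nat.add_sub_cancel, pow_succ]; ring

theorem hasDerivAt_cosMoment (m : ℤ) (a : ℝ) :
    HasDerivAt (cosMoment m) (-cosMoment (m - 1) a) a := by
  set r := |a| + 1 with hr
  have hr0 : 0 < r := by positivity
  have hu : Summable fun N : ℕ => r ^ (N - 1) / ((N - 1).factorial : ℝ) := by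
    rw [← summable_nat_add_iff 1]
    simpa using Real.summable_pow_div_factorial r
  have key := hasDerivAt_tsum_of_isPreconnected (𝕜 := ℝ) (t := Metric.ball (0 : ℝ) r)
    (g := fun (N : ℕ) y => Real.cos (Real.pi / 2 * (N + m)) * (y ^ N / N.factorial) / (N - m + 1))
    (g' := fun (N : ℕ) y =>
      Real.cos (Real.pi / 2 * (N + m)) * (N * y ^ (N - 1) / N.factorial) / (N - m + 1))
    (y₀ := 0) (y := a) hu Metric.isOpen_ball (convex_ball _ _).isPreconnected
    (fun N y _ => (((hasDerivAt_pow N y).div_const _).const_mul _).div_const _) ?_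
    (Metric.mem_ball_self hr0) (summable_cosMoment m 0) (by simp [hr])
  · rw [(hasSum_cosMoment_deriv m a).tsum_eq] at key
    exact key
  · intro N y hy
    rw [mem_ball_zero_iff] at hy
    rcases N with _ | N
    · simp
    · rw [Nat.add_sub_cancel, cosMoment_term_shift, norm_neg]
      refine (cosMoment_term_bound (m - 1) y N).trans ?_
      have : |y| ≤ r := hy.le
      gcongr

theorem continuous_cosMoment (m : ℤ) : Continuous (cosMoment m) :=
  continuous_iff_continuousAt.2 fun a => (hasDerivAt_cosMoment m a).continuousAt

/-- An antiderivative of `t ^ (-m) cos (t a + π m / 2)`. -/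
theorem hasDerivAt_zpow_mul_cosMoment (m : ℤ) (a : ℝ) {t : ℝ} (ht : t ≠ 0) :
    HasDerivAt (fun t => t ^ (1 - m) * cosMoment m (t * a))
      (t ^ (-m) * Real.cos (t * a + Real.pi / 2 * m)) t := by
  have h1 := hasDerivAt_zpow (1 - m) t (Or.inl ht)
  have h2 := (hasDerivAt_cosMoment m (t * a)).comp t ((hasDerivAt_id t).mul_const a)
  refine (h1.mul h2).congr_deriv ?_
  have h3 := cosMoment_recursion m (t * a)
  rw [show (1 - m - 1 : ℤ) = -m by ring]
  have e : t ^ (1 - m) = t ^ (-m) * t := by rw [← zpow_add_one₀ ht]; ring_nf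
  rw [show Real.cos (t * a + Real.pi / 2 * m) = -(m - 1) * cosMoment m (t * a) -
    t * a * cosMoment (m - 1) (t * a) by linarith]
  simp only [Function.comp, id]
  push_cast
  rw [e]; ring

theorem integral_one_zpow_mul_cos (m : ℤ) (a : ℝ) {R : ℝ} (hR : 1 ≤ R) :
    ∫ t in (1 : ℝ)..R, t ^ (-m) * Real.cos (t * a + Real.pi / 2 * m) =
      R ^ (1 - m) * cosMoment m (R * a) - cosMoment m a := by
  have hpos : ∀ t ∈ Set.uIcc 1 R, t ≠ 0 := fun t ht => by
    rw [Set.uIcc_of_le hR] at ht; linarith [ht.1]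
  rw [intervalIntegral.integral_eq_sub_of_hasDerivAt
    (fun t ht => hasDerivAt_zpow_mul_cosMoment m a (hpos t ht))]
  · simp
  · apply ContinuousOn.intervalIntegrable
    exact (continuousOn_id.zpow₀ _ fun t ht => Or.inl (hpos t ht)).mul (by fun_prop)

theorem integral_zero_one_zpow_mul_cos {m : ℤ} (hm : m ≤ 0) (a : ℝ) :
    ∫ t in (0 : ℝ)..1, t ^ (-m) * Real.cos (t * a + Real.pi / 2 * m) = cosMoment m a := by
  obtain ⟨k, rfl⟩ : ∃ k : ℕ, m = -k := ⟨(-m).toNat, by omega⟩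
  -- The antiderivative is differentiated only at t ≠ 0, so this version asks for derivatives inside
  -- the interval and continuity up to 0. The value at 0 vanishes because the exponent 1 + k is
  -- positive.
  rw [intervalIntegral.integral_eq_sub_of_hasDerivAt_of_le (zero_le_one)
    (f := fun t => t ^ (1 - (-k : ℤ)) * cosMoment (-k) (t * a)) ?_
    (fun t ht => hasDerivAt_zpow_mul_cosMoment _ a ht.1.ne')]
  · simp [zero_zpow _ (show (1 + k : ℤ) ≠ 0 by omega)]
  · apply Continuous.intervalIntegrable
    simp only [neg_neg, zpow_natCast]
    fun_prop
  · have := continuous_cosMoment (-k)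
    have e : (1 - (-k : ℤ)) = ((1 + k : ℕ) : ℤ) := by push_cast; ring
    simp only [e, zpow_natCast]
    fun_prop

/-! ### The Dirichlet integral -/

/-- The derivative of E_1 is -E_0, and E_0(t) = ∫₀¹ cos(ts) ds is the sinc function. -/
theorem cosMoment_one_eq (y : ℝ) : cosMoment 1 y = -∫ t in (0 : ℝ)..y, Real.sinc t := by
  have hd : ∀ t, HasDerivAt (cosMoment 1) (-Real.sinc t) t := by
    intro t
    refine (hasDerivAt_cosMoment 1 t).congr_deriv ?_
    rw [neg_inj, show (1 - 1 : ℤ) = 0 by norm_num, ← integral_zero_one_zpow_mul_cos le_rfl]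
    simp only [neg_zero, zpow_zero, one_mul, Int.cast_zero, mul_zero, add_zero]
    rcases eq_or_ne t 0 with rfl | ht
    · simp
    · rw [intervalIntegral.integral_comp_mul_right (fun x => Real.cos x) ht]
      simp [Real.sinc_of_ne_zero ht, div_eq_inv_mul]
  have h0 : cosMoment 1 0 = 0 := by
    unfold cosMoment
    rw [tsum_eq_single 0]
    · simp
    · intro N hN; simp [hN]
  have := intervalIntegral.integral_eq_sub_of_hasDerivAt (a := 0) (b := y) (fun t _ => hd t)
    (Continuous.intervalIntegrable (by fun_prop) _ _)
  rw [h0, sub_zero, intervalIntegral.integral_neg] at this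
  exact this.symm

/-- Insert 1/t = ∫₀^∞ exp(-st) ds and exchange the integrals; the norm has inner integral |sinc t|,
so Fubini applies. The part 1/(1 + s²) of the inner integral gives π/2, and the rest is O(1/R). -/
theorem integral_sinc_eq {R : ℝ} (hR : 0 < R) :
    ∫ t in (0 : ℝ)..R, Real.sinc t = Real.pi / 2 -
      ∫ s in Set.Ioi (0 : ℝ), Real.exp (-(s * R)) * (Real.cos R + s * Real.sin R) / (1 + s ^ 2) := by
  have hint : Integrable (Function.uncurry fun t s : ℝ => Real.exp (-(s * t)) * Real.sin t)
      ((volume.restrict (Set.Ioc 0 R)).prod (volume.restrict (Set.Ioi 0))) := by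
    have hsm : AEStronglyMeasurable (Function.uncurry fun t s : ℝ => Real.exp (-(s * t)) * Real.sin t)
        ((volume.restrict (Set.Ioc 0 R)).prod (volume.restrict (Set.Ioi 0))) := by
      apply Continuous.aestronglyMeasurable
      unfold Function.uncurry
      fun_prop
    rw [integrable_prod_iff hsm]
    constructor
    · filter_upwards [ae_restrict_mem measurableSet_Ioc] with t ht
      simp only [Function.uncurry]
      refine Integrable.mul_const ?_ _
      change IntegrableOn (fun s => Real.exp (-(s * t))) (Set.Ioi 0)
      simpa [mul_comm] using integrableOn_exp_mul_Ioi (neg_lt_zero.2 ht.1) 0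
    · have : Integrable (fun t => |Real.sinc t|) (volume.restrict (Set.Ioc 0 R)) :=
        Real.integrable_sinc.abs
      refine this.congr ?_
      filter_upwards [ae_restrict_mem measurableSet_Ioc] with t ht
      simp only [Function.uncurry, norm_mul, Real.norm_eq_abs, Real.abs_exp]
      rw [integral_mul_const, Real.sinc_of_ne_zero ht.1.ne', abs_div, abs_of_pos ht.1]
      have := integral_exp_mul_Ioi (neg_lt_zero.2 ht.1) 0
      simp only [mul_zero, Real.exp_zero] at this
      rw [show (fun s : ℝ => Real.exp (-(s * t))) = fun s => Real.exp (-t * s) by ext; ring_nf, this]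
      field_simp
  have h1 : ∫ t in (0 : ℝ)..R, Real.sinc t =
      ∫ t in Set.Ioc 0 R, ∫ s in Set.Ioi (0 : ℝ), Real.exp (-(s * t)) * Real.sin t := by
    rw [intervalIntegral.integral_of_le hR.le]
    refine setIntegral_congr_fun measurableSet_Ioc fun t ht => ?_
    rw [integral_mul_const, Real.sinc_of_ne_zero ht.1.ne']
    have := integral_exp_mul_Ioi (neg_lt_zero.2 ht.1) 0
    simp only [mul_zero, Real.exp_zero] at this
    rw [show (fun s : ℝ => Real.exp (-(s * t))) = fun s => Real.exp (-t * s) by ext; ring_nf, this]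
    have := ht.1.ne'
    field_simp
  have h2 : ∀ s : ℝ, ∫ t in Set.Ioc 0 R, Real.exp (-(s * t)) * Real.sin t =
      (1 + s ^ 2)⁻¹ - Real.exp (-(s * R)) * (Real.cos R + s * Real.sin R) / (1 + s ^ 2) := by
    intro s
    have hs : (1 + s ^ 2) ≠ 0 := by positivity
    have hd : ∀ t, HasDerivAt
        (fun t => -(Real.exp (-(s * t)) * (Real.cos t + s * Real.sin t) / (1 + s ^ 2)))
        (Real.exp (-(s * t)) * Real.sin t) t := by
      intro t
      have h := ((((hasDerivAt_id t).const_mul s).neg.exp).mul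
        ((Real.hasDerivAt_cos t).add ((Real.hasDerivAt_sin t).const_mul s))).div_const (1 + s ^ 2)
      refine h.neg.congr_deriv ?_
      simp only [id, Pi.add_apply, Pi.neg_apply]
      field_simp
      ring
    rw [← intervalIntegral.integral_of_le hR.le,
      intervalIntegral.integral_eq_sub_of_hasDerivAt (fun t _ => hd t)
        (Continuous.intervalIntegrable (by fun_prop) _ _)]
    simp
    ring
  rw [h1, integral_integral_swap hint]
  simp_rw [h2]
  have hi := integrable_inv_one_add_sq.integrableOn (s := Set.Ioi (0 : ℝ))
  have hp := hint.integral_prod_right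
  simp only [Function.uncurry, h2] at hp
  have := integral_sub hi hp
  simp only [sub_sub_cancel] at this
  rw [integral_Ioi_inv_one_add_sq, Real.arctan_zero, sub_zero] at this
  linarith

theorem tendsto_integral_sinc :
    Tendsto (fun R : ℝ => ∫ t in (0 : ℝ)..R, Real.sinc t) atTop (𝓝 (Real.pi / 2)) := by
  have h : Tendsto (fun R : ℝ => ∫ s in Set.Ioi (0 : ℝ),
      Real.exp (-(s * R)) * (Real.cos R + s * Real.sin R) / (1 + s ^ 2)) atTop (𝓝 0) := by
    refine squeeze_zero_norm' (a := fun R => 2 * R⁻¹) ?_ 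
      (by simpa using (tendsto_inv_atTop_zero (𝕜 := ℝ)).const_mul 2)
    filter_upwards [eventually_gt_atTop 0] with R hR
    have hi : IntegrableOn (fun s => 2 * Real.exp (-R * s)) (Set.Ioi 0) :=
      (integrableOn_exp_mul_Ioi (neg_lt_zero.2 hR) 0).const_mul 2
    have := integral_exp_mul_Ioi (neg_lt_zero.2 hR) 0
    simp only [mul_zero, Real.exp_zero] at this
    have h3 : 2 * R⁻¹ = ∫ s in Set.Ioi (0 : ℝ), 2 * Real.exp (-R * s) := by
      rw [integral_const_mul, this]; field_simp
    rw [h3]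
    refine norm_integral_le_of_norm_le hi ?_
    filter_upwards [ae_restrict_mem measurableSet_Ioi] with s hs
    have hs : 0 < s := hs
    rw [norm_div, norm_mul, Real.norm_eq_abs, Real.abs_exp, Real.norm_eq_abs, Real.norm_eq_abs,
      abs_of_pos (by positivity : 0 < 1 + s ^ 2), div_le_iff₀ (by positivity)]
    have h4 : |Real.cos R + s * Real.sin R| ≤ 2 * (1 + s ^ 2) := by
      have := (abs_add_le (Real.cos R) (s * Real.sin R))
      rw [abs_mul, abs_of_pos hs] at this
      nlinarith [Real.abs_cos_le_one R, Real.abs_sin_le_one R, sq_nonneg (s - 1),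
        mul_le_mul_of_nonneg_left (Real.abs_sin_le_one R) hs.le]
    rw [show -(s * R) = -R * s by ring]
    nlinarith [Real.exp_pos (-R * s), mul_le_mul_of_nonneg_left h4 (Real.exp_pos (-R * s)).le]
  have h2 := (tendsto_const_nhds (x := Real.pi / 2)).sub h
  rw [sub_zero] at h2
  refine h2.congr' ?_
  filter_upwards [eventually_gt_atTop 0] with R hR
  rw [integral_sinc_eq hR]

theorem cosMoment_one_neg (y : ℝ) : cosMoment 1 (-y) = -cosMoment 1 y := by
  unfold cosMoment
  rw [← tsum_neg]
  congr 1
  ext N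
  rcases Nat.even_or_odd N with ⟨k, rfl⟩ | h
  · have : Real.cos (Real.pi / 2 * (((k + k : ℕ) : ℝ) + ((1 : ℤ) : ℝ))) = 0 := by
      rw [Real.cos_eq_zero_iff]
      exact ⟨k, by push_cast; ring⟩
    rw [this]; simp
  · rw [h.neg_pow]; ring

/-- The limit of `R ^ (1 - m) E_m(R a)` for `m ≥ 1`, as a function of `k = m - 1`. -/
def jumpTerm (k : ℕ) (a : ℝ) : ℝ := -(Real.pi / 2) * (SignType.sign a : ℝ) * ((-a) ^ k / k.factorial)

/-- Induction on k. The base case is the Dirichlet integral together with the oddness of E_1. In the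
recursion the cosine is damped by R^(-(k+1)), so each step multiplies the limit by -a/(k + 1). -/
theorem tendsto_zpow_mul_cosMoment (k : ℕ) (a : ℝ) :
    Tendsto (fun R : ℝ => R ^ (-k : ℤ) * cosMoment (k + 1) (R * a)) atTop (𝓝 (jumpTerm k a)) := by
  induction k with
  | zero =>
    have hpos : ∀ b : ℝ, 0 < b →
        Tendsto (fun R : ℝ => cosMoment 1 (R * b)) atTop (𝓝 (-(Real.pi / 2))) := by
      intro b hb
      simp_rw [cosMoment_one_eq]
      exact (tendsto_integral_sinc.comp (tendsto_id.atTop_mul_const hb)).neg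
    simp only [Nat.cast_zero, neg_zero, zpow_zero, one_mul, zero_add, jumpTerm, pow_zero,
      Nat.factorial_zero, Nat.cast_one, div_one, mul_one]
    rcases lt_trichotomy a 0 with h | rfl | h
    · have := (hpos (-a) (by linarith)).neg
      simp only [mul_neg, cosMoment_one_neg, neg_neg] at this
      simpa [sign_neg h] using this
    · have : cosMoment 1 0 = 0 := by rw [cosMoment_one_eq]; simp
      simp [this]
    · simpa [sign_pos h] using hpos a h
  | succ k ih =>
    have hk : ((k : ℝ) + 1) ≠ 0 := by positivity
    have h1 : Tendsto (fun R : ℝ => R ^ (-((k + 1 : ℕ) : ℤ)) *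
        Real.cos (R * a + Real.pi / 2 * ((k + 2 : ℤ) : ℝ))) atTop (𝓝 0) := by
      have h0 : Tendsto (fun R : ℝ => R ^ (-((k + 1 : ℕ) : ℤ))) atTop (𝓝 0) := by
        simp only [zpow_neg, zpow_natCast]
        exact (tendsto_pow_atTop (by omega)).inv_tendsto_atTop
      refine h0.zero_mul_isBoundedUnder_le ?_
      exact isBoundedUnder_of ⟨1, fun R => Real.abs_cos_le_one _⟩
    have h2 := (h1.neg.sub (ih.const_mul a)).div_const ((k : ℝ) + 1)
    have e : (-0 - a * jumpTerm k a) / ((k : ℝ) + 1) = jumpTerm (k + 1) a := by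
      simp only [jumpTerm, Nat.factorial_succ, pow_succ]
      push_cast
      field_simp
      ring
    rw [e] at h2
    refine h2.congr' ?_
    filter_upwards [eventually_gt_atTop 0] with R hR
    have h3 := cosMoment_recursion (k + 2) (R * a)
    have h4 : (((k + 2 : ℤ) : ℝ) - 1) = k + 1 := by push_cast; ring
    rw [h4, show ((k : ℤ) + 2 - 1) = k + 1 by ring] at h3
    have h5 : R ^ (-(k : ℤ)) = R ^ (-((k + 1 : ℕ) : ℤ)) * R := by
      rw [← zpow_add_one₀ hR.ne']; congr 1; push_cast; ring
    rw [show (((k + 1 : ℕ) : ℤ) + 1) = k + 2 by push_cast; ring]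
    rw [div_eq_iff hk, h5]
    linear_combination (-(R ^ (-((k + 1 : ℕ) : ℤ)))) * h3

/-! ### The real form of the kernel -/

theorem cos_add_pi_mul_int (y : ℝ) (n : ℤ) :
    Real.cos (y + Real.pi * n) = (-1) ^ n * Real.cos y := by
  rw [mul_comm, Real.cos_add_int_mul_pi]

/-- The second frequency is taken as -(u₁ + u₂), so that both cosines have the phase π(x₁ - x₂)/2
required by `cosMoment`; the price is the sign (-1)^x₁. -/
theorem realIntegrand_eq (x₁ x₂ : ℤ) (u₁ u₂ t : ℝ) :
    realIntegrand x₁ u₁ x₂ u₂ t =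
      1 / 2 * (t ^ (-(x₁ - x₂)) * Real.cos (t * (u₁ - u₂) + Real.pi / 2 * ((x₁ - x₂ : ℤ) : ℝ))) +
      (-1) ^ x₁ / 2 *
        (t ^ (-(x₁ - x₂)) * Real.cos (t * -(u₁ + u₂) + Real.pi / 2 * ((x₁ - x₂ : ℤ) : ℝ))) := by
  have h1 := Real.two_mul_cos_mul_cos (t * u₁ + Real.pi / 2 * x₁) (t * u₂ + Real.pi / 2 * x₂)
  rw [show t * u₁ + Real.pi / 2 * x₁ - (t * u₂ + Real.pi / 2 * x₂) =
      t * (u₁ - u₂) + Real.pi / 2 * ((x₁ - x₂ : ℤ) : ℝ) by push_cast; ring,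
    show t * u₁ + Real.pi / 2 * x₁ + (t * u₂ + Real.pi / 2 * x₂) =
      -(t * -(u₁ + u₂) + Real.pi / 2 * ((x₁ - x₂ : ℤ) : ℝ)) + Real.pi * x₁ by push_cast; ring,
    cos_add_pi_mul_int, Real.cos_neg] at h1
  rw [realIntegrand, neg_sub, mul_assoc]
  linear_combination (t ^ (x₂ - x₁) / 2) * h1

theorem intervalIntegrable_zpow_mul_cos_one (m : ℤ) (a : ℝ) {R : ℝ} (hR : 1 ≤ R) :
    IntervalIntegrable (fun t : ℝ => t ^ (-m) * Real.cos (t * a + Real.pi / 2 * m)) volume 1 R := by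
  apply ContinuousOn.intervalIntegrable
  refine (continuousOn_id.zpow₀ _ fun t ht => Or.inl ?_).mul (by fun_prop)
  rw [Set.uIcc_of_le hR] at ht
  simp only [id]; linarith [ht.1]

/-- The part of the kernel given by power series. -/
def seriesPart (x₁ x₂ : ℤ) (u₁ u₂ : ℝ) : ℝ :=
  1 / Real.pi * (cosMoment (x₁ - x₂) (u₁ - u₂) + (-1) ^ x₁ * cosMoment (x₁ - x₂) (-(u₁ + u₂)))

theorem realKernel_of_le {x₁ x₂ : ℤ} (h : x₁ ≤ x₂) (u₁ u₂ : ℝ) :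
    realKernel x₁ u₁ x₂ u₂ = seriesPart x₁ x₂ u₁ u₂ := by
  have hi : ∀ a : ℝ, IntervalIntegrable (fun t : ℝ => t ^ (-(x₁ - x₂)) *
      Real.cos (t * a + Real.pi / 2 * ((x₁ - x₂ : ℤ) : ℝ))) volume 0 1 := by
    intro a
    obtain ⟨k, hk⟩ : ∃ k : ℕ, -(x₁ - x₂) = k := ⟨(x₂ - x₁).toNat, by omega⟩
    apply Continuous.intervalIntegrable
    rw [hk]
    simp only [zpow_natCast]
    fun_prop
  have hm : x₁ - x₂ ≤ 0 := by omega
  rw [realKernel, if_pos h]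
  simp_rw [realIntegrand_eq]
  rw [intervalIntegral.integral_add ((hi _).const_mul _) ((hi _).const_mul _),
    intervalIntegral.integral_const_mul, intervalIntegral.integral_const_mul,
    integral_zero_one_zpow_mul_cos hm, integral_zero_one_zpow_mul_cos hm, seriesPart]
  ring

/-- The value of the improper integral for `x₂ < x₁`, with `k = x₁ - x₂ - 1`. -/
theorem tendsto_integral_realIntegrand {x₁ x₂ : ℤ} {k : ℕ} (h : x₁ - x₂ = k + 1) (u₁ u₂ : ℝ) :
    Tendsto (fun R : ℝ => -(2 / Real.pi) * ∫ t in (1 : ℝ)..R, realIntegrand x₁ u₁ x₂ u₂ t) atTop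
      (𝓝 (seriesPart x₁ x₂ u₁ u₂ -
        1 / Real.pi * (jumpTerm k (u₁ - u₂) + (-1) ^ x₁ * jumpTerm k (-(u₁ + u₂))))) := by
  have h1 := tendsto_zpow_mul_cosMoment k (u₁ - u₂)
  have h2 := tendsto_zpow_mul_cosMoment k (-(u₁ + u₂))
  have h3 := ((h1.sub_const (cosMoment (k + 1) (u₁ - u₂))).add
    ((h2.sub_const (cosMoment (k + 1) (-(u₁ + u₂)))).const_mul ((-1) ^ x₁))).const_mul
      (-(1 / Real.pi))
  convert! h3.congr' ?_ using 2
  · rw [seriesPart, h]; ring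
  · filter_upwards [eventually_ge_atTop 1] with R hR
    simp_rw [realIntegrand_eq]
    rw [intervalIntegral.integral_add
      ((intervalIntegrable_zpow_mul_cos_one _ _ hR).const_mul _)
      ((intervalIntegrable_zpow_mul_cos_one _ _ hR).const_mul _),
      intervalIntegral.integral_const_mul, intervalIntegral.integral_const_mul,
      integral_one_zpow_mul_cos _ _ hR, integral_one_zpow_mul_cos _ _ hR, h,
      show (1 - ((k : ℤ) + 1)) = -k by ring]
    ring

theorem realKernel_of_lt {x₁ x₂ : ℤ} {k : ℕ} (h : x₁ - x₂ = k + 1) (u₁ u₂ : ℝ) :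
    realKernel x₁ u₁ x₂ u₂ = seriesPart x₁ x₂ u₁ u₂ -
        1 / Real.pi * (jumpTerm k (u₁ - u₂) + (-1) ^ x₁ * jumpTerm k (-(u₁ + u₂))) := by
  have h1 := tendsto_integral_realIntegrand h u₁ u₂
  have hpi : -(2 / Real.pi) ≠ 0 := by simp [Real.pi_ne_zero]
  have h2 := h1.const_mul (-(2 / Real.pi))⁻¹
  simp only [inv_mul_cancel_left₀ hpi] at h2
  rw [realKernel, if_neg (by omega), h2.limUnder_eq, mul_inv_cancel_left₀ hpi]

theorem exists_ge_eq_of_tendsto_atTop {g : ℝ → ℝ} (hg : Continuous g) (h : Tendsto g atTop atTop)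
    (T y : ℝ) (hy : g T ≤ y) : ∃ t, T ≤ t ∧ g t = y := by
  obtain ⟨S, hS, hSy⟩ := ((eventually_ge_atTop T).and (h.eventually_ge_atTop y)).exists
  obtain ⟨t, ht, hty⟩ := intermediate_value_Icc hS hg.continuousOn ⟨hy, hSy⟩
  exact ⟨t, ht.1, hty⟩

/-! ### Unbounded curves -/

namespace IsUnboundedCurve

variable {γ : ℝ → ℂ}

theorem tendsto_re_atTop (hγ : IsUnboundedCurve γ) : Tendsto (fun t => (γ t).re) atTop atTop :=
  hγ.tendsto_re.mono_left (by rw [cocompact_eq_atBot_atTop]; exact le_sup_right)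

theorem tendsto_re_neg_atTop (hγ : IsUnboundedCurve γ) :
    Tendsto (fun t => (γ (-t)).re) atTop atTop :=
  (hγ.tendsto_re.mono_left (by rw [cocompact_eq_atBot_atTop]; exact le_sup_left)).comp
    tendsto_neg_atTop_atBot

theorem exists_re_gt (hγ : IsUnboundedCurve γ) (X : ℝ) :
    ∃ T, 0 < T ∧ ∀ t, T ≤ t → X < (γ t).re ∧ X < (γ (-t)).re := by
  obtain ⟨T, hT⟩ := ((eventually_gt_atTop 0).and ((hγ.tendsto_re_atTop.eventually_gt_atTop X).and
    (hγ.tendsto_re_neg_atTop.eventually_gt_atTop X))).exists_forall_of_atTop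
  exact ⟨T, (hT T le_rfl).1, fun t ht => (hT t ht).2⟩

theorem exists_countable_hasDerivAt (hγ : IsUnboundedCurve γ) :
    ∃ S : Set ℝ, S.Countable ∧ ∀ t ∉ S, HasDerivAt γ (deriv γ t) t := by
  obtain ⟨S, h, -⟩ := hγ.piecewiseC1
  exact ⟨S, S.countable_toSet, fun t ht => (h t ⟨trivial, ht⟩).hasDerivAt⟩

theorem intervalIntegral_eq (hγ : IsUnboundedCurve γ) {F f : ℂ → ℂ} {a b : ℝ}
    (hF : ∀ t ∈ Set.uIcc a b, HasDerivAt F (f (γ t)) (γ t))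
    (hint : IntervalIntegrable (fun t => f (γ t) * deriv γ t) volume a b) :
    ∫ t in a..b, f (γ t) * deriv γ t = F (γ b) - F (γ a) := by
  obtain ⟨S, hS, hd⟩ := hγ.exists_countable_hasDerivAt
  refine integral_eq_of_hasDerivAt_off_countable (fun t => F (γ t)) _ hS
    (fun t ht => (((hF t ht).continuousAt).comp hγ.continuous.continuousAt).continuousWithinAt)
    (fun t ht => ?_) hint
  exact (hF t (Set.Ioo_subset_Icc_self ht.1)).comp t (hd t ht.2)

/-- A primitive of a function that is small on vertical lines takes asymptotically equal values at
the two ends of an unbounded curve. -/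
theorem tendsto_ends_sub (hγ : IsUnboundedCurve γ) {F f : ℂ → ℂ} {X : ℝ}
    (hF : ∀ w : ℂ, X < w.re → HasDerivAt F (f w) w)
    (hint : Integrable (fun t => f (γ t) * deriv γ t))
    (hf : ∀ B ε : ℝ, 0 < ε →
      ∀ᶠ N : ℕ in atTop, ∀ w : ℂ, w.re = N + 1 / 2 → |w.im| ≤ B → ‖f w‖ ≤ ε) :
    Tendsto (fun T => F (γ T) - F (γ (-T))) atTop (𝓝 0) := by
  obtain ⟨T₀, hT₀, hX⟩ := hγ.exists_re_gt X
  -- Integrability along the curve gives F a limit at each end separately; it remains to compare the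
  -- two limits.
  have h1 : ∃ L, Tendsto (fun T => F (γ T)) atTop (𝓝 L) := by
    have h := (intervalIntegral_tendsto_integral_Ioi T₀ hint.integrableOn tendsto_id).add_const
      (F (γ T₀))
    refine ⟨_, h.congr' ?_⟩
    filter_upwards [eventually_ge_atTop T₀] with T hT
    rw [id, hγ.intervalIntegral_eq (F := F) (fun t ht => hF _ ?_) hint.intervalIntegrable]
    · ring
    · rw [Set.uIcc_of_le hT] at ht
      exact (hX t ht.1).1
  have h2 : ∃ L, Tendsto (fun T => F (γ (-T))) atTop (𝓝 L) := by
    have h := ((intervalIntegral_tendsto_integral_Iic (-T₀) hint.integrableOn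
      tendsto_neg_atTop_atBot).neg).add_const (F (γ (-T₀)))
    refine ⟨_, h.congr' ?_⟩
    filter_upwards [eventually_ge_atTop T₀] with T hT
    rw [hγ.intervalIntegral_eq (F := F) (fun t ht => hF _ ?_) hint.intervalIntegrable]
    · ring
    · rw [Set.uIcc_of_le (neg_le_neg hT)] at ht
      simpa using (hX (-t) (by linarith [ht.2])).2
  obtain ⟨L₁, hL₁⟩ := h1
  obtain ⟨L₂, hL₂⟩ := h2
  have hL := hL₁.sub hL₂
  suffices L₁ - L₂ = 0 by rwa [this] at hL
  by_contra hne
  set D := ‖L₁ - L₂‖ with hD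
  have hD0 : 0 < D := norm_pos_iff.2 hne
  obtain ⟨B, hB⟩ := hγ.bounded_im
  have hB0 : 0 ≤ B := (abs_nonneg _).trans (hB 0)
  obtain ⟨T₁, hT₁⟩ := ((eventually_ge_atTop T₀).and
    ((Metric.tendsto_nhds.1 hL₁ (D / 4) (by positivity)).and
    (Metric.tendsto_nhds.1 hL₂ (D / 4) (by positivity)))).exists_forall_of_atTop
  -- Both ends cross the line Re w = N + 1/2, at points at most 2B apart. With |f| below this ε
  -- there, F changes by at most D/4 between the crossings. Each crossing value is within D/4 of its
  -- limit, so the limits would differ by less than D.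
  have hε : 0 < D / (4 * (2 * B + 1)) := by positivity
  obtain ⟨N, hN, hNB⟩ := ((hf B _ hε).and (eventually_ge_atTop
    ⌈max X (max (γ T₁).re (γ (-T₁)).re)⌉₊)).exists
  have hN2 : max X (max (γ T₁).re (γ (-T₁)).re) ≤ N := (Nat.le_ceil _).trans (by exact_mod_cast hNB)
  simp only [max_le_iff] at hN2
  obtain ⟨t₁, ht₁, e₁⟩ := exists_ge_eq_of_tendsto_atTop (Complex.continuous_re.comp hγ.continuous)
    hγ.tendsto_re_atTop T₁ (N + 1 / 2) (by simp only [Function.comp]; linarith)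
  obtain ⟨t₂, ht₂, e₂⟩ := exists_ge_eq_of_tendsto_atTop (g := fun t => (γ (-t)).re)
    (Complex.continuous_re.comp (hγ.continuous.comp continuous_neg))
    hγ.tendsto_re_neg_atTop T₁ (N + 1 / 2) (by linarith)
  simp only [Function.comp] at e₁
  have hconv : Convex ℝ {w : ℂ | w.re = N + 1 / 2 ∧ |w.im| ≤ B} := by
    intro z hz w hw a b ha hb hab
    simp only [Set.mem_ofPred_eq, Complex.add_re, Complex.add_im, Complex.real_smul,
      Complex.mul_re, Complex.mul_im, Complex.ofReal_re, Complex.ofReal_im, zero_mul, sub_zero,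
      add_zero] at hz hw ⊢
    rw [abs_le] at hz hw ⊢
    refine ⟨by rw [hz.1, hw.1, ← add_mul, hab, one_mul], ?_, ?_⟩ <;> nlinarith [hz.2.1, hz.2.2, hw.2.1, hw.2.2]
  have hmv := hconv.norm_image_sub_le_of_norm_hasDerivWithin_le (𝕜 := ℂ) (f := F) (f' := f)
    (x := γ (-t₂)) (y := γ t₁)
    (fun w hw => (hF w (by rw [hw.1]; linarith)).hasDerivWithinAt) (fun w hw => hN w hw.1 hw.2)
    ⟨e₂, hB _⟩ ⟨e₁, hB _⟩
  have hdist : ‖γ t₁ - γ (-t₂)‖ ≤ 2 * B := by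
    refine (Complex.norm_le_abs_re_add_abs_im _).trans ?_
    rw [Complex.sub_re, Complex.sub_im, e₁, e₂, sub_self, abs_zero, zero_add]
    exact (abs_sub _ _).trans (by linarith [hB t₁, hB (-t₂)])
  have h3 : ‖F (γ t₁) - F (γ (-t₂))‖ ≤ D / 4 := by
    refine hmv.trans ((mul_le_mul_of_nonneg_left hdist hε.le).trans ?_)
    rw [div_mul_eq_mul_div, div_le_div_iff₀ (by positivity) (by positivity)]
    nlinarith
  have h4 := (hT₁ t₁ ht₁).2.1
  have h5 := (hT₁ t₂ ht₂).2.2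
  rw [dist_eq_norm] at h4 h5
  have : D ≤ ‖F (γ t₁) - F (γ (-t₂))‖ + ‖F (γ t₁) - L₁‖ + ‖F (γ (-t₂)) - L₂‖ := by
    have e : L₁ - L₂ = (F (γ t₁) - F (γ (-t₂))) - (F (γ t₁) - L₁) + (F (γ (-t₂)) - L₂) := by ring
    rw [hD, e]
    exact (norm_add_le _ _).trans (add_le_add_left (norm_sub_le _ _) _)
  linarith

end IsUnboundedCurve

theorem IsClosedCurve.exists_countable_hasDerivAt {γ : ℝ → ℂ} (hγ : IsClosedCurve γ) :
    ∃ S : Set ℝ, S.Countable ∧ ∀ t ∈ Set.Ioo (0 : ℝ) 1, t ∉ S → HasDerivAt γ (deriv γ t) t := by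
  obtain ⟨S, h, -⟩ := hγ.piecewiseC1
  exact ⟨S, S.countable_toSet, fun t ht hS => (h t ⟨ht, hS⟩).hasDerivAt⟩

/-! ### Integrals over contours -/

namespace Contour

variable (C : Contour)

theorem measurableSet_dom (c : Option (Fin C.numLoops)) : MeasurableSet (C.dom c) := by
  cases c
  · exact MeasurableSet.univ
  · exact measurableSet_Icc

theorem continuousOn_piece (c : Option (Fin C.numLoops)) : ContinuousOn (C.piece c) (C.dom c) := by
  cases c
  · exact C.isUnboundedCurve_arm.continuous.continuousOn
  · exact (C.isClosedCurve_loop _).continuousOn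

variable {C} in
theorem piece_mem_support {c : Option (Fin C.numLoops)} {t : ℝ} (ht : t ∈ C.dom c) :
    C.piece c t ∈ C.support :=
  Set.mem_iUnion.2 ⟨c, t, ht, rfl⟩

theorem exists_countable_hasDerivAt (c : Option (Fin C.numLoops)) :
    ∃ S : Set ℝ, S.Countable ∧ ∀ t ∈ interior (C.dom c), t ∉ S →
      HasDerivAt (C.piece c) (deriv (C.piece c) t) t := by
  cases c with
  | none =>
    obtain ⟨S, hS, h⟩ := C.isUnboundedCurve_arm.exists_countable_hasDerivAt
    exact ⟨S, hS, fun t _ => h t⟩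
  | some i =>
    obtain ⟨S, hS, h⟩ := (C.isClosedCurve_loop i).exists_countable_hasDerivAt
    refine ⟨S, hS, fun t ht => h t ?_⟩
    simpa [dom, interior_Icc] using ht

theorem integrableOn_length (c : Option (Fin C.numLoops)) :
    IntegrableOn (fun t => Real.exp (-(C.piece c t).re) * ‖deriv (C.piece c) t‖) (C.dom c) := by
  cases c with
  | none => exact C.isUnboundedCurve_arm.integrable_length.integrableOn
  | some i =>
    exact (C.isClosedCurve_loop i).integrable_length.continuousOn_mul
      (Real.continuous_exp.comp_continuousOn (Complex.continuous_re.comp_continuousOn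
        (C.isClosedCurve_loop i).continuousOn).neg) isCompact_Icc

/-- The length of a contour, weighted by `exp (- Re)`. -/
def weightedLength : ℝ :=
  ∑ c, ∫ t in C.dom c, Real.exp (-(C.piece c t).re) * ‖deriv (C.piece c) t‖

variable {C}

theorem norm_piece_mul_deriv_le {h : ℂ → ℂ} {A : ℝ}
    (hA : ∀ w ∈ C.support, ‖h w‖ ≤ A * Real.exp (-w.re)) {c : Option (Fin C.numLoops)} {t : ℝ}
    (ht : t ∈ C.dom c) :
    ‖h (C.piece c t) * deriv (C.piece c) t‖ ≤
      A * (Real.exp (-(C.piece c t).re) * ‖deriv (C.piece c) t‖) := by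
  rw [norm_mul, ← mul_assoc]
  exact mul_le_mul_of_nonneg_right (hA _ (piece_mem_support ht)) (norm_nonneg _)

theorem aestronglyMeasurable_piece {h : ℂ → ℂ} (hc : ContinuousOn h C.support)
    (c : Option (Fin C.numLoops)) :
    AEStronglyMeasurable (fun t => h (C.piece c t)) (volume.restrict (C.dom c)) :=
  (hc.comp (C.continuousOn_piece c) fun _ ht => piece_mem_support ht).aestronglyMeasurable
    (C.measurableSet_dom c)

theorem integrableOn_piece {h : ℂ → ℂ} {A : ℝ} (hc : ContinuousOn h C.support)
    (hA : ∀ w ∈ C.support, ‖h w‖ ≤ A * Real.exp (-w.re)) (c : Option (Fin C.numLoops)) :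
    IntegrableOn (fun t => h (C.piece c t) * deriv (C.piece c) t) (C.dom c) := by
  refine ((C.integrableOn_length c).const_mul A).mono'
    ((aestronglyMeasurable_piece hc c).mul (measurable_deriv _).aestronglyMeasurable) ?_
  filter_upwards [ae_restrict_mem (C.measurableSet_dom c)] with t ht
  exact norm_piece_mul_deriv_le hA ht

theorem norm_integral_le {h : ℂ → ℂ} {A : ℝ}
    (hA : ∀ w ∈ C.support, ‖h w‖ ≤ A * Real.exp (-w.re)) :
    ‖C.integral h‖ ≤ A * C.weightedLength := by
  rw [integral, weightedLength, Finset.mul_sum]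
  refine norm_sum_le_of_le _ fun c _ => ?_
  rw [← integral_const_mul]
  refine norm_integral_le_of_norm_le ((C.integrableOn_length c).const_mul A) ?_
  filter_upwards [ae_restrict_mem (C.measurableSet_dom c)] with t ht
  exact norm_piece_mul_deriv_le hA ht

theorem integral_congr {f g : ℂ → ℂ} (h : ∀ w ∈ C.support, f w = g w) :
    C.integral f = C.integral g :=
  Finset.sum_congr rfl fun c _ => setIntegral_congr_fun (C.measurableSet_dom c) fun t ht => by
    simp only [h _ (piece_mem_support ht)]

theorem integral_add {f g : ℂ → ℂ} {A B : ℝ} (hf : ContinuousOn f C.support)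
    (hA : ∀ w ∈ C.support, ‖f w‖ ≤ A * Real.exp (-w.re)) (hg : ContinuousOn g C.support)
    (hB : ∀ w ∈ C.support, ‖g w‖ ≤ B * Real.exp (-w.re)) :
    C.integral (fun w => f w + g w) = C.integral f + C.integral g := by
  simp only [integral]
  rw [← Finset.sum_add_distrib]
  refine Finset.sum_congr rfl fun c _ => ?_
  simp_rw [add_mul]
  exact MeasureTheory.integral_add (integrableOn_piece hf hA c) (integrableOn_piece hg hB c)

theorem integral_const_mul (r : ℂ) (f : ℂ → ℂ) :
    C.integral (fun w => r * f w) = r * C.integral f := by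
  simp only [integral, Finset.mul_sum, mul_assoc, MeasureTheory.integral_const_mul]

theorem hasSum_integral {f : ℕ → ℂ → ℂ} {A : ℕ → ℝ} (hf : ∀ n, ContinuousOn (f n) C.support)
    (hA : ∀ n, ∀ w ∈ C.support, ‖f n w‖ ≤ A n * Real.exp (-w.re)) (hs : Summable A) :
    HasSum (fun n => C.integral (f n)) (C.integral fun w => ∑' n, f n w) := by
  refine hasSum_sum fun c _ => ?_
  have h := hasSum_integral_of_summable_integral_norm
    (fun n => integrableOn_piece (hf n) (hA n) c) ?_
  · simp_rw [tsum_mul_right] at h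
    exact h
  · refine Summable.of_nonneg_of_le (fun n => integral_nonneg fun t => norm_nonneg _) (fun n => ?_)
      (hs.mul_right (∫ t in C.dom c, Real.exp (-(C.piece c t).re) * ‖deriv (C.piece c) t‖))
    rw [← MeasureTheory.integral_const_mul]
    refine integral_mono_ae (integrableOn_piece (hf n) (hA n) c).norm
      ((C.integrableOn_length c).const_mul _) ?_
    filter_upwards [ae_restrict_mem (C.measurableSet_dom c)] with t ht
    exact norm_piece_mul_deriv_le (hA n) ht

theorem integral_loop_eq_zero {F f : ℂ → ℂ} (i : Fin C.numLoops)
    (hF : ∀ w ∈ C.support, HasDerivAt F (f w) w)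
    (hint : IntegrableOn (fun t => f (C.loop i t) * deriv (C.loop i) t) (Set.Icc 0 1)) :
    ∫ t in Set.Icc (0 : ℝ) 1, f (C.loop i t) * deriv (C.loop i) t = 0 := by
  have hl := C.isClosedCurve_loop i
  have hm : ∀ t ∈ Set.Icc (0 : ℝ) 1, C.loop i t ∈ C.support := fun t ht =>
    piece_mem_support (c := some i) ht
  obtain ⟨S, hS, hd⟩ := hl.exists_countable_hasDerivAt
  rw [integral_Icc_eq_integral_Ioc, ← intervalIntegral.integral_of_le zero_le_one,
    integral_eq_of_hasDerivAt_off_countable (fun t => F (C.loop i t)) _ hS, hl.closed, sub_self]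
  · rw [Set.uIcc_of_le zero_le_one]
    exact fun t ht => ((hF _ (hm t ht)).continuousAt).comp_continuousWithinAt (hl.continuousOn t ht)
  · intro t ht
    simp only [zero_le_one, min_eq_left, max_eq_right] at ht
    exact (hF _ (hm t (Set.Ioo_subset_Icc_self ht.1))).comp t (hd t ht.1 ht.2)
  · rw [intervalIntegrable_iff_integrableOn_Icc_of_le zero_le_one]
    exact hint

theorem integral_eq_zero_of_hasDerivAt {F f : ℂ → ℂ}
    (hint : ∀ c, IntegrableOn (fun t => f (C.piece c t) * deriv (C.piece c) t) (C.dom c))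
    (hF : ∀ w ∈ C.support, HasDerivAt F (f w) w)
    (hends : Tendsto (fun T => F (C.arm T) - F (C.arm (-T))) atTop (𝓝 0)) :
    C.integral f = 0 := by
  rw [integral, Fintype.sum_option]
  have h1 : ∀ i : Fin C.numLoops, ∫ t in C.dom (some i), f (C.piece (some i) t) *
      deriv (C.piece (some i)) t = 0 := fun i => integral_loop_eq_zero i hF (hint (some i))
  have hi : Integrable (fun t => f (C.arm t) * deriv C.arm t) := by
    simpa [dom, piece] using hint none
  have h2 : ∫ t, f (C.arm t) * deriv C.arm t = 0 := by
    refine tendsto_nhds_unique (intervalIntegral_tendsto_integral hi tendsto_neg_atTop_atBot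
      tendsto_id) (hends.congr fun T => ?_)
    rw [C.isUnboundedCurve_arm.intervalIntegral_eq (F := F)
      (fun t _ => hF _ (piece_mem_support (c := none) trivial)) hi.intervalIntegrable]
    rfl
  simp only [h1, Finset.sum_const_zero, add_zero]
  simpa [dom, piece] using h2

/-- Cauchy's theorem for these contours: an entire function has a global primitive, so the loops
contribute nothing, and the two ends of the arm cancel by `tendsto_ends_sub`. -/
theorem integral_eq_zero_of_differentiable {g : ℂ → ℂ} (hg : Differentiable ℂ g) {A : ℝ}
    (hA : ∀ w ∈ C.support, ‖g w‖ ≤ A * Real.exp (-w.re))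
    (hl : ∀ B ε : ℝ, 0 < ε →
      ∀ᶠ N : ℕ in atTop, ∀ w : ℂ, w.re = N + 1 / 2 → |w.im| ≤ B → ‖g w‖ ≤ ε) :
    C.integral g = 0 := by
  obtain ⟨F, hF⟩ := hg.isExactOn_univ
  have hF : ∀ w, HasDerivAt F (g w) w := fun w => hF w trivial
  have hint := integrableOn_piece hg.continuous.continuousOn hA
  refine integral_eq_zero_of_hasDerivAt hint (fun w _ => hF w) ?_
  exact C.isUnboundedCurve_arm.tendsto_ends_sub (X := 0) (fun w _ => hF w)
    (by simpa [dom, piece] using hint none) hl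

end Contour

/-! ### The decaying Cauchy kernel and winding numbers. -/

/-- The rapidly decaying Cauchy kernel `exp (p - w) / (w - p)`. -/
def cauchyExp (p w : ℂ) : ℂ := Complex.exp (-(w - p)) / (w - p)

theorem norm_cauchyExp (p w : ℂ) :
    ‖cauchyExp p w‖ = Real.exp p.re * Real.exp (-w.re) / ‖w - p‖ := by
  rw [cauchyExp, norm_div, Complex.norm_exp, ← Real.exp_add]
  congr 2
  simp only [Complex.neg_re, Complex.sub_re]; ring

theorem norm_cauchyExp_le {p w : ℂ} {δ : ℝ} (hδ : 0 < δ) (h : δ ≤ ‖w - p‖) :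
    ‖cauchyExp p w‖ ≤ Real.exp p.re / δ * Real.exp (-w.re) := by
  rw [norm_cauchyExp, div_mul_eq_mul_div]
  gcongr

theorem hasDerivAt_cauchyExp {p w : ℂ} (h : w ≠ p) :
    HasDerivAt (cauchyExp p)
      (-(Complex.exp (-(w - p)) / (w - p) + Complex.exp (-(w - p)) / (w - p) ^ 2)) w := by
  have h1 := (((hasDerivAt_id w).sub_const p).neg.cexp).div ((hasDerivAt_id w).sub_const p)
    (sub_ne_zero.2 h)
  refine h1.congr_deriv ?_
  have := sub_ne_zero.2 h
  simp only [id, Pi.neg_apply]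
  field_simp
  ring

theorem eventually_mul_exp_neg_le (A : ℝ) {ε : ℝ} (hε : 0 < ε) :
    ∀ᶠ N : ℕ in atTop, A * Real.exp (-((N : ℝ) + 1 / 2)) ≤ ε := by
  have h : Tendsto (fun N : ℕ => A * Real.exp (-((N : ℝ) + 1 / 2))) atTop (𝓝 (A * 0)) := by
    refine Tendsto.const_mul A (Real.tendsto_exp_neg_atTop_nhds_zero.comp ?_)
    exact tendsto_atTop_add_const_right _ _ tendsto_natCast_atTop_atTop
  rw [mul_zero] at h
  exact (h.eventually_lt_const hε).mono fun N hN => hN.le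

theorem cauchyExp_small_on_lines (p : ℂ) (B ε : ℝ) (hε : 0 < ε) :
    ∀ᶠ N : ℕ in atTop, ∀ w : ℂ, w.re = N + 1 / 2 → |w.im| ≤ B → ‖cauchyExp p w‖ ≤ ε := by
  filter_upwards [eventually_mul_exp_neg_le (Real.exp p.re / 1) hε,
    eventually_ge_atTop ⌈p.re + 1⌉₊] with N hN hN1 w hw _
  have h1 : p.re + 1 ≤ N := (Nat.le_ceil _).trans (by exact_mod_cast hN1)
  have h2 : (1 : ℝ) ≤ ‖w - p‖ := by
    refine le_trans ?_ ((le_abs_self _).trans (Complex.abs_re_le_norm _))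
    rw [Complex.sub_re, hw]; linarith
  refine (norm_cauchyExp_le one_pos h2).trans ?_
  rwa [hw]

namespace Contour

variable {C : Contour}

theorem continuousOn_cauchyExp {p : ℂ} (hp : p ∉ C.support) :
    ContinuousOn (cauchyExp p) C.support := fun w hw =>
  (hasDerivAt_cauchyExp (w := w) (p := p) (by rintro rfl; exact hp hw)).continuousAt.continuousWithinAt

theorem notMem_support_of_le {p : ℂ} {δ : ℝ} (hδ : 0 < δ) (hp : ∀ w ∈ C.support, δ ≤ ‖w - p‖) :
    p ∉ C.support := fun h => by
  have := hp p h
  rw [sub_self, norm_zero] at this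
  linarith

theorem integrableOn_piece_inter_Icc {f : ℂ → ℂ} (hf : ContinuousOn f C.support)
    (c : Option (Fin C.numLoops)) (T : ℝ) :
    IntegrableOn (fun t => f (C.piece c t) * deriv (C.piece c) t) (C.dom c ∩ Set.Icc (-T) T) := by
  have hK : IsCompact (C.dom c ∩ Set.Icc (-T) T) := by
    cases c
    · simpa [dom] using isCompact_Icc
    · exact isCompact_Icc.inter_right isClosed_Icc
  have hcont : ContinuousOn (C.piece c) (C.dom c ∩ Set.Icc (-T) T) :=
    (C.continuousOn_piece c).mono Set.inter_subset_left
  have h1 := ((C.integrableOn_length c).mono_set Set.inter_subset_left).continuousOn_mul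
    (g := fun t => Real.exp ((C.piece c t).re))
    (Real.continuous_exp.comp_continuousOn (Complex.continuous_re.comp_continuousOn hcont)) hK
  have h2 : IntegrableOn (deriv (C.piece c)) (C.dom c ∩ Set.Icc (-T) T) := by
    rw [IntegrableOn, ← integrable_norm_iff (measurable_deriv _).aestronglyMeasurable]
    refine h1.congr (Eventually.of_forall fun t => ?_)
    simp only
    rw [← mul_assoc, ← Real.exp_add, add_neg_cancel, Real.exp_zero, one_mul]
  exact h2.continuousOn_mul (hf.comp hcont fun t ht => piece_mem_support ht.1) hK

end Contour

/-- `HasWindingNumber` controls only the imaginary part of dζ/(ζ - p). The real part has the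
primitive log |ζ - p|, which needs no choice of branch. -/
theorem integral_re_log_deriv {γ : ℝ → ℂ} {p : ℂ} {a b : ℝ} (hab : a ≤ b) {S : Set ℝ}
    (hS : S.Countable) (hc : ContinuousOn γ (Set.Icc a b)) (hp : ∀ t ∈ Set.Icc a b, γ t ≠ p)
    (hd : ∀ t ∈ Set.Ioo a b, t ∉ S → HasDerivAt γ (deriv γ t) t)
    (hint : IntegrableOn (fun t => (γ t - p)⁻¹ * deriv γ t) (Set.Icc a b)) :
    ∫ t in Set.Icc a b, ((γ t - p)⁻¹ * deriv γ t).re =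
      Real.log ‖γ b - p‖ - Real.log ‖γ a - p‖ := by
  rw [integral_Icc_eq_integral_Ioc, ← intervalIntegral.integral_of_le hab]
  refine integral_eq_of_hasDerivAt_off_countable (fun t => Real.log ‖γ t - p‖) _ hS ?_ ?_ ?_
  · rw [Set.uIcc_of_le hab]
    refine ContinuousOn.log (hc.sub continuousOn_const).norm fun t ht => ?_
    exact norm_ne_zero_iff.2 (sub_ne_zero.2 (hp t ht))
  · intro t ht
    rw [min_eq_left hab, max_eq_right hab] at ht
    have hne := sub_ne_zero.2 (hp t (Set.Ioo_subset_Icc_self ht.1))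
    have h1 := (hd t ht.1 ht.2).sub_const p
    have hre : HasDerivAt (fun t => (γ t - p).re) (deriv γ t).re t :=
      Complex.reCLM.hasFDerivAt.comp_hasDerivAt t h1
    have him : HasDerivAt (fun t => (γ t - p).im) (deriv γ t).im t :=
      Complex.imCLM.hasFDerivAt.comp_hasDerivAt t h1
    have hns : Complex.normSq (γ t - p) ≠ 0 := Complex.normSq_eq_zero.not.2 hne
    have h2 := (((hre.mul hre).add (him.mul him)).log (by
      simpa [Complex.normSq_apply] using hns)).const_mul (1 / 2)
    have e : (fun t => Real.log ‖γ t - p‖) = fun t => 1 / 2 *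
        Real.log ((γ t - p).re * (γ t - p).re + (γ t - p).im * (γ t - p).im) := by
      ext t
      rw [← Complex.normSq_apply, Complex.normSq_eq_norm_sq, Real.log_pow]; push_cast; ring
    rw [e]
    refine h2.congr_deriv ?_
    simp only [Pi.add_apply, Pi.mul_apply]
    rw [← Complex.normSq_apply, Complex.mul_re, Complex.inv_re, Complex.inv_im]
    field_simp
    ring
  · rw [intervalIntegrable_iff_integrableOn_Icc_of_le hab]
    exact hint.re

/-- `exp (p - w) / (w - p) - 1 / (w - p)` has an entire primitive. -/
theorem exists_primitive_cauchyExp_sub (p : ℂ) :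
    ∃ F E : ℂ → ℂ, (∀ w, HasDerivAt F (E w) w) ∧ Continuous E ∧
      ∀ w, w ≠ p → cauchyExp p w = E w + (w - p)⁻¹ := by
  have hdiff : Differentiable ℂ (dslope (fun w => Complex.exp (-(w - p))) p) := by
    rw [← differentiableOn_univ, Complex.differentiableOn_dslope univ_mem]
    fun_prop
  obtain ⟨F, hF⟩ := hdiff.isExactOn_univ
  refine ⟨F, _, fun w => hF w trivial, hdiff.continuous, fun w hw => ?_⟩
  have := sub_ne_zero.2 hw
  rw [dslope_of_ne _ hw, slope_def_field, cauchyExp]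
  simp only [sub_self, neg_zero, Complex.exp_zero]
  field_simp
  ring

theorem IsUnboundedCurve.tendsto_arg {γ : ℝ → ℂ} (hγ : IsUnboundedCurve γ) (p : ℂ)
    {l : Filter ℝ} {σ : ℝ → ℝ} (hσ : Tendsto (fun T => (γ (σ T)).re) l atTop) :
    Tendsto (fun T => Complex.arg (γ (σ T) - p)) l (𝓝 0) := by
  obtain ⟨B, hB⟩ := hγ.bounded_im
  have h0 : Tendsto (fun T => (γ (σ T) - p).im / ‖γ (σ T) - p‖) l (𝓝 0) := by
    have h1 : Tendsto (fun T => (B + |p.im|) / ((γ (σ T)).re - p.re)) l (𝓝 0) :=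
      (tendsto_atTop_add_const_right _ (-p.re) hσ).const_div_atTop _
    refine squeeze_zero_norm' ?_ h1
    filter_upwards [hσ.eventually_gt_atTop p.re] with T hT
    rw [norm_div, norm_norm, Real.norm_eq_abs, Complex.sub_im]
    have h2 : (γ (σ T)).re - p.re ≤ ‖γ (σ T) - p‖ :=
      (le_abs_self _).trans (Complex.abs_re_le_norm (γ (σ T) - p))
    have h3 : |(γ (σ T)).im - p.im| ≤ B + |p.im| := (abs_sub _ _).trans (by linarith [hB (σ T)])
    have h4 : 0 < (γ (σ T)).re - p.re := by linarith
    have h5 := (abs_nonneg _).trans h3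
    gcongr
  have h6 := Real.continuous_arcsin.continuousAt.tendsto.comp h0
  rw [Real.arcsin_zero] at h6
  refine h6.congr' ?_
  filter_upwards [hσ.eventually_gt_atTop p.re] with T hT
  rw [Complex.arg_of_re_nonneg (by rw [Complex.sub_re]; linarith)]
  rfl

namespace Contour

variable {C : Contour}

/-- Split the kernel as E + 1/(w - p) with E = F' entire. To the right of p it has the primitive F +
log(w - p), whose difference between the two ends tends to 0, as do the arguments at both ends. Only
the total change of argument, 2πn, survives. -/
theorem integral_cauchyExp {p : ℂ} {n : ℤ} {δ : ℝ} (hδ : 0 < δ)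
    (hp : ∀ w ∈ C.support, δ ≤ ‖w - p‖) (hw : C.HasWindingNumber p n) :
    C.integral (cauchyExp p) = 2 * Real.pi * Complex.I * n := by
  have hpm := notMem_support_of_le hδ hp
  have hne : ∀ w ∈ C.support, w ≠ p := fun w hw h => hpm (h ▸ hw)
  obtain ⟨F, E, hF, hE, hFE⟩ := exists_primitive_cauchyExp_sub p
  have hγ := C.isUnboundedCurve_arm
  have hint := integrableOn_piece (continuousOn_cauchyExp hpm) (fun w hw => norm_cauchyExp_le hδ (hp w hw))
  have hinv : ContinuousOn (fun w : ℂ => (w - p)⁻¹) C.support :=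
    (continuousOn_id.sub continuousOn_const).inv₀ fun w hw => sub_ne_zero.2 (hne w hw)
  have hEi := fun c T => integrableOn_piece_inter_Icc hE.continuousOn (C := C) c T
  have hIi := fun c T => integrableOn_piece_inter_Icc hinv c T
  have hsplit : ∀ c T, ∫ t in C.dom c ∩ Set.Icc (-T) T,
        cauchyExp p (C.piece c t) * deriv (C.piece c) t =
      (∫ t in C.dom c ∩ Set.Icc (-T) T, E (C.piece c t) * deriv (C.piece c) t) +
      ((∫ t in C.dom c ∩ Set.Icc (-T) T, ((C.piece c t - p)⁻¹ * deriv (C.piece c) t).re : ℝ) +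
        (∫ t in C.dom c ∩ Set.Icc (-T) T, (deriv (C.piece c) t / (C.piece c t - p)).im : ℝ) *
          Complex.I) := by
    intro c T
    have h1 := integral_re_add_im (𝕜 := ℂ) (hIi c T)
    simp only [RCLike.re_to_complex, RCLike.im_to_complex, RCLike.I_to_complex,
      Complex.coe_algebraMap] at h1
    have h2 : ∀ t, (deriv (C.piece c) t / (C.piece c t - p)).im =
        ((C.piece c t - p)⁻¹ * deriv (C.piece c) t).im := fun t => by
      rw [div_eq_inv_mul]
    simp_rw [h2]
    erw [h1]
    rw [← MeasureTheory.integral_add (hEi c T) (hIi c T)]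
    refine setIntegral_congr_fun ((C.measurableSet_dom c).inter measurableSet_Icc) fun t ht => ?_
    rw [hFE _ (hne _ (piece_mem_support ht.1)), add_mul]
  have hloop : ∀ (i : Fin C.numLoops) (T : ℝ), 1 ≤ T →
      C.dom (some i) ∩ Set.Icc (-T) T = Set.Icc 0 1 := fun i T hT =>
    Set.inter_eq_left.2 (Set.Icc_subset_Icc (by linarith) hT)
  set W : ℝ → ℝ := fun T => ∑ c, ∫ t in C.dom c ∩ Set.Icc (-T) T,
    (deriv (C.piece c) t / (C.piece c t - p)).im with hW
  -- The logarithms of moduli are completed to complex logarithms; the arguments added in this way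
  -- are subtracted again.
  have htot : ∀ T, 1 ≤ T → ∑ c, ∫ t in C.dom c ∩ Set.Icc (-T) T,
        cauchyExp p (C.piece c t) * deriv (C.piece c) t =
      ((F (C.arm T) + Complex.log (C.arm T - p)) -
        (F (C.arm (-T)) + Complex.log (C.arm (-T) - p))) -
      (Complex.arg (C.arm T - p) - Complex.arg (C.arm (-T) - p)) * Complex.I + W T * Complex.I := by
    intro T hT
    simp_rw [hsplit]
    rw [Finset.sum_add_distrib, Finset.sum_add_distrib, ← Finset.sum_mul]
    have e1 : ∑ c, ∫ t in C.dom c ∩ Set.Icc (-T) T, E (C.piece c t) * deriv (C.piece c) t =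
        F (C.arm T) - F (C.arm (-T)) := by
      rw [Fintype.sum_option]
      have : ∀ i : Fin C.numLoops, ∫ t in C.dom (some i) ∩ Set.Icc (-T) T,
          E (C.piece (some i) t) * deriv (C.piece (some i)) t = 0 := fun i => by
        rw [hloop i T hT]
        exact integral_loop_eq_zero i (fun w _ => hF w) (by
          have h3 := hEi (some i) T
          rw [hloop i T hT] at h3
          exact h3)
      simp only [this, Finset.sum_const_zero, add_zero]
      have h3 := hEi none T
      simp only [dom, Set.univ_inter, piece] at h3 ⊢
      rw [integral_Icc_eq_integral_Ioc, ← intervalIntegral.integral_of_le (by linarith)]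
      exact hγ.intervalIntegral_eq (fun t _ => hF _)
        ((intervalIntegrable_iff_integrableOn_Icc_of_le (by linarith)).2 h3)
    have e2 : ∑ c, ∫ t in C.dom c ∩ Set.Icc (-T) T,
          ((C.piece c t - p)⁻¹ * deriv (C.piece c) t).re =
        Real.log ‖C.arm T - p‖ - Real.log ‖C.arm (-T) - p‖ := by
      rw [Fintype.sum_option]
      have : ∀ i : Fin C.numLoops, ∫ t in C.dom (some i) ∩ Set.Icc (-T) T,
          ((C.piece (some i) t - p)⁻¹ * deriv (C.piece (some i)) t).re = 0 := fun i => by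
        obtain ⟨S, hS, hd⟩ := (C.isClosedCurve_loop i).exists_countable_hasDerivAt
        have h3 := hIi (some i) T
        rw [hloop i T hT] at h3 ⊢
        simp only [piece] at h3 ⊢
        rw [integral_re_log_deriv zero_le_one hS (C.isClosedCurve_loop i).continuousOn
          (fun t ht => hne _ (piece_mem_support (c := some i) ht)) hd h3,
          (C.isClosedCurve_loop i).closed, sub_self]
      simp only [this, Finset.sum_const_zero, add_zero]
      obtain ⟨S, hS, hd⟩ := hγ.exists_countable_hasDerivAt
      have h3 := hIi none T
      simp only [dom, Set.univ_inter, piece] at h3 ⊢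
      exact integral_re_log_deriv (by linarith) hS hγ.continuous.continuousOn
        (fun t _ => hne _ (piece_mem_support (c := none) trivial)) (fun t _ => hd t) h3
    rw [e1, ← Complex.ofReal_sum, e2, ← Complex.ofReal_sum]
    simp only [Complex.log, hW]
    push_cast
    ring
  have hlim1 : Tendsto (fun T => ∑ c, ∫ t in C.dom c ∩ Set.Icc (-T) T,
      cauchyExp p (C.piece c t) * deriv (C.piece c) t) atTop (𝓝 (C.integral (cauchyExp p))) := by
    refine tendsto_finsetSum _ fun c _ => ?_
    cases c with
    | none =>
      have h3 := hint none
      simp only [dom, Set.univ_inter, piece, IntegrableOn, Measure.restrict_univ] at h3 ⊢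
      refine (intervalIntegral_tendsto_integral h3 tendsto_neg_atTop_atBot tendsto_id).congr' ?_
      filter_upwards [eventually_ge_atTop 0] with T hT
      rw [integral_Icc_eq_integral_Ioc, ← intervalIntegral.integral_of_le (by linarith), id]
    | some i =>
      refine tendsto_const_nhds.congr' ?_
      filter_upwards [eventually_ge_atTop 1] with T hT
      rw [hloop i T hT]; rfl
  have hlim2 : Tendsto (fun T => (F (C.arm T) + Complex.log (C.arm T - p)) -
        (F (C.arm (-T)) + Complex.log (C.arm (-T) - p))) atTop (𝓝 0) := by
    refine hγ.tendsto_ends_sub (F := fun w => F w + Complex.log (w - p)) (f := cauchyExp p)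
      (X := p.re) (fun w hw => ?_) ?_ (cauchyExp_small_on_lines p)
    · have hne' : w ≠ p := by rintro rfl; exact lt_irrefl _ hw
      rw [hFE w hne', ← one_div]
      refine (hF w).add (((hasDerivAt_id w).sub_const p).clog (Or.inl ?_))
      rw [id, Complex.sub_re]; linarith
    · simpa [dom, piece] using hint none
  have harg1 := hγ.tendsto_arg p (σ := id) hγ.tendsto_re_atTop
  have harg2 := hγ.tendsto_arg p (σ := Neg.neg) hγ.tendsto_re_neg_atTop
  have harg := (Complex.continuous_ofReal.continuousAt.tendsto.comp
    (harg1.sub harg2)).mul_const Complex.I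
  have hWl := ((Complex.continuous_ofReal.continuousAt.tendsto).comp hw).mul_const Complex.I
  have hlim3 := (hlim2.sub harg).add hWl
  refine tendsto_nhds_unique (l := atTop) (hlim1.congr' ?_)
    (f := fun T => ((F (C.arm T) + Complex.log (C.arm T - p)) -
        (F (C.arm (-T)) + Complex.log (C.arm (-T) - p))) -
      (Complex.arg (C.arm T - p) - Complex.arg (C.arm (-T) - p)) * Complex.I + W T * Complex.I) ?_
  · filter_upwards [eventually_ge_atTop 1] with T hT using htot T hT
  · convert! hlim3 using 2
    · simp [hW]
    · push_cast; ring

end Contour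

namespace Contour

variable {C : Contour}

/-- The contour integral of the decaying Cauchy kernel is locally constant in its pole. -/
theorem hasDerivAt_integral_cauchyExp {p : ℂ} {δ : ℝ} (hδ : 0 < δ)
    (hp : ∀ w ∈ C.support, δ ≤ ‖w - p‖) :
    HasDerivAt (fun p => C.integral (cauchyExp p)) 0 p := by
  set D : ℂ → ℂ → ℂ := fun q w =>
    Complex.exp (-(w - q)) / (w - q) + Complex.exp (-(w - q)) / (w - q) ^ 2 with hD
  have hnear : ∀ q ∈ Metric.ball p (δ / 2), ∀ w ∈ C.support, δ / 2 ≤ ‖w - q‖ := by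
    intro q hq w hw
    have h1 := hp w hw
    have h2 : ‖w - p‖ ≤ ‖w - q‖ + ‖q - p‖ := by
      rw [show w - p = (w - q) + (q - p) by ring]; exact norm_add_le _ _
    rw [Metric.mem_ball, dist_eq_norm] at hq
    linarith
  have hball : Metric.ball p (δ / 2) ∈ 𝓝 p := Metric.ball_mem_nhds _ (by positivity)
  have hmem : ∀ q ∈ Metric.ball p (δ / 2), q ∉ C.support := fun q hq =>
    notMem_support_of_le (half_pos hδ) (hnear q hq)
  set A : ℝ := Real.exp (p.re + δ / 2) / (δ / 2) * (1 + 1 / (δ / 2)) with hA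
  have hbound : ∀ q ∈ Metric.ball p (δ / 2), ∀ w ∈ C.support, ‖D q w‖ ≤ A * Real.exp (-w.re) := by
    intro q hq w hw
    have h1 := hnear q hq w hw
    have h2 := norm_cauchyExp_le (half_pos hδ) h1
    have h3 : D q w = cauchyExp q w * (1 + 1 / (w - q)) := by
      simp only [hD, cauchyExp]
      rw [mul_add, mul_one, div_mul_div_comm, mul_one, ← pow_two]
    have h4 : ‖1 + 1 / (w - q)‖ ≤ 1 + 1 / (δ / 2) := by
      refine (norm_add_le _ _).trans ?_
      rw [norm_one, norm_div, norm_one]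
      gcongr
    have h5 : q.re ≤ p.re + δ / 2 := by
      rw [Metric.mem_ball, dist_eq_norm] at hq
      have := (le_abs_self _).trans ((Complex.abs_re_le_norm (q - p)).trans hq.le)
      rw [Complex.sub_re] at this
      linarith
    rw [h3, norm_mul, hA]
    calc _ ≤ Real.exp q.re / (δ / 2) * Real.exp (-w.re) * (1 + 1 / (δ / 2)) := by gcongr
      _ ≤ Real.exp (p.re + δ / 2) / (δ / 2) * Real.exp (-w.re) * (1 + 1 / (δ / 2)) := by gcongr
      _ = _ := by ring
  have hDc : ContinuousOn (D p) C.support := by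
    have hne : ∀ w ∈ C.support, w - p ≠ 0 := fun w hw =>
      sub_ne_zero.2 fun h => hmem p (mem_of_mem_nhds hball) (h ▸ hw)
    exact (ContinuousOn.div (by fun_prop) (by fun_prop) hne).add
      (ContinuousOn.div (by fun_prop) (by fun_prop) fun w hw => pow_ne_zero 2 (hne w hw))
  have hpm := hmem p (mem_of_mem_nhds hball)
  have hDi := integrableOn_piece hDc (hbound p (mem_of_mem_nhds hball))
  have hder : HasDerivAt (fun p => C.integral (cauchyExp p)) (C.integral (D p)) p := by
    refine HasDerivAt.fun_sum fun c _ => ?_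
    refine (hasDerivAt_integral_of_dominated_loc_of_deriv_le
      (F := fun q t => cauchyExp q (C.piece c t) * deriv (C.piece c) t)
      (F' := fun q t => D q (C.piece c t) * deriv (C.piece c) t)
      (bound := fun t => A * (Real.exp (-(C.piece c t).re) * ‖deriv (C.piece c) t‖))
      hball ?_ (integrableOn_piece (continuousOn_cauchyExp hpm)
        (fun w hw => norm_cauchyExp_le hδ (hp w hw)) c) (hDi c).aestronglyMeasurable ?_
      ((C.integrableOn_length c).const_mul A) ?_).2
    · filter_upwards [hball] with q hq
      exact (aestronglyMeasurable_piece (continuousOn_cauchyExp (hmem q hq)) c).mul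
        (measurable_deriv _).aestronglyMeasurable
    · filter_upwards [ae_restrict_mem (C.measurableSet_dom c)] with t ht q hq
      exact norm_piece_mul_deriv_le (hbound q hq) ht
    · filter_upwards [ae_restrict_mem (C.measurableSet_dom c)] with t ht q hq
      have hne : C.piece c t - q ≠ 0 := sub_ne_zero.2 fun h =>
        hmem q hq (h ▸ piece_mem_support ht)
      refine HasDerivAt.mul_const ?_ _
      have h1 := (((hasDerivAt_id q).const_sub (C.piece c t)).neg.cexp).div
        ((hasDerivAt_id q).const_sub (C.piece c t)) hne
      refine h1.congr_deriv ?_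
      simp only [id, hD, Pi.neg_apply]
      field_simp
      ring
  -- The kernel depends on w - p only, so its derivative in p is minus its derivative in w. Hence `D
  -- p` has the primitive `-cauchyExp p`, which vanishes at both ends.
  have hz : C.integral (D p) = 0 := by
    refine integral_eq_zero_of_hasDerivAt hDi (F := fun w => -cauchyExp p w) (fun w hw => ?_) ?_
    · have := (hasDerivAt_cauchyExp (p := p) (w := w) (by rintro rfl; exact hpm hw)).neg
      rw [neg_neg] at this
      exact this
    · have hlim : ∀ σ : ℝ → ℝ, Tendsto (fun T => (C.arm (σ T)).re) atTop atTop →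
          Tendsto (fun T => -cauchyExp p (C.arm (σ T))) atTop (𝓝 0) := by
        intro σ hσ
        refine squeeze_zero_norm (a := fun T => Real.exp p.re / δ * Real.exp (-(C.arm (σ T)).re))
          (fun T => ?_) ?_
        · rw [norm_neg]
          exact norm_cauchyExp_le hδ (hp _ (piece_mem_support (c := none) trivial))
        · simpa using (Real.tendsto_exp_neg_atTop_nhds_zero.comp hσ).const_mul (Real.exp p.re / δ)
      have h1 := (hlim id C.isUnboundedCurve_arm.tendsto_re_atTop).sub
        (hlim Neg.neg C.isUnboundedCurve_arm.tendsto_re_neg_atTop)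
      rwa [sub_zero] at h1
  rwa [hz] at hder

/-- A contour has winding number zero around the points of a curve which avoids it and goes to
infinity to the left. -/
theorem integral_cauchyExp_eq_zero_of_curve {κ : ℝ → ℂ} (hκ : Continuous κ) {δ : ℝ} (hδ : 0 < δ)
    (hd : ∀ t, ∀ w ∈ C.support, δ ≤ ‖w - κ t‖)
    (hlim : Tendsto (fun t => (κ t).re) atTop atBot) (t : ℝ) :
    C.integral (cauchyExp (κ t)) = 0 := by
  have hloc : IsLocallyConstant fun t => C.integral (cauchyExp (κ t)) := by
    rw [IsLocallyConstant.iff_eventually_eq]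
    intro s
    have hb : Metric.ball (κ s) (δ / 2) ∈ 𝓝 (κ s) := Metric.ball_mem_nhds _ (by positivity)
    have hnear : ∀ q ∈ Metric.ball (κ s) (δ / 2), ∀ w ∈ C.support, δ / 2 ≤ ‖w - q‖ := by
      intro q hq w hw
      have h1 := hd s w hw
      have h2 : ‖w - κ s‖ ≤ ‖w - q‖ + ‖q - κ s‖ := by
        rw [show w - κ s = (w - q) + (q - κ s) by ring]; exact norm_add_le _ _
      rw [Metric.mem_ball, dist_eq_norm] at hq
      linarith
    filter_upwards [hκ.continuousAt.preimage_mem_nhds hb] with r hr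
    have := (convex_ball (κ s) (δ / 2)).norm_image_sub_le_of_norm_hasDerivWithin_le (𝕜 := ℂ)
      (f := fun p => C.integral (cauchyExp p)) (f' := fun _ => 0) (C := 0)
      (fun q hq => (hasDerivAt_integral_cauchyExp (half_pos hδ) (hnear q hq)).hasDerivWithinAt)
      (fun q hq => by simp) (mem_of_mem_nhds hb) hr
    rw [zero_mul, norm_le_zero_iff, sub_eq_zero] at this
    exact this
  have hconst : ∀ s, C.integral (cauchyExp (κ s)) = C.integral (cauchyExp (κ t)) := fun s =>
    hloc.apply_eq_of_isPreconnected isPreconnected_univ trivial trivial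
  -- The bound on the kernel carries the factor exp(Re p), which tends to 0 as the pole p moves to
  -- the left at distance at least δ from the contour.
  have h0 : Tendsto (fun s => C.integral (cauchyExp (κ s))) atTop (𝓝 0) := by
    refine squeeze_zero_norm (a := fun s => Real.exp (κ s).re / δ * C.weightedLength)
      (fun s => norm_integral_le fun w hw => norm_cauchyExp_le hδ (hd s w hw)) ?_
    simpa using ((Real.tendsto_exp_atBot.comp hlim).div_const δ).mul_const C.weightedLength
  simp_rw [hconst] at h0
  exact tendsto_nhds_unique tendsto_const_nhds h0

end Contour

/-! ### Residues at the non-negative integers -/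

theorem one_half_le_norm_sub_int {n k : ℤ} (hk : k ≠ n) {w : ℂ} (hw : ‖w - n‖ ≤ 1 / 2) :
    1 / 2 ≤ ‖w - k‖ := by
  have h1 : (1 : ℝ) ≤ ‖((n : ℂ) - k)‖ := by
    rw [← Int.cast_sub, Complex.norm_intCast]
    exact_mod_cast Int.one_le_abs (sub_ne_zero.2 hk.symm)
  have h2 : ‖(n : ℂ) - k‖ ≤ ‖w - k‖ + ‖w - n‖ := by
    rw [show (n : ℂ) - k = (w - k) - (w - n) by ring]; exact norm_sub_le _ _
  linarith

theorem ball_diff_subset_compl_range_intCast (n : ℤ) :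
    Metric.ball (n : ℂ) (1 / 2) \ {(n : ℂ)} ⊆ (Set.range ((↑) : ℤ → ℂ))ᶜ := by
  rintro w ⟨hw, hwn⟩ ⟨k, rfl⟩
  rw [Metric.mem_ball, dist_eq_norm] at hw
  have hk : k ≠ n := by rintro rfl; exact hwn rfl
  have := one_half_le_norm_sub_int hk hw.le
  simp at this
  linarith

/-- A function with removable singularities at the integers extends to an entire function. -/
theorem exists_entire_extension {f : ℂ → ℂ}
    (hd : DifferentiableOn ℂ f (Set.range ((↑) : ℤ → ℂ))ᶜ)
    (h0 : ∀ n : ℤ, Tendsto (fun w => (w - n) * f w) (𝓝[≠] (n : ℂ)) (𝓝 0)) :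
    ∃ g : ℂ → ℂ, Differentiable ℂ g ∧ ∀ w ∈ (Set.range ((↑) : ℤ → ℂ))ᶜ, g w = f w := by
  have hopen := Complex.isOpen_compl_range_intCast
  have hval : ∀ w ∈ (Set.range ((↑) : ℤ → ℂ))ᶜ, limUnder (𝓝[≠] w) f = f w := fun w hw =>
    ((hd.differentiableAt (hopen.mem_nhds hw)).continuousAt.continuousWithinAt).limUnder_eq
  refine ⟨fun w => limUnder (𝓝[≠] w) f, fun w => ?_, hval⟩
  by_cases hw : w ∈ (Set.range ((↑) : ℤ → ℂ))ᶜ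
  · exact (hd.differentiableAt (hopen.mem_nhds hw)).congr_of_eventuallyEq
      (Filter.eventuallyEq_of_mem (hopen.mem_nhds hw) hval)
  · obtain ⟨n, rfl⟩ := not_not.1 hw
    have hb : Metric.ball (n : ℂ) (1 / 2) ∈ 𝓝 (n : ℂ) := Metric.ball_mem_nhds _ (by norm_num)
    -- The value `f n` is arbitrary here. It does no harm, because (z - n) f(n) tends to 0.
    have ho : (fun z => f z - f n) =o[𝓝[≠] (n : ℂ)] fun z => (z - n)⁻¹ := by
      refine Asymptotics.isLittleO_of_tendsto' ?_ ?_
      · filter_upwards [self_mem_nhdsWithin] with z hz h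
        exact absurd h (inv_ne_zero (sub_ne_zero.2 hz))
      · have h1 : Tendsto (fun z : ℂ => (z - n) * f n) (𝓝[≠] (n : ℂ)) (𝓝 0) := by
          have : Continuous fun z : ℂ => (z - n) * f n := by fun_prop
          have := this.tendsto n
          rw [sub_self, zero_mul] at this
          exact this.mono_left nhdsWithin_le_nhds
        have h2 := (h0 n).sub h1
        rw [sub_zero] at h2
        refine h2.congr fun z => ?_
        rw [div_inv_eq_mul]; ring
    have h1 := Complex.differentiableOn_update_limUnder_of_isLittleO hb
      (hd.mono (ball_diff_subset_compl_range_intCast n)) ho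
    refine (h1.differentiableAt hb).congr_of_eventuallyEq ?_
    filter_upwards [hb] with z hz
    by_cases hzn : z = n
    · rw [hzn, Function.update_self]
    · rw [Function.update_of_ne hzn]
      exact hval z (ball_diff_subset_compl_range_intCast n ⟨hz, hzn⟩)

/-- A sum of decaying principal parts at the non-negative integers. -/
def principalSum (ρ : ℕ → ℂ) (w : ℂ) : ℂ := ∑' k : ℕ, ρ k * cauchyExp k w

theorem norm_principalSum_term_le (ρ : ℕ → ℂ) (k : ℕ) {w : ℂ} {d : ℝ} (hd : 0 < d) (h : d ≤ ‖w - k‖) :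
    ‖ρ k * cauchyExp k w‖ ≤ ‖ρ k‖ * Real.exp k / d * Real.exp (-w.re) := by
  rw [norm_mul]
  calc _ ≤ ‖ρ k‖ * (Real.exp (k : ℂ).re / d * Real.exp (-w.re)) := by
        gcongr; exact norm_cauchyExp_le hd h
    _ = _ := by rw [Complex.natCast_re]; ring

theorem norm_principalSum_le {ρ : ℕ → ℂ} (hρ : Summable fun k : ℕ => ‖ρ k‖ * Real.exp k)
    {w : ℂ} {d : ℝ} (hd : 0 < d) (h : ∀ k : ℕ, d ≤ ‖w - k‖) :
    ‖principalSum ρ w‖ ≤ (∑' k : ℕ, ‖ρ k‖ * Real.exp k) / d * Real.exp (-w.re) :=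
  tsum_of_norm_bounded ((hρ.hasSum.div_const d).mul_right (Real.exp (-w.re)))
    fun k => norm_principalSum_term_le ρ k hd (h k)

theorem differentiableOn_principalSum {ρ : ℕ → ℂ} (hρ : Summable fun k : ℕ => ‖ρ k‖ * Real.exp k) :
    DifferentiableOn ℂ (principalSum ρ) (Set.range ((↑) : ℤ → ℂ))ᶜ := by
  intro w hw
  obtain ⟨d, hd, hball⟩ := Metric.isOpen_iff.1 Complex.isOpen_compl_range_intCast w hw
  have hfar : ∀ z ∈ Metric.ball w (d / 2), ∀ k : ℕ, d / 2 ≤ ‖z - k‖ := by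
    intro z hz k
    by_contra! h
    refine absurd (⟨k, by simp⟩ : (k : ℂ) ∈ Set.range ((↑) : ℤ → ℂ)) (hball ?_)
    rw [Metric.mem_ball, dist_eq_norm] at hz ⊢
    calc ‖(k : ℂ) - w‖ = ‖(z - w) - (z - k)‖ := by congr 1; ring
      _ ≤ _ := norm_sub_le _ _
      _ < d := by linarith
  refine DifferentiableAt.differentiableWithinAt ?_
  refine (Complex.differentiableOn_tsum_of_summable_norm
    (u := fun k : ℕ => ‖ρ k‖ * Real.exp k / (d / 2) * Real.exp (-(w.re - d / 2)))
    ((hρ.div_const _).mul_right _) (U := Metric.ball w (d / 2)) (fun k z hz => ?_)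
    Metric.isOpen_ball (fun k z hz => ?_)).differentiableAt (Metric.ball_mem_nhds _ (half_pos hd))
  · refine ((hasDerivAt_cauchyExp ?_).differentiableAt.const_mul _).differentiableWithinAt
    rintro rfl
    have := hfar _ hz k
    rw [sub_self, norm_zero] at this
    linarith
  · refine (norm_principalSum_term_le ρ k (half_pos hd) (hfar z hz k)).trans ?_
    rw [Metric.mem_ball, dist_eq_norm] at hz
    have := (neg_le_abs _).trans ((Complex.abs_re_le_norm (z - w)).trans hz.le)
    rw [Complex.sub_re] at this
    gcongr
    linarith

/-- The conditional sum denotes ρ_n for n ≥ 0 and 0 for n < 0, so all integers are treated alike.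
Dominated convergence applies because near n one has |w - n| ≤ |w - k| for every k, so the factor w
- n absorbs each denominator, including that of k = n. -/
theorem tendsto_mul_principalSum {ρ : ℕ → ℂ} (hρ : Summable fun k : ℕ => ‖ρ k‖ * Real.exp k)
    (n : ℤ) :
    Tendsto (fun w => (w - n) * principalSum ρ w) (𝓝[≠] (n : ℂ))
      (𝓝 (∑' k : ℕ, if (k : ℤ) = n then ρ k else 0)) := by
  simp only [principalSum, ← tsum_mul_left]
  refine tendsto_tsum_of_dominated_convergence
    (bound := fun k : ℕ => ‖ρ k‖ * Real.exp k * Real.exp (-((n : ℝ) - 1 / 2))) (hρ.mul_right _) ?_ ?_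
  · intro k
    split_ifs with hk
    · subst hk
      have h1 : Continuous fun w : ℂ => ρ k * Complex.exp (-(w - k)) := by fun_prop
      have h2 := (h1.tendsto (k : ℂ)).mono_left (nhdsWithin_le_nhds (s := {(k : ℂ)}ᶜ))
      simp only [sub_self, neg_zero, Complex.exp_zero, mul_one] at h2
      simp only [Int.cast_natCast]
      refine h2.congr' ?_
      filter_upwards [self_mem_nhdsWithin] with w hw
      have := sub_ne_zero.2 hw
      rw [cauchyExp]
      field_simp
    · have hne : (n : ℂ) ≠ k := by
        intro h; exact hk (by exact_mod_cast h.symm)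
      have h1 : ContinuousAt (fun w : ℂ => (w - n) * (ρ k * cauchyExp k w)) n :=
        (continuousAt_id.sub continuousAt_const).mul
          (continuousAt_const.mul (hasDerivAt_cauchyExp hne).continuousAt)
      have h2 := h1.tendsto
      rw [sub_self, zero_mul] at h2
      exact h2.mono_left nhdsWithin_le_nhds
  · have hb : Metric.ball (n : ℂ) (1 / 2) ∈ 𝓝[≠] (n : ℂ) :=
      nhdsWithin_le_nhds (Metric.ball_mem_nhds _ (by norm_num))
    filter_upwards [hb, self_mem_nhdsWithin] with w hw hwn k
    rw [Metric.mem_ball, dist_eq_norm] at hw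
    have hpos : 0 < ‖w - n‖ := norm_pos_iff.2 (sub_ne_zero.2 hwn)
    have h1 : ‖w - n‖ ≤ ‖w - k‖ := by
      by_cases hk : (k : ℤ) = n
      · rw [← hk]; simp
      · have := one_half_le_norm_sub_int hk hw.le
        rw [Int.cast_natCast] at this
        linarith
    rw [norm_mul]
    calc _ ≤ ‖w - n‖ * (‖ρ k‖ * Real.exp k / ‖w - n‖ * Real.exp (-w.re)) := by
          gcongr; exact norm_principalSum_term_le ρ k hpos h1
      _ = ‖ρ k‖ * Real.exp k * Real.exp (-w.re) := by field_simp
      _ ≤ _ := by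
        have := (neg_le_abs _).trans ((Complex.abs_re_le_norm (w - n)).trans hw.le)
        rw [Complex.sub_re, Complex.intCast_re] at this
        gcongr
        linarith

theorem Contour.EnclosesNonnegIntegers.support_subset {C : Contour} (hC : C.EnclosesNonnegIntegers) :
    C.support ⊆ (Set.range ((↑) : ℤ → ℂ))ᶜ := by
  rintro w hw ⟨n, rfl⟩
  obtain ⟨δ, hδ, h⟩ := hC.away
  have := h _ hw n
  rw [sub_self, norm_zero] at this
  linarith

theorem Contour.EnclosesNonnegIntegers.integral_cauchyExp_int {C : Contour}
    (hC : C.EnclosesNonnegIntegers) (n : ℤ) :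
    C.integral (cauchyExp n) = if 0 ≤ n then 2 * Real.pi * Complex.I else 0 := by
  obtain ⟨δ, hδ, h⟩ := hC.away
  split_ifs with hn
  · simpa using Contour.integral_cauchyExp hδ (fun w hw => h w hw n) (hC.nonneg n hn)
  · simpa using Contour.integral_cauchyExp hδ (fun w hw => h w hw n) (hC.neg n (not_le.1 hn))

theorem one_half_le_norm_sub_natCast_of_re {w : ℂ} {N : ℕ} (hw : w.re = N + 1 / 2) (k : ℤ) :
    1 / 2 ≤ ‖w - k‖ := by
  refine le_trans ?_ (Complex.abs_re_le_norm _)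
  rw [Complex.sub_re, hw, Complex.intCast_re]
  rcases le_or_gt k N with h | h
  · have : (k : ℝ) ≤ N := by exact_mod_cast h
    rw [le_abs]; left; linarith
  · have : (N : ℝ) + 1 ≤ k := by exact_mod_cast h
    rw [le_abs]; right; linarith

/-- The residue theorem for a contour enclosing the non-negative integers and a decaying function with
simple poles there. -/
theorem Contour.EnclosesNonnegIntegers.integral_eq_tsum {C : Contour}
    (hC : C.EnclosesNonnegIntegers) {h : ℂ → ℂ} {ρ : ℕ → ℂ}
    (hd : DifferentiableOn ℂ h (Set.range ((↑) : ℤ → ℂ))ᶜ)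
    (hres : ∀ n : ℤ, Tendsto (fun w => (w - n) * h w) (𝓝[≠] (n : ℂ))
      (𝓝 (∑' k : ℕ, if (k : ℤ) = n then ρ k else 0)))
    (hρ : Summable fun k : ℕ => ‖ρ k‖ * Real.exp k) {A : ℝ}
    (hA : ∀ w ∈ C.support, ‖h w‖ ≤ A * Real.exp (-w.re))
    (hl : ∀ B : ℝ, ∃ A' : ℝ, ∀ᶠ N : ℕ in atTop, ∀ w : ℂ, w.re = N + 1 / 2 → |w.im| ≤ B →
      ‖h w‖ ≤ A' * Real.exp (-w.re)) :
    C.integral h = 2 * Real.pi * Complex.I * ∑' k, ρ k := by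
  obtain ⟨δ, hδ, haway⟩ := hC.away
  obtain ⟨g, hg, hgf⟩ := exists_entire_extension (f := fun w => h w - principalSum ρ w)
    (hd.sub (differentiableOn_principalSum hρ)) fun n => by
      have := (hres n).sub (tendsto_mul_principalSum hρ n)
      rw [sub_self] at this
      refine this.congr fun w => ?_
      ring
  set S := ∑' k : ℕ, ‖ρ k‖ * Real.exp k
  have hP : ∀ w ∈ C.support, ‖principalSum ρ w‖ ≤ S / δ * Real.exp (-w.re) := fun w hw =>
    norm_principalSum_le hρ hδ fun k => by simpa using haway w hw k
  have hgS : ∀ w ∈ C.support, ‖g w‖ ≤ (A + S / δ) * Real.exp (-w.re) := fun w hw => by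
    rw [hgf w (hC.support_subset hw), add_mul]
    exact (norm_sub_le _ _).trans (add_le_add (hA w hw) (hP w hw))
  have hg0 : C.integral g = 0 := by
    -- The lines Re w = N + 1/2 stay 1/2 away from every integer, so the principal sum decays on
    -- them as h does.
    refine integral_eq_zero_of_differentiable hg hgS fun B ε hε => ?_
    obtain ⟨A', hA'⟩ := hl B
    filter_upwards [hA', eventually_mul_exp_neg_le (A' + S / (1 / 2)) hε] with N h1 h2 w hw hwB
    have hfar := one_half_le_norm_sub_natCast_of_re hw
    have hwc : w ∈ (Set.range ((↑) : ℤ → ℂ))ᶜ := by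
      rintro ⟨k, rfl⟩
      have := hfar k
      rw [sub_self, norm_zero] at this
      norm_num at this
    rw [hgf w hwc]
    refine (norm_sub_le _ _).trans ?_
    have h3 := norm_principalSum_le hρ (w := w) (by norm_num : (0 : ℝ) < 1 / 2)
      fun k => by simpa using hfar k
    have h4 := h1 w hw hwB
    rw [← hw, add_mul] at h2
    linarith
  have hPi : HasSum (fun k : ℕ => C.integral fun w => ρ k * cauchyExp k w)
      (C.integral (principalSum ρ)) := by
    refine hasSum_integral (A := fun k : ℕ => ‖ρ k‖ * Real.exp k / δ) (fun k => ?_)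
      (fun k w hw => norm_principalSum_term_le ρ k hδ (by simpa using haway w hw k))
      (hρ.div_const _)
    refine continuousOn_const.mul (continuousOn_cauchyExp fun hk => ?_)
    exact hC.support_subset hk ⟨k, by simp⟩
  have hPi2 : C.integral (principalSum ρ) = 2 * Real.pi * Complex.I * ∑' k, ρ k := by
    rw [← hPi.tsum_eq, ← tsum_mul_left]
    congr 1
    ext k
    have := hC.integral_cauchyExp_int k
    rw [if_pos (Int.natCast_nonneg k), Int.cast_natCast] at this
    rw [Contour.integral_const_mul, this, mul_comm]
  rw [integral_congr (g := fun w => g w + principalSum ρ w) fun w hw => by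
      rw [hgf w (hC.support_subset hw)]; ring,
    Contour.integral_add hg.continuous.continuousOn hgS
      ((differentiableOn_principalSum hρ).continuousOn.mono hC.support_subset) hP, hg0, hPi2, zero_add]

/-! ### The function `G` -/

theorem G_eq (z : ℂ) (x : ℤ) (u : ℝ) :
    G z x u = (u : ℂ) ^ z * (Complex.Gamma (z + 1))⁻¹ * (Complex.sin (Real.pi / 2 * (z + x)))⁻¹ := by
  rw [G, div_eq_mul_inv, mul_inv, mul_assoc]

theorem sin_ne_zero_of_notMem_range {z : ℂ} (hz : z ∈ (Set.range ((↑) : ℤ → ℂ))ᶜ) (x : ℤ) :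
    Complex.sin (Real.pi / 2 * (z + x)) ≠ 0 := by
  intro h
  obtain ⟨k, hk⟩ := Complex.sin_eq_zero_iff.1 h
  refine hz ⟨2 * k - x, ?_⟩
  have hpi : (Real.pi : ℂ) ≠ 0 := by exact_mod_cast Real.pi_ne_zero
  have h2 : z + x = 2 * k := by
    field_simp at hk
    linear_combination hk
  push_cast
  linear_combination -h2

theorem differentiable_cpow_mul_Gamma_inv {u : ℝ} (hu : 0 < u) :
    Differentiable ℂ fun z : ℂ => (u : ℂ) ^ z * (Complex.Gamma (z + 1))⁻¹ := by
  have hu' : (u : ℂ) ≠ 0 := by exact_mod_cast hu.ne'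
  refine Differentiable.mul (fun z => ?_) (fun z => ?_)
  · exact differentiableAt_id.const_cpow (Or.inl hu')
  · exact DifferentiableAt.comp (f := fun z : ℂ => z + 1) z
      (Complex.differentiable_one_div_Gamma (z + 1)) (by fun_prop)

theorem differentiableAt_G {x : ℤ} {u : ℝ} (hu : 0 < u) {z : ℂ}
    (hz : Complex.sin (Real.pi / 2 * (z + x)) ≠ 0) : DifferentiableAt ℂ (fun z => G z x u) z := by
  simp_rw [G_eq]
  refine (differentiable_cpow_mul_Gamma_inv hu z).mul (DifferentiableAt.inv ?_ hz)
  exact (Complex.differentiable_sin _).comp z (by fun_prop)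

theorem differentiableOn_G (x : ℤ) {u : ℝ} (hu : 0 < u) :
    DifferentiableOn ℂ (fun z => G z x u) (Set.range ((↑) : ℤ → ℂ))ᶜ := fun _ hz =>
  (differentiableAt_G hu (sin_ne_zero_of_notMem_range hz x)).differentiableWithinAt

/-- A shift by two changes the sine only in sign. The factor from Γ carries decay from a bounded
region to the whole half-strip. -/
theorem G_add_two (x : ℤ) {u : ℝ} (hu : 0 < u) {z : ℂ} (hz : 0 ≤ z.re) :
    G (z + 2) x u = -(u ^ 2 / ((z + 1) * (z + 2)) * G z x u) := by
  have hu' : (u : ℂ) ≠ 0 := by exact_mod_cast hu.ne'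
  have h1 : z + 1 ≠ 0 := fun h => by
    have := congrArg Complex.re h
    simp at this; linarith
  have h2 : z + 2 ≠ 0 := fun h => by
    have := congrArg Complex.re h
    simp at this; linarith
  have hg : Complex.Gamma (z + 2 + 1) = (z + 2) * ((z + 1) * Complex.Gamma (z + 1)) := by
    rw [Complex.Gamma_add_one _ h2, show z + 2 = z + 1 + 1 by ring, Complex.Gamma_add_one _ h1]
  have hs : Complex.sin (Real.pi / 2 * (z + 2 + x)) = -Complex.sin (Real.pi / 2 * (z + x)) := by
    rw [← Complex.sin_add_pi]; congr 1; ring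
  have hp : (u : ℂ) ^ (z + 2) = (u : ℂ) ^ z * (u : ℂ) ^ 2 := by
    rw [Complex.cpow_add _ _ hu']; norm_cast
  rw [G, G, hg, hs, hp, mul_neg, div_neg, div_mul_div_comm]
  congr 2 <;> ring

/-- `G` decays in horizontal strips, away from the integers. -/
theorem exists_norm_G_le (x : ℤ) {u : ℝ} (hu : 0 < u) (R₀ B : ℝ) {δ : ℝ} (hδ : 0 < δ) :
    ∃ A : ℝ, ∀ w : ℂ, R₀ ≤ w.re → |w.im| ≤ B → (∀ n : ℤ, δ ≤ ‖w - n‖) →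
      ‖G w x u‖ ≤ A * Real.exp (-w.re) := by
  -- For Re w > R₁ + 2 one has |w - 1| |w| ≥ u² exp 2, so passing from w - 2 to w multiplies |G| by
  -- at most exp(-2). Hence the maximum of |G| exp(Re w) over the compact set `K` bounds it
  -- everywhere.
  set R₁ : ℝ := max R₀ (u ^ 2 * Real.exp 2) with hR₁
  have hR0 : R₀ ≤ R₁ := le_max_left _ _
  have hR1 : u ^ 2 * Real.exp 2 ≤ R₁ := le_max_right _ _
  have hR1' : 0 ≤ R₁ := le_trans (by positivity) hR1
  set K : Set ℂ := {w | R₀ ≤ w.re ∧ w.re ≤ R₁ + 2 ∧ |w.im| ≤ B ∧ ∀ n : ℤ, δ ≤ ‖w - n‖} with hK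
  have hKc : IsCompact K := by
    refine Metric.isCompact_of_isClosed_isBounded ?_ ?_
    · have h1 : K = {w : ℂ | R₀ ≤ w.re} ∩ ({w : ℂ | w.re ≤ R₁ + 2} ∩ ({w : ℂ | |w.im| ≤ B} ∩
          ⋂ n : ℤ, {w : ℂ | δ ≤ ‖w - n‖})) := by
        ext w; simp [hK]
      rw [h1]
      refine (isClosed_le continuous_const Complex.continuous_re).inter
        ((isClosed_le Complex.continuous_re continuous_const).inter
        ((isClosed_le Complex.continuous_im.abs continuous_const).inter
        (isClosed_iInter fun n => isClosed_le continuous_const (by fun_prop))))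
    · refine isBounded_iff_forall_norm_le.2 ⟨max |R₀| |R₁ + 2| + B, fun w hw => ?_⟩
      refine (Complex.norm_le_abs_re_add_abs_im w).trans (add_le_add ?_ hw.2.2.1)
      exact abs_le_max_abs_abs hw.1 hw.2.1
  have hcont : ContinuousOn (fun w => ‖G w x u‖ * Real.exp w.re) K := by
    refine ContinuousOn.mul ((differentiableOn_G x hu).continuousOn.mono ?_).norm
      (Real.continuous_exp.comp Complex.continuous_re).continuousOn
    rintro w hw ⟨n, rfl⟩
    have := hw.2.2.2 n
    rw [sub_self, norm_zero] at this
    linarith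
  obtain ⟨A, hA⟩ := hKc.bddAbove_image hcont
  have hA : ∀ w ∈ K, ‖G w x u‖ * Real.exp w.re ≤ A := fun w hw => hA ⟨w, hw, rfl⟩
  refine ⟨A, ?_⟩
  have key : ∀ j : ℕ, ∀ w : ℂ, R₀ ≤ w.re → |w.im| ≤ B → (∀ n : ℤ, δ ≤ ‖w - n‖) →
      w.re ≤ R₁ + 2 + 2 * j → ‖G w x u‖ * Real.exp w.re ≤ A := by
    intro j
    induction j with
    | zero =>
      intro w h1 h2 h3 h4
      exact hA w ⟨h1, by simpa using h4, h2, h3⟩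
    | succ j ih =>
      intro w h1 h2 h3 h4
      rcases le_or_gt w.re (R₁ + 2) with h5 | h5
      · exact hA w ⟨h1, h5, h2, h3⟩
      · have hre : (w - 2).re = w.re - 2 := by simp
        have him : (w - 2).im = w.im := by simp
        have h6 := ih (w - 2) (by rw [hre]; linarith) (by rwa [him]) (fun n => by
          have := h3 (n + 2); push_cast at this
          rwa [show w - 2 - n = w - (n + 2) by ring])
          (by rw [hre]; push_cast at h4; linarith)
        refine le_trans ?_ h6
        have h7 := G_add_two x hu (z := w - 2) (by rw [hre]; linarith)
        rw [sub_add_cancel] at h7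
        have h8 : w.re - 2 + 1 ≤ ‖w - 2 + 1‖ := by
          refine le_trans (le_of_eq ?_) (Complex.re_le_norm _); simp
        have h9 : w.re ≤ ‖w‖ := Complex.re_le_norm _
        have h10 : u ^ 2 * Real.exp 2 ≤ ‖w - 2 + 1‖ * ‖w‖ := by
          nlinarith [norm_nonneg w, norm_nonneg (w - 2 + 1)]
        have h11 : Real.exp w.re = Real.exp (w - 2).re * Real.exp 2 := by
          rw [← Real.exp_add, hre]; ring_nf
        have hpos : 0 < ‖w - 2 + 1‖ * ‖w‖ := lt_of_lt_of_le (by positivity) h10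
        rw [h7, h11, norm_neg, norm_mul, norm_div, norm_mul, norm_pow, Complex.norm_real,
          Real.norm_eq_abs, sq_abs]
        calc _ = (‖G (w - 2) x u‖ * Real.exp (w - 2).re) *
              (u ^ 2 * Real.exp 2 / (‖w - 2 + 1‖ * ‖w‖)) := by ring
          _ ≤ (‖G (w - 2) x u‖ * Real.exp (w - 2).re) * 1 := by
            gcongr
            exact (div_le_one hpos).2 h10
          _ = _ := mul_one _
  intro w h1 h2 h3
  have h4 := key ⌈w.re - R₁ - 2⌉₊ w h1 h2 h3 (by
    have := Nat.le_ceil (w.re - R₁ - 2)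
    have h0 : (0 : ℝ) ≤ ⌈w.re - R₁ - 2⌉₊ := Nat.cast_nonneg _
    linarith)
  rw [Real.exp_neg, ← div_eq_mul_inv, le_div_iff₀ (Real.exp_pos _)]
  exact h4

/-- The residue of `G(·; x, u)` at `k`. -/
def residueG (x : ℤ) (u : ℝ) (k : ℕ) : ℝ :=
  2 / Real.pi * Real.cos (Real.pi / 2 * (k + x)) * (u ^ k / k.factorial)

theorem norm_residueG_le (x : ℤ) {u : ℝ} (hu : 0 ≤ u) (k : ℕ) :
    ‖(residueG x u k : ℂ)‖ ≤ 2 / Real.pi * (u ^ k / k.factorial) := by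
  rw [Complex.norm_real, residueG, norm_mul, norm_mul, Real.norm_eq_abs, Real.norm_eq_abs,
    Real.norm_eq_abs, abs_of_pos (by positivity : 0 < 2 / Real.pi),
    abs_of_nonneg (by positivity : 0 ≤ u ^ k / (k.factorial : ℝ))]
  have := Real.abs_cos_le_one (Real.pi / 2 * (k + x))
  calc _ ≤ 2 / Real.pi * 1 * (u ^ k / k.factorial) := by gcongr
    _ = _ := by ring

theorem summable_residueG_mul_exp (x : ℤ) {u : ℝ} (hu : 0 ≤ u) :
    Summable fun k : ℕ => ‖(residueG x u k : ℂ)‖ * Real.exp k := by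
  refine Summable.of_nonneg_of_le (fun k => by positivity) (fun k => ?_)
    ((Real.summable_pow_div_factorial (u * Real.exp 1)).mul_left (2 / Real.pi))
  calc _ ≤ 2 / Real.pi * (u ^ k / k.factorial) * Real.exp k := by
        gcongr; exact norm_residueG_le x hu k
    _ = _ := by rw [mul_pow, ← Real.exp_nat_mul, mul_one]; ring

theorem tsum_ite_natCast (ρ : ℕ → ℂ) (k : ℕ) :
    (∑' j : ℕ, if (j : ℤ) = k then ρ j else 0) = ρ k := by
  rw [tsum_eq_single k]
  · simp
  · intro j hj
    rw [if_neg (by exact_mod_cast hj)]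

theorem tsum_ite_neg (ρ : ℕ → ℂ) {n : ℤ} (hn : n < 0) :
    (∑' j : ℕ, if (j : ℤ) = n then ρ j else 0) = 0 := by
  convert! tsum_zero with j
  rw [if_neg (by omega)]

/-- One formula covers both parities. If n + x is even, the sine has a simple zero and the cosine is
its own inverse, being ±1. If n + x is odd, there is no pole and the cosine vanishes. -/
theorem tendsto_sub_mul_inv_sin (x n : ℤ) :
    Tendsto (fun w : ℂ => (w - n) * (Complex.sin (Real.pi / 2 * (w + x)))⁻¹) (𝓝[≠] (n : ℂ))
      (𝓝 ((2 / Real.pi * Real.cos (Real.pi / 2 * (n + x)) : ℝ) : ℂ)) := by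
  have hpi : (Real.pi : ℂ) ≠ 0 := by exact_mod_cast Real.pi_ne_zero
  have hder : ∀ w : ℂ, HasDerivAt (fun w : ℂ => Complex.sin (Real.pi / 2 * (w + x)))
      (Complex.cos (Real.pi / 2 * (w + x)) * (Real.pi / 2)) w := by
    intro w
    have := (((hasDerivAt_id w).add_const (x : ℂ)).const_mul (Real.pi / 2 : ℂ)).csin
    simpa using this
  have hsq := Complex.sin_sq_add_cos_sq (Real.pi / 2 * ((n : ℂ) + x))
  push_cast
  by_cases hs : Complex.sin (Real.pi / 2 * ((n : ℂ) + x)) = 0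
  · have h1 := (hder n).tendsto_slope
    have hc : Complex.cos (Real.pi / 2 * ((n : ℂ) + x)) ≠ 0 := by
      intro h; rw [hs, h] at hsq; norm_num at hsq
    have h2 := h1.inv₀ (mul_ne_zero hc (div_ne_zero hpi two_ne_zero))
    have e : (Complex.cos (Real.pi / 2 * ((n : ℂ) + x)) * (Real.pi / 2))⁻¹ =
        2 / Real.pi * Complex.cos (Real.pi / 2 * ((n : ℂ) + x)) := by
      generalize Complex.cos (Real.pi / 2 * ((n : ℂ) + x)) = c at hc hsq ⊢
      rw [hs] at hsq
      field_simp
      linear_combination -hsq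
    rw [e] at h2
    refine h2.congr fun w => ?_
    rw [slope_def_field, hs, sub_zero, inv_div, div_eq_mul_inv]
  · have hc : Complex.cos (Real.pi / 2 * ((n : ℂ) + x)) = 0 := by
      have h := Complex.sin_two_mul (Real.pi / 2 * ((n : ℂ) + x))
      rw [show 2 * ((Real.pi : ℂ) / 2 * (n + x)) = ((n + x : ℤ) : ℂ) * Real.pi by push_cast; ring,
        Complex.sin_int_mul_pi] at h
      simpa [hs] using h.symm
    have h1 : ContinuousAt (fun w : ℂ => (w - n) * (Complex.sin (Real.pi / 2 * (w + x)))⁻¹) n :=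
      (continuousAt_id.sub continuousAt_const).mul ((hder n).continuousAt.inv₀ hs)
    have h2 := h1.tendsto.mono_left (nhdsWithin_le_nhds (s := {(n : ℂ)}ᶜ))
    rw [sub_self, zero_mul] at h2
    rwa [hc, mul_zero]

theorem tendsto_sub_mul_G (x : ℤ) {u : ℝ} (hu : 0 < u) (n : ℤ) :
    Tendsto (fun w => (w - n) * G w x u) (𝓝[≠] (n : ℂ))
      (𝓝 (∑' k : ℕ, if (k : ℤ) = n then (residueG x u k : ℂ) else 0)) := by
  have h1 := ((differentiable_cpow_mul_Gamma_inv hu).continuous.tendsto (n : ℂ)).mono_left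
    (nhdsWithin_le_nhds (s := {(n : ℂ)}ᶜ))
  have h2 := h1.mul (tendsto_sub_mul_inv_sin x n)
  have e : (∑' k : ℕ, if (k : ℤ) = n then (residueG x u k : ℂ) else 0) =
      (u : ℂ) ^ (n : ℂ) * (Complex.Gamma (n + 1))⁻¹ *
        ((2 / Real.pi * Real.cos (Real.pi / 2 * (n + x)) : ℝ) : ℂ) := by
    rcases le_or_gt 0 n with hn | hn
    · lift n to ℕ using hn
      rw [tsum_ite_natCast, residueG]
      push_cast
      rw [Complex.Gamma_nat_eq_factorial, Complex.cpow_natCast]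
      ring
    -- At a negative integer 1/Γ(n + 1) vanishes and removes any pole of 1/sin.
    · rw [tsum_ite_neg _ hn]
      obtain ⟨k, rfl⟩ : ∃ k : ℕ, n = -((k : ℤ) + 1) := ⟨(-n - 1).toNat, by omega⟩
      have : ((-((k : ℤ) + 1) : ℤ) : ℂ) + 1 = -k := by push_cast; ring
      rw [this, Complex.Gamma_neg_nat_eq_zero]
      simp
  rw [e]
  refine h2.congr fun w => ?_
  rw [G_eq]; ring

theorem Contour.exists_support_bounds (C : Contour) :
    ∃ R₀ B : ℝ, ∀ w ∈ C.support, R₀ ≤ w.re ∧ |w.im| ≤ B := by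
  have hpiece : ∀ c, ∃ R₀ B : ℝ, ∀ t ∈ C.dom c, R₀ ≤ (C.piece c t).re ∧ |(C.piece c t).im| ≤ B := by
    intro c
    cases c with
    | none =>
      have hγ := C.isUnboundedCurve_arm
      obtain ⟨B, hB⟩ := hγ.bounded_im
      obtain ⟨t₀, ht₀⟩ := (Complex.continuous_re.comp hγ.continuous).exists_forall_le hγ.tendsto_re
      exact ⟨_, B, fun t _ => ⟨ht₀ t, hB t⟩⟩
    | some i =>
      have hK : IsCompact (C.loop i '' Set.Icc 0 1) :=
        isCompact_Icc.image_of_continuousOn (C.isClosedCurve_loop i).continuousOn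
      obtain ⟨M, hM⟩ := hK.isBounded.exists_norm_le
      refine ⟨-M, M, fun t ht => ?_⟩
      have := hM _ ⟨t, ht, rfl⟩
      exact ⟨(abs_le.1 ((Complex.abs_re_le_norm _).trans this)).1,
        (Complex.abs_im_le_norm _).trans this⟩
  choose R B h using hpiece
  obtain ⟨R₀, hR⟩ := (Set.finite_range R).bddBelow
  obtain ⟨B₀, hB⟩ := (Set.finite_range B).bddAbove
  refine ⟨R₀, B₀, fun w hw => ?_⟩
  obtain ⟨c, t, ht, rfl⟩ := Set.mem_iUnion.1 hw
  exact ⟨(hR ⟨c, rfl⟩).trans (h c t ht).1, (h c t ht).2.trans (hB ⟨c, rfl⟩)⟩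

theorem Contour.EnclosesNonnegIntegers.exists_norm_G_le {C : Contour}
    (hC : C.EnclosesNonnegIntegers) (x : ℤ) {u : ℝ} (hu : 0 < u) :
    ∃ A : ℝ, 0 ≤ A ∧ ∀ w ∈ C.support, ‖G w x u‖ ≤ A * Real.exp (-w.re) := by
  obtain ⟨R₀, B, hb⟩ := C.exists_support_bounds
  obtain ⟨δ, hδ, haway⟩ := hC.away
  obtain ⟨A, hA⟩ := EdgeKernel.exists_norm_G_le x hu R₀ B hδ
  refine ⟨max A 0, le_max_right _ _, fun w hw => ?_⟩
  exact (hA w (hb w hw).1 (hb w hw).2 (haway w hw)).trans (by gcongr; exact le_max_left _ _)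

theorem summable_residueG_div (x : ℤ) {u : ℝ} (hu : 0 ≤ u) (p : ℂ) :
    Summable fun k : ℕ => ‖(residueG x u k : ℂ) / (k - p)‖ * Real.exp k := by
  refine Summable.of_norm_bounded_eventually_nat (summable_residueG_mul_exp x hu) ?_
  filter_upwards [eventually_ge_atTop ⌈‖p‖ + 1⌉₊] with k hk
  have h1 : ‖p‖ + 1 ≤ k := (Nat.le_ceil _).trans (by exact_mod_cast hk)
  have h2 : (1 : ℝ) ≤ ‖(k : ℂ) - p‖ := by
    have := norm_sub_norm_le (k : ℂ) p
    rw [Complex.norm_natCast] at this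
    linarith
  rw [norm_mul, norm_norm, norm_div, Real.norm_eq_abs, Real.abs_exp]
  gcongr
  exact div_le_self (norm_nonneg _) h2

theorem norm_exp_neg_sub (w p : ℂ) :
    ‖Complex.exp (-(w - p))‖ = Real.exp p.re * Real.exp (-w.re) := by
  rw [Complex.norm_exp, ← Real.exp_add]
  congr 1
  simp only [Complex.neg_re, Complex.sub_re]; ring

/-- Subtracting G(p) exp(p - w) from G makes the quotient by w - p regular at p, so the residue
theorem sees only the poles of G. The subtracted part contributes G(p) times the winding integral
around p. The point p may be an integer, provided the sine does not vanish there. -/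
theorem Contour.EnclosesNonnegIntegers.integral_G_div {C : Contour}
    (hC : C.EnclosesNonnegIntegers) (x : ℤ) {u : ℝ} (hu : 0 < u) {p : ℂ}
    (hp : Complex.sin (Real.pi / 2 * (p + x)) ≠ 0) {δ : ℝ} (hδ : 0 < δ)
    (hd : ∀ w ∈ C.support, δ ≤ ‖w - p‖) :
    C.integral (fun w => G w x u / (w - p)) =
      2 * Real.pi * Complex.I * ∑' k : ℕ, (residueG x u k : ℂ) / (k - p) +
        G p x u * C.integral (cauchyExp p) := by
  set κ : ℂ → ℂ := fun w => G w x u - G p x u * Complex.exp (-(w - p)) with hκ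
  have hκp : κ p = 0 := by simp [hκ]
  set h : ℂ → ℂ := dslope κ p with hh
  have hne : ∀ w, w ≠ p → h w = κ w / (w - p) := fun w hw => by
    rw [hh, dslope_of_ne _ hw, slope_def_field, hκp, sub_zero]
  have hκd : ∀ z : ℂ, Complex.sin (Real.pi / 2 * (z + x)) ≠ 0 → DifferentiableAt ℂ κ z :=
    fun z hz => (differentiableAt_G hu hz).sub (by fun_prop)
  have hκd' : DifferentiableOn ℂ κ (Set.range ((↑) : ℤ → ℂ))ᶜ := fun z hz =>
    (hκd z (sin_ne_zero_of_notMem_range hz x)).differentiableWithinAt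
  have hhd : DifferentiableOn ℂ h (Set.range ((↑) : ℤ → ℂ))ᶜ := by
    by_cases hpr : p ∈ (Set.range ((↑) : ℤ → ℂ))ᶜ
    · exact (Complex.differentiableOn_dslope
        (Complex.isOpen_compl_range_intCast.mem_nhds hpr)).2 hκd'
    · exact (differentiableOn_dslope_of_notMem hpr).2 hκd'
  have hnorm : ∀ {A d : ℝ} {w : ℂ}, 0 < d → d ≤ ‖w - p‖ → ‖G w x u‖ ≤ A * Real.exp (-w.re) →
      ‖h w‖ ≤ (A + ‖G p x u‖ * Real.exp p.re) / d * Real.exp (-w.re) := by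
    intro A d w hd0 hdw hG
    have hwp : w ≠ p := by
      rintro rfl
      rw [sub_self, norm_zero] at hdw
      linarith
    have h1 : ‖κ w‖ ≤ (A + ‖G p x u‖ * Real.exp p.re) * Real.exp (-w.re) := by
      refine (norm_sub_le _ _).trans ?_
      rw [norm_mul, norm_exp_neg_sub, add_mul, mul_assoc]
      gcongr
    rw [hne w hwp, norm_div, div_mul_eq_mul_div]
    gcongr
    exact (norm_nonneg _).trans h1
  obtain ⟨A, -, hA⟩ := hC.exists_norm_G_le x hu
  have hmain := hC.integral_eq_tsum (h := h) (ρ := fun k : ℕ => (residueG x u k : ℂ) / (k - p)) hhd ?_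
    (summable_residueG_div x hu.le p) (fun w hw => hnorm hδ (hd w hw) (hA w hw)) ?_
  · have hpm := Contour.notMem_support_of_le hδ hd
    rw [← hmain, ← Contour.integral_const_mul, ← Contour.integral_add
      (hhd.continuousOn.mono hC.support_subset) (fun w hw => hnorm hδ (hd w hw) (hA w hw))
      (g := fun w => G p x u * cauchyExp p w)
      (continuousOn_const.mul (Contour.continuousOn_cauchyExp hpm))
      (B := ‖G p x u‖ * (Real.exp p.re / δ))]
    · refine Contour.integral_congr fun w hw => ?_
      rw [hne w (by rintro rfl; exact hpm hw), hκ, cauchyExp]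
      ring
    · intro w hw
      rw [norm_mul, mul_assoc]
      gcongr
      exact norm_cauchyExp_le hδ (hd w hw)
  · intro n
    by_cases hnp : (n : ℂ) = p
    · have h0 : (∑' k : ℕ, if (k : ℤ) = n then (residueG x u k : ℂ) / (k - p) else 0) = 0 := by
        rcases le_or_gt 0 n with hn | hn
        · lift n to ℕ using hn
          rw [tsum_ite_natCast (fun k : ℕ => (residueG x u k : ℂ) / (k - p)), ← hnp]
          simp
        · exact tsum_ite_neg _ hn
      have hc : ContinuousAt h p := continuousAt_dslope_same.2 (hκd p hp)
      rw [h0, hnp]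
      have h1 : ContinuousAt (fun w => (w - p) * h w) p :=
        (continuousAt_id.sub continuousAt_const).mul hc
      have h2 := h1.tendsto.mono_left (nhdsWithin_le_nhds (s := {p}ᶜ))
      rwa [sub_self, zero_mul] at h2
    · have hnp' := sub_ne_zero.2 hnp
      have h1 : ContinuousAt (fun w : ℂ => (w - n) * (G p x u * Complex.exp (-(w - p)))) n := by
        fun_prop
      have h2 := h1.tendsto.mono_left (nhdsWithin_le_nhds (s := {(n : ℂ)}ᶜ))
      rw [sub_self, zero_mul] at h2
      have h3 : Tendsto (fun w : ℂ => w - p) (𝓝[≠] (n : ℂ)) (𝓝 (n - p)) :=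
        ((continuous_id.sub continuous_const).tendsto (n : ℂ)).mono_left nhdsWithin_le_nhds
      have h4 := ((tendsto_sub_mul_G x hu n).sub h2).div h3 hnp'
      have e : (∑' k : ℕ, if (k : ℤ) = n then (residueG x u k : ℂ) / (k - p) else 0) =
          ((∑' k : ℕ, if (k : ℤ) = n then (residueG x u k : ℂ) else 0) - 0) / (n - p) := by
        rcases le_or_gt 0 n with hn | hn
        · lift n to ℕ using hn
          rw [tsum_ite_natCast (fun k : ℕ => (residueG x u k : ℂ) / (k - p)), tsum_ite_natCast]
          simp
        · rw [tsum_ite_neg _ hn, tsum_ite_neg _ hn]; simp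
      rw [e]
      refine h4.congr' ?_
      have hev : ∀ᶠ w in 𝓝[≠] (n : ℂ), w ≠ p :=
        nhdsWithin_le_nhds (isOpen_ne.mem_nhds hnp)
      filter_upwards [hev] with w hw
      rw [hne w hw, hκ, Pi.div_apply]
      ring
  · intro B
    obtain ⟨A', hA'⟩ := EdgeKernel.exists_norm_G_le x hu 0 B (δ := 1 / 2) (by norm_num)
    refine ⟨(A' + ‖G p x u‖ * Real.exp p.re) / 1, ?_⟩
    filter_upwards [eventually_ge_atTop ⌈p.re + 1⌉₊] with N hN1 w hw hwB
    have h1 : p.re + 1 ≤ N := (Nat.le_ceil _).trans (by exact_mod_cast hN1)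
    have h2 : (1 : ℝ) ≤ ‖w - p‖ := by
      refine le_trans ?_ ((le_abs_self _).trans (Complex.abs_re_le_norm _))
      rw [Complex.sub_re, hw]; linarith
    exact hnorm one_pos h2 (hA' w (by rw [hw]; positivity) hwB
      (one_half_le_norm_sub_natCast_of_re hw))

/-! ### The double series -/

theorem sum_antidiagonal_pow_div_factorial (x y : ℝ) (N : ℕ) :
    ∑ q ∈ Finset.HasAntidiagonal.antidiagonal N, x ^ q.1 / q.1.factorial * (y ^ q.2 / q.2.factorial) =
      (x + y) ^ N / N.factorial := by
  rw [(Commute.all x y).add_pow', Finset.sum_div]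
  refine Finset.sum_congr rfl fun q hq => ?_
  rw [Finset.HasAntidiagonal.mem_antidiagonal] at hq
  have h := Nat.add_choose_mul_factorial_mul_factorial q.1 q.2
  rw [hq, ← Nat.choose_symm_of_eq_add hq.symm] at h
  have h' : ((N.choose q.1 : ℕ) : ℝ) * q.1.factorial * q.2.factorial = N.factorial := by
    exact_mod_cast h
  have h1 : (q.1.factorial : ℝ) ≠ 0 := by positivity
  have h2 : (q.2.factorial : ℝ) ≠ 0 := by positivity
  have h3 : (N.factorial : ℝ) ≠ 0 := by positivity
  rw [nsmul_eq_mul]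
  field_simp
  linear_combination (-(x ^ q.1 * y ^ q.2)) * h'

/-- The terms of the double series for the kernel. -/
def doubleTerm (x₁ x₂ : ℤ) (u₁ u₂ : ℝ) (q : ℕ × ℕ) : ℝ :=
  residueG x₁ u₁ q.1 * residueG x₂ u₂ q.2 / (q.2 - ((x₁ - x₂ - 1 - q.1 : ℤ) : ℝ))

theorem summable_doubleTerm (x₁ x₂ : ℤ) {u₁ u₂ : ℝ} (hu₁ : 0 ≤ u₁) (hu₂ : 0 ≤ u₂) :
    Summable (doubleTerm x₁ x₂ u₁ u₂) := by
  have h1 := (Real.summable_pow_div_factorial u₁).mul_left (2 / Real.pi)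
  have h2 := (Real.summable_pow_div_factorial u₂).mul_left (2 / Real.pi)
  refine Summable.of_norm_bounded (h1.mul_of_nonneg h2 (fun k => ?_) fun k => ?_) fun q => ?_
  · simp only [Pi.zero_apply]; positivity
  · simp only [Pi.zero_apply]; positivity
  · have h3 := norm_residueG_le x₁ hu₁ q.1
    have h4 := norm_residueG_le x₂ hu₂ q.2
    rw [Complex.norm_real] at h3 h4
    have h5 := abs_inv_int_le_one (q.2 - (x₁ - x₂ - 1 - q.1))
    rw [doubleTerm, div_eq_mul_inv, norm_mul, norm_mul]
    have h6 : ‖((q.2 : ℝ) - ((x₁ - x₂ - 1 - q.1 : ℤ) : ℝ))⁻¹‖ ≤ 1 := by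
      rw [Real.norm_eq_abs]
      exact_mod_cast h5
    calc _ ≤ 2 / Real.pi * (u₁ ^ q.1 / q.1.factorial) * (2 / Real.pi * (u₂ ^ q.2 / q.2.factorial)) * 1 := by
          gcongr
      _ = _ := mul_one _

/-- Along k + l = N only the sign (-1)^l depends on l. Under the binomial theorem the two summands
produce (u₁ - u₂)^N and (-(u₁ + u₂))^N. -/
theorem cos_mul_cos_parity (x₁ x₂ : ℤ) {k l N : ℕ} (h : k + l = N) :
    Real.cos (Real.pi / 2 * (k + x₁)) * Real.cos (Real.pi / 2 * (l + x₂)) =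
      1 / 2 * Real.cos (Real.pi / 2 * (N + ((x₁ - x₂ : ℤ) : ℝ))) *
        ((-1) ^ l + (-1) ^ x₁ * (-1) ^ N) := by
  have h1 := Real.two_mul_cos_mul_cos (Real.pi / 2 * (k + x₁)) (Real.pi / 2 * (l + x₂))
  have hN : (k : ℝ) + l = N := by exact_mod_cast h
  rw [show Real.pi / 2 * (k + x₁) - Real.pi / 2 * (l + x₂) =
      Real.pi / 2 * (N + ((x₁ - x₂ : ℤ) : ℝ)) + Real.pi * ((-l : ℤ) : ℝ) by
        rw [← hN]; push_cast; ring,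
    show Real.pi / 2 * (k + x₁) + Real.pi / 2 * (l + x₂) =
      -(Real.pi / 2 * (N + ((x₁ - x₂ : ℤ) : ℝ))) + Real.pi * ((x₁ + N : ℤ) : ℝ) by
        push_cast; rw [← hN]; ring,
    cos_add_pi_mul_int, cos_add_pi_mul_int, Real.cos_neg, zpow_add₀ (by norm_num), zpow_neg,
    zpow_natCast, zpow_natCast, ← inv_pow, inv_neg_one] at h1
  linear_combination h1 / 2

/-- The denominator depends only on N = k + l, so absolute convergence allows regrouping by
antidiagonals, each of which the binomial theorem sums. -/
theorem tsum_doubleTerm (x₁ x₂ : ℤ) {u₁ u₂ : ℝ} (hu₁ : 0 ≤ u₁) (hu₂ : 0 ≤ u₂) :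
    ∑' q, doubleTerm x₁ x₂ u₁ u₂ q = 2 / Real.pi * seriesPart x₁ x₂ u₁ u₂ := by
  have h1 := (summable_doubleTerm x₁ x₂ hu₁ hu₂).hasSum
  rw [← Finset.HasAntidiagonal.sigmaAntidiagonalEquivProd.hasSum_iff] at h1
  have h2 := h1.sigma fun N => hasSum_fintype _
  have h3 := (((summable_cosMoment (x₁ - x₂) (u₁ - u₂)).hasSum).add
    ((summable_cosMoment (x₁ - x₂) (-(u₁ + u₂))).hasSum.mul_left ((-1) ^ x₁))).mul_left
      (2 / Real.pi * (1 / Real.pi))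
  rw [seriesPart, ← mul_assoc]
  refine h2.unique (h3.congr_fun fun N => ?_)
  rw [Finset.univ_eq_attach]
  simp only [Function.comp, Finset.HasAntidiagonal.sigmaAntidiagonalEquivProd_apply]
  rw [Finset.sum_attach (Finset.HasAntidiagonal.antidiagonal N) (fun q => doubleTerm x₁ x₂ u₁ u₂ q)]
  set c := Real.cos (Real.pi / 2 * (N + ((x₁ - x₂ : ℤ) : ℝ))) with hc
  set D : ℝ := (N : ℝ) - ((x₁ - x₂ : ℤ) : ℝ) + 1 with hD
  have hterm : ∀ q ∈ Finset.HasAntidiagonal.antidiagonal N, doubleTerm x₁ x₂ u₁ u₂ q =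
      2 / Real.pi * (1 / Real.pi) * c / D *
        (u₁ ^ q.1 / q.1.factorial * ((-u₂) ^ q.2 / q.2.factorial) +
          (-1) ^ x₁ * (-1) ^ N * (u₁ ^ q.1 / q.1.factorial * (u₂ ^ q.2 / q.2.factorial))) := by
    intro q hq
    rw [Finset.HasAntidiagonal.mem_antidiagonal] at hq
    have h := cos_mul_cos_parity x₁ x₂ hq
    have hN : (q.1 : ℝ) + q.2 = N := by exact_mod_cast hq
    rw [doubleTerm, residueG, residueG, neg_pow u₂,
      show (q.2 : ℝ) - ((x₁ - x₂ - 1 - q.1 : ℤ) : ℝ) = D by rw [hD, ← hN]; push_cast; ring]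
    linear_combination (2 / Real.pi * (u₁ ^ q.1 / q.1.factorial) * (2 / Real.pi) *
      (u₂ ^ q.2 / q.2.factorial) / D) * h
  rw [Finset.sum_congr rfl hterm, ← Finset.mul_sum, Finset.sum_add_distrib, ← Finset.mul_sum,
    sum_antidiagonal_pow_div_factorial, sum_antidiagonal_pow_div_factorial, neg_pow (u₁ + u₂),
    ← sub_eq_add_neg]
  ring

/-! ### The extra residues -/

/-- The contribution of the residues at `w + z = x₁ - x₂ - 1`. -/
def extraResidue (x₁ x₂ : ℤ) (u₁ u₂ : ℝ) (k : ℕ) : ℂ :=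
  residueG x₁ u₁ k *
    (if 0 ≤ x₁ - x₂ - 1 - k then G ((x₁ - x₂ - 1 - k : ℤ) : ℂ) x₂ u₂ else 0)

theorem sin_pi_half_eq_neg_cos (x₁ : ℤ) (k : ℕ) :
    Real.sin (Real.pi / 2 * (x₁ - 1 - k)) = -((-1) ^ k * Real.cos (Real.pi / 2 * (k + x₁))) := by
  have h := cos_add_pi_mul_int (Real.pi / 2 * (k + x₁)) (-k)
  rw [zpow_neg, zpow_natCast, ← inv_pow, inv_neg_one] at h
  rw [← h, ← Real.sin_sub_pi_div_two]
  congr 1; push_cast; ring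

/-- If k + x₁ is odd, the cosine and the sine both vanish; then `0 / 0 = 0` agrees with the right
side, where the two signs cancel. -/
theorem cos_div_sin_parity (x₁ : ℤ) (k : ℕ) :
    Real.cos (Real.pi / 2 * (k + x₁)) / Real.sin (Real.pi / 2 * (x₁ - 1 - k)) =
      -(1 / 2) * ((-1) ^ k + (-1) ^ x₁) := by
  rw [sin_pi_half_eq_neg_cos]
  rcases Int.even_or_odd (k + x₁) with h | h
  · have hne : Real.cos (Real.pi / 2 * (k + x₁)) ≠ 0 := by
      obtain ⟨j, hj⟩ := h
      have : (k : ℝ) + x₁ = j + j := by exact_mod_cast hj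
      rw [this, show Real.pi / 2 * ((j : ℝ) + j) = 0 + Real.pi * j by ring, cos_add_pi_mul_int,
        Real.cos_zero, mul_one]
      exact zpow_ne_zero _ (by norm_num)
    have e : ((-1 : ℝ)) ^ x₁ = (-1) ^ k := by
      have := h.neg_one_zpow (α := ℝ)
      rw [zpow_add₀ (by norm_num), zpow_natCast] at this
      rcases neg_one_pow_eq_or ℝ k with h1 | h1 <;> rw [h1] at this ⊢ <;> linarith
    have hk : ((-1 : ℝ)) ^ k * (-1) ^ k = 1 := by rw [← mul_pow]; norm_num
    have hk0 : ((-1 : ℝ)) ^ k ≠ 0 := pow_ne_zero _ (by norm_num)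
    generalize Real.cos (Real.pi / 2 * (k + x₁)) = c at hne ⊢
    rw [e]
    field_simp
    linear_combination 2 * hk
  · have h0 : Real.cos (Real.pi / 2 * (k + x₁)) = 0 := by
      obtain ⟨j, hj⟩ := h
      have : (k : ℝ) + x₁ = 2 * j + 1 := by exact_mod_cast hj
      rw [Real.cos_eq_zero_iff]
      exact ⟨j, by rw [this]; ring⟩
    have e : ((-1 : ℝ)) ^ x₁ = -(-1) ^ k := by
      have := h.neg_one_zpow (α := ℝ)
      rw [zpow_add₀ (by norm_num), zpow_natCast] at this
      rcases neg_one_pow_eq_or ℝ k with h1 | h1 <;> rw [h1] at this ⊢ <;> linarith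
    rw [h0, e]; simp

theorem hasSum_extraResidue_of_le {x₁ x₂ : ℤ} (h : x₁ ≤ x₂) (u₁ u₂ : ℝ) :
    HasSum (extraResidue x₁ x₂ u₁ u₂) 0 := by
  convert! hasSum_zero with k
  rw [extraResidue, if_neg (by omega), mul_zero]

/-- Only k ≤ j contributes. There G is evaluated at the natural number l = j - k, where Γ(l + 1) =
l!, so the sum is again binomial. -/
theorem hasSum_extraResidue_of_lt {x₁ x₂ : ℤ} {j : ℕ} (h : x₁ - x₂ = j + 1) (u₁ u₂ : ℝ) :
    HasSum (extraResidue x₁ x₂ u₁ u₂)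
      ((-(1 / Real.pi) * (((u₂ - u₁) ^ j + (-1) ^ x₁ * (u₁ + u₂) ^ j) / j.factorial) : ℝ) : ℂ) := by
  have hsup : ∀ k ∉ Finset.range (j + 1), extraResidue x₁ x₂ u₁ u₂ k = 0 := by
    intro k hk
    rw [Finset.mem_range] at hk
    rw [extraResidue, if_neg (by omega), mul_zero]
  have hfin := hasSum_sum_of_ne_finset_zero hsup (L := .unconditional ℕ)
  rw [← Finset.Nat.sum_antidiagonal_eq_sum_range_succ_mk
    (fun q : ℕ × ℕ => extraResidue x₁ x₂ u₁ u₂ q.1)] at hfin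
  have hterm : ∀ q ∈ Finset.HasAntidiagonal.antidiagonal j, extraResidue x₁ x₂ u₁ u₂ q.1 =
      ((-(1 / Real.pi) * ((-u₁) ^ q.1 / q.1.factorial * (u₂ ^ q.2 / q.2.factorial) +
        (-1) ^ x₁ * (u₁ ^ q.1 / q.1.factorial * (u₂ ^ q.2 / q.2.factorial))) : ℝ) : ℂ) := by
    intro q hq
    rw [Finset.HasAntidiagonal.mem_antidiagonal] at hq
    have hp : x₁ - x₂ - 1 - (q.1 : ℤ) = q.2 := by omega
    have hp' : (q.2 : ℝ) + x₂ = x₁ - 1 - q.1 := by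
      have : (q.2 : ℤ) + x₂ = x₁ - 1 - q.1 := by omega
      exact_mod_cast this
    rw [extraResidue, hp, if_pos (Int.natCast_nonneg _), G, Int.cast_natCast,
      Complex.Gamma_nat_eq_factorial, Complex.cpow_natCast]
    have hs : Complex.sin (Real.pi / 2 * ((q.2 : ℂ) + x₂)) =
        ((Real.sin (Real.pi / 2 * (x₁ - 1 - q.1)) : ℝ) : ℂ) := by
      rw [← hp']; push_cast; rfl
    have hcs := cos_div_sin_parity x₁ q.1
    rw [hs, residueG]
    norm_cast
    rw [neg_pow u₁]
    push_cast at hcs ⊢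
    linear_combination (2 / Real.pi * (u₁ ^ q.1 / q.1.factorial) * (u₂ ^ q.2 / q.2.factorial)) * hcs
  rw [Finset.sum_congr rfl hterm, ← Complex.ofReal_sum, ← Finset.mul_sum, Finset.sum_add_distrib,
    ← Finset.mul_sum, sum_antidiagonal_pow_div_factorial, sum_antidiagonal_pow_div_factorial] at hfin
  convert! hfin using 2
  ring

/-! ### Evaluation of the double contour integral -/

/-- A nonzero residue forces k + x₁ to be even, so x₁ - 1 - k is odd. Hence the pole left by the
w-integral never coincides with a pole of G(·; x₂, u₂), and no double poles arise. -/
theorem sin_ne_zero_of_residueG_ne_zero {x₁ : ℤ} {u₁ : ℝ} {k : ℕ} (h : residueG x₁ u₁ k ≠ 0)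
    (x₂ : ℤ) : Complex.sin (Real.pi / 2 * (((x₁ - x₂ - 1 - k : ℤ) : ℂ) + x₂)) ≠ 0 := by
  have hc : Real.cos (Real.pi / 2 * (k + x₁)) ≠ 0 := by
    intro h0; apply h; rw [residueG, h0]; simp
  have e : (Real.pi / 2 * (((x₁ - x₂ - 1 - k : ℤ) : ℂ) + x₂)) =
      ((Real.pi / 2 * (x₁ - 1 - k) : ℝ) : ℂ) := by push_cast; ring
  rw [e, ← Complex.ofReal_sin, sin_pi_half_eq_neg_cos, Complex.ofReal_ne_zero]
  exact neg_ne_zero.2 (mul_ne_zero (pow_ne_zero _ (by norm_num)) hc)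

namespace Admissible

variable {x₁ x₂ : ℤ} {Cz Cw : Contour}

theorem exists_arm_eq (h : Admissible x₁ x₂ Cz Cw) {z : ℂ} (hz : z ∈ Cz.support) :
    ∃ t, z = Cz.arm t := by
  obtain ⟨c, t, -, rfl⟩ := Set.mem_iUnion.1 hz
  cases c with
  | none => exact ⟨t, rfl⟩
  | some i => exact absurd i.2 (by have := h.singleZ; omega)

theorem integral_w (h : Admissible x₁ x₂ Cz Cw) {u₁ : ℝ} (hu₁ : 0 < u₁) {z : ℂ}
    (hz : z ∈ Cz.support) :
    Cw.integral (fun w => G w x₁ u₁ / (w + z + x₂ - x₁ + 1)) =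
      2 * Real.pi * Complex.I *
        ∑' k : ℕ, (residueG x₁ u₁ k : ℂ) / (z - ((x₁ - x₂ - 1 - k : ℤ) : ℂ)) := by
  obtain ⟨δ, hδ, haway⟩ := h.away
  set p : ℂ := x₁ - x₂ - 1 - z with hp
  have hd : ∀ w ∈ Cw.support, δ ≤ ‖w - p‖ := fun w hw => by
    rw [hp, show w - (x₁ - x₂ - 1 - z) = w + z + x₂ - x₁ + 1 by ring]
    exact haway z hz w hw
  have hsin : Complex.sin (Real.pi / 2 * (p + x₁)) ≠ 0 := by
    refine sin_ne_zero_of_notMem_range ?_ x₁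
    rintro ⟨n, hn⟩
    refine h.enclosesZ.support_subset hz ⟨x₁ - x₂ - 1 - n, ?_⟩
    push_cast
    rw [hn, hp]; ring
  -- The reflected curve s ↦ x₁ - x₂ - 1 - C_z(s) passes through p, stays δ away from C_w and goes
  -- to the left. That C_z is a single curve matters here: every z lies on the unbounded arm.
  have hzero : Cw.integral (cauchyExp p) = 0 := by
    obtain ⟨t, rfl⟩ := h.exists_arm_eq hz
    have hγ := Cz.isUnboundedCurve_arm
    refine Contour.integral_cauchyExp_eq_zero_of_curve (κ := fun t => x₁ - x₂ - 1 - Cz.arm t)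
      (continuous_const.sub hγ.continuous) hδ (fun s w hw => ?_) ?_ t
    · rw [show w - (x₁ - x₂ - 1 - Cz.arm s) = w + Cz.arm s + x₂ - x₁ + 1 by ring]
      exact haway _ (Contour.piece_mem_support (c := none) trivial) w hw
    · simp only [Complex.sub_re]
      exact tendsto_const_nhds.add_atBot (tendsto_neg_atTop_atBot.comp hγ.tendsto_re_atTop)
  have hmain := h.enclosesW.integral_G_div x₁ hu₁ hsin hδ hd
  rw [hzero, mul_zero, add_zero] at hmain
  convert! hmain using 2
  · ext w; rw [hp]; congr 1; ring
  · congr 1; ext k; rw [hp]; congr 1; push_cast; ring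

/-- The series is integrated termwise. The k-th term gives the k-th row of the double series and, if
x₁ - x₂ - 1 - k ≥ 0, also the residue at that enclosed integer. -/
theorem integral_z (h : Admissible x₁ x₂ Cz Cw) {u₁ u₂ : ℝ} (hu₁ : 0 < u₁) (hu₂ : 0 < u₂) :
    Cz.integral (fun z => G z x₂ u₂ *
        ∑' k : ℕ, (residueG x₁ u₁ k : ℂ) / (z - ((x₁ - x₂ - 1 - k : ℤ) : ℂ))) =
      2 * Real.pi * Complex.I * ((2 / Real.pi * seriesPart x₁ x₂ u₁ u₂ : ℝ) +
        ∑' k, extraResidue x₁ x₂ u₁ u₂ k) := by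
  obtain ⟨δ, hδ, haway⟩ := h.enclosesZ.away
  obtain ⟨A, hA0, hA⟩ := h.enclosesZ.exists_norm_G_le x₂ hu₂
  have hne : ∀ z ∈ Cz.support, ∀ n : ℤ, z - n ≠ 0 := fun z hz n h0 => by
    have := haway z hz n
    rw [h0, norm_zero] at this
    linarith
  have hsum := Contour.hasSum_integral (C := Cz)
    (f := fun (k : ℕ) z => (residueG x₁ u₁ k : ℂ) *
      (G z x₂ u₂ / (z - ((x₁ - x₂ - 1 - k : ℤ) : ℂ))))
    (A := fun k : ℕ => 2 / Real.pi * (u₁ ^ k / k.factorial) * (A / δ))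
    (fun k => continuousOn_const.mul (((differentiableOn_G x₂ hu₂).continuousOn.mono
      h.enclosesZ.support_subset).div (by fun_prop) fun z hz => hne z hz _))
    (fun k z hz => ?_)
    (((Real.summable_pow_div_factorial u₁).mul_left _).mul_right _)
  · have hterm : ∀ k : ℕ, Cz.integral (fun z => (residueG x₁ u₁ k : ℂ) *
        (G z x₂ u₂ / (z - ((x₁ - x₂ - 1 - k : ℤ) : ℂ)))) =
        2 * Real.pi * Complex.I *
          (((∑' l, doubleTerm x₁ x₂ u₁ u₂ (k, l) : ℝ) : ℂ) + extraResidue x₁ x₂ u₁ u₂ k) := by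
      intro k
      rw [Contour.integral_const_mul]
      by_cases hr : residueG x₁ u₁ k = 0
      · simp [hr, doubleTerm, extraResidue]
      · rw [h.enclosesZ.integral_G_div x₂ hu₂ (sin_ne_zero_of_residueG_ne_zero hr x₂) hδ
          (fun w hw => haway w hw _), h.enclosesZ.integral_cauchyExp_int, Complex.ofReal_tsum,
          extraResidue]
        simp only [doubleTerm]
        have e : ∑' l : ℕ, ((residueG x₁ u₁ k * residueG x₂ u₂ l /
            ((l : ℝ) - ((x₁ - x₂ - 1 - k : ℤ) : ℝ)) : ℝ) : ℂ) =
            residueG x₁ u₁ k * ∑' l : ℕ, (residueG x₂ u₂ l : ℂ) /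
              (l - ((x₁ - x₂ - 1 - k : ℤ) : ℂ)) := by
          rw [← tsum_mul_left]
          congr 1; ext l
          push_cast
          ring
        rw [e]
        split_ifs <;> ring
    simp_rw [hterm] at hsum
    have hs := summable_doubleTerm x₁ x₂ hu₁.le hu₂.le
    have h1 : HasSum (fun k => ((∑' l, doubleTerm x₁ x₂ u₁ u₂ (k, l) : ℝ) : ℂ))
        ((2 / Real.pi * seriesPart x₁ x₂ u₁ u₂ : ℝ) : ℂ) := by
      rw [Complex.hasSum_ofReal, ← tsum_doubleTerm x₁ x₂ hu₁.le hu₂.le]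
      exact hs.hasSum.prod_fiberwise fun k => (hs.prod_factor k).hasSum
    have h2 : Summable (extraResidue x₁ x₂ u₁ u₂) := by
      rcases le_or_gt x₁ x₂ with hx | hx
      · exact (hasSum_extraResidue_of_le hx u₁ u₂).summable
      · exact (hasSum_extraResidue_of_lt (j := (x₁ - x₂ - 1).toNat) (by omega) u₁ u₂).summable
    have h3 := (h1.add h2.hasSum).mul_left (2 * Real.pi * Complex.I)
    rw [← hsum.unique h3]
    congr 1
    ext z
    rw [← tsum_mul_left]
    congr 1; ext k; ring
  · rw [norm_mul, norm_div]
    calc _ ≤ 2 / Real.pi * (u₁ ^ k / k.factorial) * (A * Real.exp (-z.re) / δ) := by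
          gcongr
          · exact norm_residueG_le x₁ hu₁.le k
          · exact hA z hz
          · exact haway z hz _
      _ = _ := by ring

theorem doubleIntegral_eq (h : Admissible x₁ x₂ Cz Cw) {u₁ u₂ : ℝ} (hu₁ : 0 < u₁) (hu₂ : 0 < u₂) :
    doubleIntegral Cz Cw (contourIntegrand x₁ u₁ x₂ u₂) =
      seriesPart x₁ x₂ u₁ u₂ + Real.pi / 2 * ∑' k, extraResidue x₁ x₂ u₁ u₂ k := by
  have hpi : (Real.pi : ℂ) ≠ 0 := by exact_mod_cast Real.pi_ne_zero
  have h1 : Cz.integral (fun z => Cw.integral fun w => contourIntegrand x₁ u₁ x₂ u₂ z w) =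
      Cz.integral fun z => (Real.pi / 2 * (2 * Real.pi * Complex.I)) * (G z x₂ u₂ *
        ∑' k : ℕ, (residueG x₁ u₁ k : ℂ) / (z - ((x₁ - x₂ - 1 - k : ℤ) : ℂ))) := by
    refine Contour.integral_congr fun z hz => ?_
    have e : (fun w => contourIntegrand x₁ u₁ x₂ u₂ z w) = fun w =>
        (Real.pi / 2 * G z x₂ u₂) * (G w x₁ u₁ / (w + z + x₂ - x₁ + 1)) := by
      ext w; rw [contourIntegrand]; ring
    rw [e, Contour.integral_const_mul, h.integral_w hu₁ hz]
    ring
  rw [doubleIntegral, h1, Contour.integral_const_mul, h.integral_z hu₁ hu₂]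
  push_cast
  field_simp

theorem doubleIntegrable (h : Admissible x₁ x₂ Cz Cw) {u₁ u₂ : ℝ} (hu₁ : 0 < u₁) (hu₂ : 0 < u₂) :
    DoubleIntegrable Cz Cw (contourIntegrand x₁ u₁ x₂ u₂) := by
  intro a b
  obtain ⟨δ, hδ, haway⟩ := h.away
  obtain ⟨A₁, hA₁0, hA₁⟩ := h.enclosesW.exists_norm_G_le x₁ hu₁
  obtain ⟨A₂, hA₂0, hA₂⟩ := h.enclosesZ.exists_norm_G_le x₂ hu₂
  have hint := ((Cz.integrableOn_length a).mul_prod (Cw.integrableOn_length b)).const_mul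
    (Real.pi / 2 * (A₁ * A₂ / δ))
  have hmem : ∀ᵐ q : ℝ × ℝ ∂((volume.restrict (Cz.dom a)).prod (volume.restrict (Cw.dom b))),
      q.1 ∈ Cz.dom a ∧ q.2 ∈ Cw.dom b := by
    rw [Measure.prod_restrict]
    exact ae_restrict_mem ((Cz.measurableSet_dom a).prod (Cw.measurableSet_dom b))
  have hc1 : ContinuousOn (fun z => G z x₂ u₂) Cz.support :=
    (differentiableOn_G x₂ hu₂).continuousOn.mono h.enclosesZ.support_subset
  have hc2 : ContinuousOn (fun w => G w x₁ u₁) Cw.support :=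
    (differentiableOn_G x₁ hu₁).continuousOn.mono h.enclosesW.support_subset
  have hcont : ContinuousOn (fun q : ℝ × ℝ =>
      contourIntegrand x₁ u₁ x₂ u₂ (Cz.piece a q.1) (Cw.piece b q.2)) (Cz.dom a ×ˢ Cw.dom b) := by
    have hz : ContinuousOn (fun q : ℝ × ℝ => Cz.piece a q.1) (Cz.dom a ×ˢ Cw.dom b) :=
      (Cz.continuousOn_piece a).comp continuousOn_fst fun q hq => hq.1
    have hw : ContinuousOn (fun q : ℝ × ℝ => Cw.piece b q.2) (Cz.dom a ×ˢ Cw.dom b) :=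
      (Cw.continuousOn_piece b).comp continuousOn_snd fun q hq => hq.2
    unfold contourIntegrand
    refine continuousOn_const.mul (ContinuousOn.div
      ((hc2.comp hw fun q hq => Contour.piece_mem_support hq.2).mul
        (hc1.comp hz fun q hq => Contour.piece_mem_support hq.1))
      ((((hw.add hz).add continuousOn_const).sub continuousOn_const).add continuousOn_const)
      fun q hq h0 => ?_)
    have := haway _ (Contour.piece_mem_support hq.1) _ (Contour.piece_mem_support hq.2)
    rw [h0, norm_zero] at this
    linarith
  refine hint.mono' (AEStronglyMeasurable.mul ?_ ?_) ?_
  · rw [Measure.prod_restrict]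
    exact hcont.aestronglyMeasurable ((Cz.measurableSet_dom a).prod (Cw.measurableSet_dom b))
  · exact (((measurable_deriv _).comp measurable_fst).mul
      ((measurable_deriv _).comp measurable_snd)).aestronglyMeasurable
  · filter_upwards [hmem] with q hq
    have h1 := hA₁ _ (Contour.piece_mem_support hq.2)
    have h2 := hA₂ _ (Contour.piece_mem_support hq.1)
    have h3 := haway _ (Contour.piece_mem_support hq.1) _ (Contour.piece_mem_support hq.2)
    rw [contourIntegrand, norm_mul, norm_mul, norm_mul, norm_div, norm_div, norm_mul,
      Complex.norm_real, Real.norm_eq_abs, abs_of_pos Real.pi_pos, Complex.norm_ofNat]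
    calc _ ≤ Real.pi / 2 * (A₁ * Real.exp (-(Cw.piece b q.2).re) *
          (A₂ * Real.exp (-(Cz.piece a q.1).re)) / δ) *
          (‖deriv (Cz.piece a) q.1‖ * ‖deriv (Cw.piece b) q.2‖) := by gcongr
      _ = _ := by ring

end Admissible

/-! ### Existence of contours -/

/-- The curve `t ↦ t² - 1/4 + a - i arctan t`. -/
def hairpin (a t : ℝ) : ℂ := ((t ^ 2 - 1 / 4 + a : ℝ) : ℂ) - (Real.arctan t : ℝ) * Complex.I

@[simp] theorem hairpin_re (a t : ℝ) : (hairpin a t).re = t ^ 2 - 1 / 4 + a := by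
  rw [hairpin, Complex.sub_re, Complex.ofReal_re, Complex.re_ofReal_mul, Complex.I_re, mul_zero,
    sub_zero]

@[simp] theorem hairpin_im (a t : ℝ) : (hairpin a t).im = -Real.arctan t := by
  rw [hairpin, Complex.sub_im, Complex.ofReal_im, Complex.im_ofReal_mul, Complex.I_im, mul_one,
    zero_sub]

theorem hasDerivAt_hairpin (a t : ℝ) :
    HasDerivAt (hairpin a) (((2 * t : ℝ) : ℂ) - ((1 / (1 + t ^ 2) : ℝ) : ℂ) * Complex.I) t := by
  have h1 : HasDerivAt (fun t : ℝ => t ^ 2 - 1 / 4 + a) (2 * t) t := by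
    simpa using ((hasDerivAt_pow 2 t).sub_const (1 / 4)).add_const a
  exact h1.ofReal_comp.sub ((Real.hasDerivAt_arctan t).ofReal_comp.mul_const Complex.I)

theorem deriv_hairpin (a : ℝ) : deriv (hairpin a) =
    fun t => ((2 * t : ℝ) : ℂ) - ((1 / (1 + t ^ 2) : ℝ) : ℂ) * Complex.I :=
  funext fun t => (hasDerivAt_hairpin a t).deriv

theorem continuous_deriv_hairpin (a : ℝ) : Continuous (deriv (hairpin a)) := by
  rw [deriv_hairpin]
  have : Continuous fun t : ℝ => 1 / (1 + t ^ 2) :=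
    Continuous.div (by fun_prop) (by fun_prop) fun t => by positivity
  exact (Complex.continuous_ofReal.comp (by fun_prop)).sub
    ((Complex.continuous_ofReal.comp this).mul continuous_const)

theorem isUnboundedCurve_hairpin (a : ℝ) : IsUnboundedCurve (hairpin a) where
  continuous := continuous_iff_continuousAt.2 fun t => (hasDerivAt_hairpin a t).continuousAt
  piecewiseC1 := ⟨∅, fun t _ => (hasDerivAt_hairpin a t).differentiableAt,
    (continuous_deriv_hairpin a).continuousOn⟩
  tendsto_re := by
    simp only [hairpin_re]
    refine tendsto_atTop_add_const_right _ _ (tendsto_atTop_add_const_right _ _ ?_)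
    have := (tendsto_pow_atTop (α := ℝ) two_ne_zero).comp (tendsto_norm_cocompact_atTop (E := ℝ))
    refine this.congr fun t => ?_
    simp
  bounded_im := ⟨Real.pi / 2, fun t => by
    rw [hairpin_im, abs_neg, abs_le]
    exact ⟨(Real.neg_pi_div_two_lt_arctan t).le, (Real.arctan_lt_pi_div_two t).le⟩⟩
  integrable_length := by
    have h1 := integrable_exp_neg_mul_sq (one_pos)
    have h2 := (integrable_mul_exp_neg_mul_sq (one_pos)).norm
    refine ((h2.const_mul 2).add h1).const_mul (Real.exp (1 / 4 - a)) |>.mono' ?_ ?_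
    · refine Continuous.aestronglyMeasurable ?_
      refine Continuous.mul ?_ (continuous_deriv_hairpin a).norm
      simp only [hairpin_re]
      fun_prop
    · refine Eventually.of_forall fun t => ?_
      have h3 : ‖deriv (hairpin a) t‖ ≤ 2 * |t| + 1 := by
        rw [deriv_hairpin]
        refine (norm_sub_le _ _).trans (add_le_add ?_ ?_)
        · rw [Complex.norm_real, norm_mul, Real.norm_ofNat, Real.norm_eq_abs]
        · rw [norm_mul, Complex.norm_I, mul_one, Complex.norm_real, Real.norm_eq_abs,
            abs_of_pos (by positivity), div_le_one (by positivity)]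
          nlinarith [sq_nonneg t]
      simp only [Pi.add_apply]
      rw [hairpin_re, norm_mul, norm_norm, Real.norm_eq_abs, Real.abs_exp,
        norm_mul, Real.norm_eq_abs, Real.norm_eq_abs, Real.abs_exp]
      calc _ ≤ Real.exp (-(t ^ 2 - 1 / 4 + a)) * (2 * |t| + 1) := by gcongr
        _ = Real.exp (1 / 4 - a) * Real.exp (-1 * t ^ 2) * (2 * |t| + 1) := by
          rw [← Real.exp_add]; ring_nf
        _ = _ := by ring

theorem exists_hairpin_away :
    ∃ δ : ℝ, 0 < δ ∧ δ ≤ 1 / 2 ∧ ∀ (t : ℝ) (n : ℤ), δ ≤ ‖hairpin 0 t - n‖ := by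
  have harc : 0 < Real.arctan (1 / 4) := Real.arctan_pos.2 (by norm_num)
  -- For |t| ≤ 1/4 the real part lies in [-1/4, -3/16], at least 3/16 from every integer; otherwise
  -- the imaginary part is at least arctan(1/4) in absolute value.
  refine ⟨min (3 / 16) (Real.arctan (1 / 4)), by positivity,
    (min_le_left _ _).trans (by norm_num), fun t n => ?_⟩
  rcases le_or_gt |t| (1 / 4) with ht | ht
  · refine (min_le_left _ _).trans (le_trans ?_ (Complex.abs_re_le_norm _))
    have h1 : t ^ 2 ≤ 1 / 16 := by
      rw [← sq_abs]; nlinarith [abs_nonneg t]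
    rw [Complex.sub_re, hairpin_re, Complex.intCast_re]
    rcases le_or_gt n (-1) with hn | hn
    · have : (n : ℝ) ≤ -1 := by exact_mod_cast hn
      rw [le_abs]; left; nlinarith [sq_nonneg t]
    · have : (0 : ℝ) ≤ n := by exact_mod_cast (by omega : 0 ≤ n)
      rw [le_abs]; right; linarith
  · refine (min_le_right _ _).trans (le_trans ?_ (Complex.abs_im_le_norm _))
    rw [Complex.sub_im, hairpin_im, Complex.intCast_im, sub_zero, abs_neg]
    rcases lt_abs.1 ht with h | h
    · exact (Real.arctan_strictMono h).le.trans (le_abs_self _)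
    · rw [← abs_neg, ← Real.arctan_neg]
      exact (Real.arctan_strictMono h).le.trans (le_abs_self _)

theorem integral_im_hairpin {a : ℝ} {p : ℂ} {F : ℂ → ℂ}
    (hF : ∀ t, HasDerivAt F (hairpin a t - p)⁻¹ (hairpin a t)) (hne : ∀ t, hairpin a t ≠ p) {T : ℝ}
    (hT : 0 ≤ T) :
    ∫ t in Set.Icc (-T) T, (deriv (hairpin a) t / (hairpin a t - p)).im =
      (F (hairpin a T)).im - (F (hairpin a (-T))).im := by
  have hγ := isUnboundedCurve_hairpin a
  have hc : Continuous fun t => (hairpin a t - p)⁻¹ * deriv (hairpin a) t :=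
    ((hγ.continuous.sub continuous_const).inv₀ fun t => sub_ne_zero.2 (hne t)).mul
      (continuous_deriv_hairpin a)
  have h1 := hγ.intervalIntegral_eq (F := F) (f := fun w => (w - p)⁻¹) (a := -T) (b := T)
    (fun t _ => hF t) (hc.intervalIntegrable _ _)
  have h2 := integral_im (𝕜 := ℂ) (hc.integrableOn_Icc (a := -T) (b := T) (μ := volume))
  simp only [RCLike.im_to_complex] at h2
  rw [← Complex.sub_im, ← h1, intervalIntegral.integral_of_le (by linarith),
    ← integral_Icc_eq_integral_Ioc, ← h2]
  simp_rw [div_eq_inv_mul]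

/-- For n ≥ m the curve avoids the ray [n, ∞), so log(-(w - n)) is a primitive along it. Returning
to arg(w - n) adds π at the lower end and subtracts π at the upper end, giving 2π. For n < m the
curve lies to the right of n and the principal logarithm gives 0. -/
theorem tendsto_winding_hairpin (m n : ℤ) :
    Tendsto (fun T : ℝ => ∫ t in Set.Icc (-T) T,
      (deriv (hairpin m) t / (hairpin m t - n)).im) atTop
      (𝓝 (if m ≤ n then 2 * Real.pi else 0)) := by
  have hγ := isUnboundedCurve_hairpin (m : ℝ)
  have harg1 := hγ.tendsto_arg n (σ := id) hγ.tendsto_re_atTop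
  have harg2 := hγ.tendsto_arg n (σ := Neg.neg) hγ.tendsto_re_neg_atTop
  have harg := harg1.sub harg2
  rw [sub_zero] at harg
  split_ifs with h
  · have hmn : (m : ℝ) ≤ n := by exact_mod_cast h
    have hslit : ∀ t, -(hairpin m t - n) ∈ Complex.slitPlane := by
      intro t
      rcases eq_or_ne t 0 with rfl | ht
      · left
        simp only [Complex.neg_re, Complex.sub_re, hairpin_re, Complex.intCast_re]
        norm_num
        linarith
      · right
        simp only [Complex.neg_im, Complex.sub_im, hairpin_im, Complex.intCast_im]
        simpa using ht
    have hne : ∀ t, hairpin m t ≠ n := fun t ht => by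
      have := Complex.slitPlane_ne_zero (hslit t)
      rw [ht] at this
      simp at this
    have h2 := harg.add_const (2 * Real.pi)
    rw [zero_add] at h2
    refine h2.congr' ?_
    filter_upwards [eventually_gt_atTop 0] with T hT
    rw [integral_im_hairpin (F := fun w => Complex.log (-(w - n))) (fun t => ?_) hne hT.le]
    · rw [Complex.log_im, Complex.log_im, Complex.arg_neg_eq_arg_add_pi_of_im_neg,
        Complex.arg_neg_eq_arg_sub_pi_of_im_pos]
      · simp only [id]; ring
      · simpa using hT
      · simpa using hT
    · refine ((((hasDerivAt_id (hairpin m t)).sub_const _).neg).clog (hslit t)).congr_deriv ?_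
      simp only [id, Pi.neg_apply]
      rw [neg_div_neg_eq, one_div]
  · have hmn : (n : ℝ) + 1 ≤ m := by exact_mod_cast (by omega : n + 1 ≤ m)
    have hslit : ∀ t, hairpin m t - n ∈ Complex.slitPlane := by
      intro t
      left
      simp only [Complex.sub_re, hairpin_re, Complex.intCast_re]
      nlinarith [sq_nonneg t]
    have hne : ∀ t, hairpin m t ≠ n := fun t ht => by
      have := Complex.slitPlane_ne_zero (hslit t)
      rw [ht] at this
      simp at this
    refine harg.congr' ?_
    filter_upwards [eventually_gt_atTop 0] with T hT
    rw [integral_im_hairpin (F := fun w => Complex.log (w - n)) (fun t => ?_) hne hT.le]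
    · rw [Complex.log_im, Complex.log_im]; rfl
    · refine (((hasDerivAt_id (hairpin m t)).sub_const _).clog (hslit t)).congr_deriv ?_
      simp only [id, one_div]

/-- The circle of radius `ρ` about the integer `j`. -/
def circleLoop (ρ : ℝ) (j : ℤ) (t : ℝ) : ℂ := j + ρ * Complex.exp (2 * Real.pi * Complex.I * t)

theorem hasDerivAt_circleLoop (ρ : ℝ) (j : ℤ) (t : ℝ) : HasDerivAt (circleLoop ρ j)
    (ρ * (Complex.exp (2 * Real.pi * Complex.I * t) * (2 * Real.pi * Complex.I))) t := by
  have h := (((hasDerivAt_id (t : ℂ)).const_mul (2 * Real.pi * Complex.I)).cexp.const_mul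
    (ρ : ℂ)).const_add (j : ℂ)
  exact h.comp_ofReal.congr_deriv (by simp)

theorem deriv_circleLoop (ρ : ℝ) (j : ℤ) : deriv (circleLoop ρ j) =
    fun t : ℝ => ρ * (Complex.exp (2 * Real.pi * Complex.I * t) * (2 * Real.pi * Complex.I)) :=
  funext fun t => (hasDerivAt_circleLoop ρ j t).deriv

theorem continuous_circleLoop (ρ : ℝ) (j : ℤ) : Continuous (circleLoop ρ j) :=
  continuous_iff_continuousAt.2 fun t => (hasDerivAt_circleLoop ρ j t).continuousAt

theorem continuous_deriv_circleLoop (ρ : ℝ) (j : ℤ) : Continuous (deriv (circleLoop ρ j)) := by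
  rw [deriv_circleLoop]
  fun_prop

theorem circleLoop_one (ρ : ℝ) (j : ℤ) : circleLoop ρ j 1 = circleLoop ρ j 0 := by
  simp [circleLoop, Complex.exp_two_pi_mul_I]

theorem isClosedCurve_circleLoop (ρ : ℝ) (j : ℤ) : IsClosedCurve (circleLoop ρ j) where
  continuousOn := (continuous_circleLoop ρ j).continuousOn
  closed := (circleLoop_one ρ j).symm
  piecewiseC1 := ⟨∅, fun t _ => (hasDerivAt_circleLoop ρ j t).differentiableAt,
    (continuous_deriv_circleLoop ρ j).continuousOn⟩
  integrable_length := (continuous_deriv_circleLoop ρ j).norm.integrableOn_Icc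

theorem norm_circleLoop_sub {ρ : ℝ} (hρ : 0 ≤ ρ) (j : ℤ) (t : ℝ) : ‖circleLoop ρ j t - j‖ = ρ := by
  have : (2 * Real.pi * Complex.I * t : ℂ) = ((2 * Real.pi * t : ℝ) : ℂ) * Complex.I := by
    push_cast; ring
  rw [circleLoop, add_sub_cancel_left, norm_mul, this, Complex.norm_exp_ofReal_mul_I, mul_one,
    Complex.norm_real, Real.norm_eq_abs, abs_of_nonneg hρ]

theorem winding_circleLoop {ρ : ℝ} (h0 : 0 < ρ) (h1 : ρ ≤ 1 / 2) (j n : ℤ) :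
    ∫ t in Set.Icc (0 : ℝ) 1, (deriv (circleLoop ρ j) t / (circleLoop ρ j t - n)).im =
      if n = j then 2 * Real.pi else 0 := by
  split_ifs with h
  · subst h
    have hρ : (ρ : ℂ) ≠ 0 := by exact_mod_cast h0.ne'
    have : ∀ t : ℝ, (deriv (circleLoop ρ n) t / (circleLoop ρ n t - n)).im = 2 * Real.pi := by
      intro t
      rw [deriv_circleLoop, circleLoop, add_sub_cancel_left]
      simp only
      rw [mul_div_mul_left _ _ hρ, mul_div_cancel_left₀ _ (Complex.exp_ne_zero _)]
      simp
    simp [this]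
  · have hd : (1 : ℝ) ≤ ‖(j : ℂ) - n‖ := by
      rw [← Int.cast_sub, Complex.norm_intCast]
      exact_mod_cast Int.one_le_abs (sub_ne_zero.2 (Ne.symm h))
    have hjn : (j : ℂ) - n ≠ 0 := norm_pos_iff.1 (lt_of_lt_of_le one_pos hd)
    -- The quotient stays within 1/2 of 1, so its logarithm is a single-valued primitive on the
    -- circle.
    have hslit : ∀ t, (circleLoop ρ j t - n) / (j - n) ∈ Complex.slitPlane := by
      intro t
      left
      have e : (circleLoop ρ j t - n) / (j - n) = 1 + (circleLoop ρ j t - j) / (j - n) := by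
        field_simp; ring
      have h2 : ‖(circleLoop ρ j t - j) / ((j : ℂ) - n)‖ ≤ 1 / 2 := by
        rw [norm_div, norm_circleLoop_sub h0.le]
        exact (div_le_self h0.le hd).trans h1
      have h3 := (neg_le_abs _).trans ((Complex.abs_re_le_norm _).trans h2)
      rw [e, Complex.add_re, Complex.one_re]
      linarith
    have hne : ∀ t, circleLoop ρ j t - n ≠ 0 := fun t ht => by
      have := Complex.slitPlane_ne_zero (hslit t)
      rw [ht, zero_div] at this
      exact this rfl
    have hc : Continuous fun t => deriv (circleLoop ρ j) t / (circleLoop ρ j t - n) :=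
      (continuous_deriv_circleLoop ρ j).div ((continuous_circleLoop ρ j).sub continuous_const) hne
    have hFd : ∀ t, HasDerivAt (fun t => Complex.log ((circleLoop ρ j t - n) / (j - n)))
        (deriv (circleLoop ρ j) t / (circleLoop ρ j t - n)) t := by
      intro t
      have hd := (hasDerivAt_circleLoop ρ j t).differentiableAt.hasDerivAt
      refine (((hd.sub_const (n : ℂ)).div_const ((j : ℂ) - n)).clog_real (hslit t)).congr_deriv ?_
      have := hne t
      field_simp
    have h2 := intervalIntegral.integral_eq_sub_of_hasDerivAt (a := 0) (b := 1)
      (fun t _ => hFd t) (hc.intervalIntegrable _ _)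
    have h3 := integral_im (𝕜 := ℂ) (hc.integrableOn_Icc (a := 0) (b := 1) (μ := volume))
    simp only [RCLike.im_to_complex] at h3
    rw [h3, integral_Icc_eq_integral_Ioc, ← intervalIntegral.integral_of_le zero_le_one, h2,
      circleLoop_one, sub_self, Complex.zero_im]

/-- A hairpin around `{M, M + 1, …}` together with circles around `0, …, M - 1`. -/
def hairpinContour (ρ : ℝ) (M : ℕ) : Contour where
  arm := hairpin (M : ℤ)
  numLoops := M
  loop i := circleLoop ρ (i : ℕ)
  isUnboundedCurve_arm := isUnboundedCurve_hairpin _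
  isClosedCurve_loop _ := isClosedCurve_circleLoop _ _

theorem mem_support_hairpinContour {ρ : ℝ} {M : ℕ} {w : ℂ} (hw : w ∈ (hairpinContour ρ M).support) :
    (∃ t, w = hairpin 0 t + M) ∨ ∃ (j : ℕ) (t : ℝ), j < M ∧ w = circleLoop ρ j t := by
  obtain ⟨c, t, -, rfl⟩ := Set.mem_iUnion.1 hw
  cases c with
  | none =>
    refine Or.inl ⟨t, ?_⟩
    simp only [Contour.piece, hairpinContour, hairpin]
    push_cast
    ring
  | some i => exact Or.inr ⟨i, t, i.2, rfl⟩

theorem hasWindingNumber_hairpinContour {ρ : ℝ} (h0 : 0 < ρ) (h1 : ρ ≤ 1 / 2) (M : ℕ) (n : ℤ) :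
    (hairpinContour ρ M).HasWindingNumber n (if 0 ≤ n then 1 else 0) := by
  have harm := tendsto_winding_hairpin M n
  have hloop : ∀ i : Fin M, Tendsto (fun T : ℝ => ∫ t in Set.Icc (0 : ℝ) 1 ∩ Set.Icc (-T) T,
      (deriv (circleLoop ρ (i : ℕ)) t / (circleLoop ρ (i : ℕ) t - n)).im) atTop
      (𝓝 (if n = (i : ℕ) then 2 * Real.pi else 0)) := by
    intro i
    refine tendsto_const_nhds.congr' ?_
    filter_upwards [eventually_ge_atTop 1] with T hT
    rw [Set.inter_eq_left.2 (Set.Icc_subset_Icc (by linarith) hT)]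
    exact_mod_cast (winding_circleLoop h0 h1 (i : ℕ) n).symm
  have hsum := harm.add (tendsto_finsetSum Finset.univ fun i _ => hloop i)
  have e : (if (M : ℤ) ≤ n then 2 * Real.pi else 0) +
      ∑ i : Fin M, (if n = (i : ℕ) then 2 * Real.pi else 0) =
      2 * Real.pi * ((if 0 ≤ n then 1 else 0 : ℤ) : ℝ) := by
    rw [Fin.sum_univ_eq_sum_range (fun i : ℕ => if n = (i : ℤ) then 2 * Real.pi else 0) M]
    rcases le_or_gt 0 n with hn | hn
    · lift n to ℕ using hn
      simp only [Nat.cast_inj, Finset.sum_ite_eq, Finset.mem_range, Nat.cast_le]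
      rcases le_or_gt M n with h | h
      · simp [h, not_lt.2 h]
      · simp [h, not_le.2 h]
    · rw [if_neg (by omega), if_neg (by omega), Finset.sum_eq_zero]
      · simp
      · intro i _
        rw [if_neg (by omega)]
  rw [e] at hsum
  refine hsum.congr fun T => ?_
  rw [Fintype.sum_option]
  simp only [Contour.dom, Contour.piece, hairpinContour, Set.univ_inter]
  rfl

theorem norm_circleLoop_sub_int {ρ : ℝ} (h0 : 0 < ρ) (h1 : ρ ≤ 1 / 2) (j n : ℤ) (t : ℝ) :
    ρ ≤ ‖circleLoop ρ j t - n‖ := by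
  have h := norm_circleLoop_sub h0.le j t
  by_cases hn : n = j
  · rw [hn, h]
  · exact h1.trans (one_half_le_norm_sub_int hn (by rw [h]; exact h1))

theorem exists_admissible (x₁ x₂ : ℤ) : ∃ Cz Cw : Contour, Admissible x₁ x₂ Cz Cw := by
  obtain ⟨δ, hδ, hδ2, haway⟩ := exists_hairpin_away
  have hρ : 0 < δ / 2 := half_pos hδ
  have hρ2 : δ / 2 ≤ 1 / 2 := by linarith
  have hencl : ∀ M, (hairpinContour (δ / 2) M).EnclosesNonnegIntegers := by
    intro M
    refine ⟨⟨δ / 2, hρ, fun w hw n => ?_⟩, fun n hn => ?_, fun n hn => ?_⟩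
    · rcases mem_support_hairpinContour hw with ⟨t, rfl⟩ | ⟨j, t, -, rfl⟩
      · have := haway t (n - M)
        push_cast at this
        rw [show hairpin 0 t + M - n = hairpin 0 t - (n - M) by ring]
        linarith
      · exact norm_circleLoop_sub_int hρ hρ2 j n t
    · simpa [hn] using hasWindingNumber_hairpinContour hρ hρ2 M n
    · simpa [not_le.2 hn] using hasWindingNumber_hairpinContour hρ hρ2 M n
  -- Moving the w-hairpin right by max(x₁ - x₂, 0) keeps Re(w + z + x₂ - x₁ + 1) ≥ 1/2; circles
  -- enclose the integers left behind. On a circle of radius δ/2 the denominator is within δ/2 of z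
  -- minus an integer, hence at least δ/2 in modulus.
  refine ⟨hairpinContour (δ / 2) 0, hairpinContour (δ / 2) (x₁ - x₂).toNat, hencl _, hencl _, rfl,
    δ / 2, hρ, fun z hz w hw => ?_⟩
  obtain ⟨s, rfl⟩ : ∃ s, z = hairpin 0 s := by
    rcases mem_support_hairpinContour hz with ⟨s, rfl⟩ | ⟨j, s, hj, -⟩
    · exact ⟨s, by simp⟩
    · omega
  rcases mem_support_hairpinContour hw with ⟨t, rfl⟩ | ⟨j, t, -, rfl⟩
  · refine le_trans ?_ (Complex.re_le_norm _)
    have hM : ((x₁ - x₂ : ℤ) : ℝ) ≤ (x₁ - x₂).toNat := by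
      exact_mod_cast Int.self_le_toNat (x₁ - x₂)
    push_cast at hM
    simp only [Complex.add_re, Complex.sub_re, hairpin_re, Complex.natCast_re, Complex.intCast_re,
      Complex.one_re]
    nlinarith [sq_nonneg s, sq_nonneg t]
  · have h1 := haway s (x₁ - x₂ - 1 - j)
    have h2 := norm_circleLoop_sub hρ.le (j : ℤ) t
    have h3 : hairpin 0 s - ((x₁ - x₂ - 1 - j : ℤ) : ℂ) =
        (circleLoop (δ / 2) j t + hairpin 0 s + x₂ - x₁ + 1) -
          (circleLoop (δ / 2) j t - (j : ℤ)) := by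
      push_cast; ring
    rw [h3] at h1
    have h4 := h1.trans (norm_sub_le _ _)
    rw [h2] at h4
    linarith

/-! ### Comparison of the two forms -/

/-- For k ≥ 1 the jump of the sign is absorbed, since sgn(a) a = |a|. Only k = 0 jumps at a = 0, and
this is the origin of the exceptional set. -/
theorem continuousAt_jumpTerm {k : ℕ} {a : ℝ} (h : k = 0 → a ≠ 0) : ContinuousAt (jumpTerm k) a := by
  rcases k with _ | k
  · have h1 : ContinuousAt (fun a : ℝ => (SignType.sign a : ℝ)) a :=
      (continuous_of_discreteTopology (f := fun s : SignType => (s : ℝ))).continuousAt.comp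
        (continuousAt_sign_of_ne_zero (h rfl))
    unfold jumpTerm
    fun_prop
  · have e : jumpTerm (k + 1) = fun a => Real.pi / 2 * (|a| * ((-a) ^ k / (k + 1).factorial)) := by
      ext a
      rw [jumpTerm, ← sign_mul_self a, pow_succ]
      ring
    rw [e]
    fun_prop

theorem continuous_seriesPart (x₁ x₂ : ℤ) :
    Continuous fun v : ℝ × ℝ => seriesPart x₁ x₂ v.1 v.2 := by
  have := continuous_cosMoment (x₁ - x₂)
  unfold seriesPart
  fun_prop

theorem continuousAt_realKernel {x₁ x₂ : ℤ} {u₁ u₂ : ℝ} (hu₁ : 0 ≤ u₁) (hu₂ : 0 ≤ u₂)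
    (h : ((x₁, u₁), (x₂, u₂)) ∉ exceptionalSet) :
    ContinuousAt (fun v : ℝ × ℝ => realKernel x₁ v.1 x₂ v.2) (u₁, u₂) := by
  rcases le_or_gt x₁ x₂ with hx | hx
  · simp_rw [realKernel_of_le hx]
    exact (continuous_seriesPart x₁ x₂).continuousAt
  · have hk : x₁ - x₂ = ((x₁ - x₂ - 1).toNat : ℕ) + 1 := by omega
    set k := (x₁ - x₂ - 1).toNat
    have hne : k = 0 → u₁ ≠ u₂ := fun h0 hu => h ⟨hu, by simp only; omega⟩
    simp_rw [realKernel_of_lt hk]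
    have h1 : ContinuousAt (fun v : ℝ × ℝ => jumpTerm k (v.1 - v.2)) (u₁, u₂) :=
      ContinuousAt.comp (f := fun v : ℝ × ℝ => v.1 - v.2)
        (continuousAt_jumpTerm fun h0 => sub_ne_zero.2 (hne h0)) (by fun_prop)
    -- With u₁, u₂ ≥ 0, a vanishing sum forces u₁ = u₂ = 0, which is excluded for k = 0.
    have h2 : ContinuousAt (fun v : ℝ × ℝ => jumpTerm k (-(v.1 + v.2))) (u₁, u₂) := by
      refine ContinuousAt.comp (f := fun v : ℝ × ℝ => -(v.1 + v.2))
        (continuousAt_jumpTerm fun h0 h3 => hne h0 ?_) (by fun_prop)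
      simp only at h3
      linarith
    have h3 := (continuous_seriesPart x₁ x₂).continuousAt (x := (u₁, u₂))
    fun_prop

theorem Admissible.contourKernel_eq {x₁ x₂ : ℤ} {Cz Cw : Contour} (h : Admissible x₁ x₂ Cz Cw)
    {u₁ u₂ : ℝ} (hu₁ : 0 < u₁) (hu₂ : 0 < u₂) (hex : ((x₁, u₁), (x₂, u₂)) ∉ exceptionalSet) :
    contourKernel Cz Cw x₁ u₁ x₂ u₂ = (realKernel x₁ u₁ x₂ u₂ : ℂ) := by
  rw [contourKernel, h.doubleIntegral_eq hu₁ hu₂]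
  rcases le_or_gt x₁ x₂ with hx | hx
  · rw [if_neg (by omega), (hasSum_extraResidue_of_le hx u₁ u₂).tsum_eq, realKernel_of_le hx]
    simp
  · have hk : x₁ - x₂ = ((x₁ - x₂ - 1).toNat : ℕ) + 1 := by omega
    rw [(hasSum_extraResidue_of_lt hk u₁ u₂).tsum_eq, realKernel_of_lt hk]
    set k := (x₁ - x₂ - 1).toNat
    have hne : k = 0 → u₁ ≠ u₂ := fun h0 hu => hex ⟨hu, by simp only; omega⟩
    have hpi := Real.pi_ne_zero
    have hb : SignType.sign (-(u₁ + u₂)) = -1 := sign_neg (by linarith)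
    -- Off the diagonal this is 1_{u₂ < u₁} - 1/2 = sgn(u₁ - u₂)/2. On the diagonal k ≠ 0, so the
    -- power vanishes.
    have key : (if u₂ < u₁ then (u₂ - u₁) ^ k / (k.factorial : ℝ) else 0) +
        (seriesPart x₁ x₂ u₁ u₂ + Real.pi / 2 *
          (-(1 / Real.pi) * (((u₂ - u₁) ^ k + (-1) ^ x₁ * (u₁ + u₂) ^ k) / k.factorial))) =
        seriesPart x₁ x₂ u₁ u₂ -
          1 / Real.pi * (jumpTerm k (u₁ - u₂) + (-1) ^ x₁ * jumpTerm k (-(u₁ + u₂))) := by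
      rw [jumpTerm, jumpTerm, hb, neg_neg, neg_sub, SignType.coe_neg_one]
      rcases lt_trichotomy u₁ u₂ with hlt | heq | hgt
      · rw [if_neg (by linarith), sign_neg (by linarith), SignType.coe_neg_one]
        field_simp
        ring
      · have hk0 : k ≠ 0 := fun h0 => hne h0 heq
        rw [if_neg (by linarith), heq, sub_self, sign_zero, zero_pow hk0, SignType.coe_zero]
        field_simp
        ring
      · rw [if_pos hgt, sign_pos (by linarith), SignType.coe_one]
        field_simp
        ring
    rw [← key]
    have hx' : (u₂ < u₁ ∧ x₂ < x₁) ↔ u₂ < u₁ := ⟨fun h => h.1, fun h => ⟨h, hx⟩⟩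
    simp only [hx']
    split_ifs <;> push_cast <;> ring

theorem Admissible.tendsto_contourKernel {x₁ x₂ : ℤ} {Cz Cw : Contour}
    (h : Admissible x₁ x₂ Cz Cw) {u₁ u₂ : ℝ} (hu₁ : 0 ≤ u₁) (hu₂ : 0 ≤ u₂)
    (hex : ((x₁, u₁), (x₂, u₂)) ∉ exceptionalSet) :
    Tendsto (fun v : ℝ × ℝ => contourKernel Cz Cw x₁ v.1 x₂ v.2)
      (𝓝[Set.Ioi 0 ×ˢ Set.Ioi 0] (u₁, u₂)) (𝓝 (realKernel x₁ u₁ x₂ u₂ : ℂ)) := by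
  have h1 : Tendsto (fun v : ℝ × ℝ => (realKernel x₁ v.1 x₂ v.2 : ℂ))
      (𝓝[Set.Ioi 0 ×ˢ Set.Ioi 0] (u₁, u₂)) (𝓝 (realKernel x₁ u₁ x₂ u₂ : ℂ)) :=
    (Complex.continuous_ofReal.continuousAt.tendsto.comp
      (continuousAt_realKernel hu₁ hu₂ hex)).mono_left nhdsWithin_le_nhds
  have h2 : ∀ᶠ v : ℝ × ℝ in 𝓝 (u₁, u₂), ((x₁, v.1), (x₂, v.2)) ∉ exceptionalSet := by
    by_cases hx : x₂ = x₁ - 1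
    · have hne : u₁ ≠ u₂ := fun hu => hex ⟨hu, hx⟩
      have : IsOpen {v : ℝ × ℝ | v.1 ≠ v.2} := isOpen_ne_fun continuous_fst continuous_snd
      filter_upwards [this.mem_nhds hne] with v hv hv2 using hv hv2.1
    · exact Eventually.of_forall fun v hv => hx hv.2
  refine h1.congr' ?_
  filter_upwards [nhdsWithin_le_nhds h2, self_mem_nhdsWithin] with v hv hv0
  exact (h.contourKernel_eq hv0.1 hv0.2 hv).symm

theorem refMeasure_prod_exceptionalSet : (refMeasure.prod refMeasure) exceptionalSet = 0 := by
  have hm : MeasurableSet exceptionalSet := by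
    refine (measurableSet_eq_fun (f := fun p : (ℤ × ℝ) × (ℤ × ℝ) => p.1.2) (g := fun p => p.2.2)
      (by fun_prop) (by fun_prop)).inter
      (measurableSet_eq_fun (f := fun p : (ℤ × ℝ) × (ℤ × ℝ) => p.2.1) (g := fun p => p.1.1 - 1)
      (by fun_prop) ((measurable_from_top (f := fun n : ℤ => n - 1)).comp (by fun_prop)))
  have : SFinite refMeasure := by unfold refMeasure; infer_instance
  rw [Measure.measure_prod_null hm]
  refine Eventually.of_forall fun p => ?_
  -- With the first point fixed, the second real coordinate is determined; the slice has measure at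
  -- most ∞ · 0 = 0.
  have hsub : Prod.mk p ⁻¹' exceptionalSet ⊆ Set.univ ×ˢ {p.2} := fun q hq =>
    ⟨trivial, hq.1.symm⟩
  refine measure_mono_null hsub ?_
  rw [refMeasure, Measure.prod_prod, measure_singleton]
  simp

end EdgeKernel

end

theorem proposition4p3 :
    -- the contours exist
    (∀ x₁ x₂ : ℤ, ∃ Cz Cw : EdgeKernel.Contour, EdgeKernel.Admissible x₁ x₂ Cz Cw) ∧
    -- the improper integral in the real form converges
    (∀ (x₁ x₂ : ℤ) (u₁ u₂ : ℝ), 0 ≤ u₁ → 0 ≤ u₂ → x₂ < x₁ →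
      Tendsto (fun R : ℝ => -(2 / Real.pi) *
          ∫ t in (1 : ℝ)..R, EdgeKernel.realIntegrand x₁ u₁ x₂ u₂ t)
        atTop (𝓝 (EdgeKernel.realKernel x₁ u₁ x₂ u₂))) ∧
    (∀ (x₁ x₂ : ℤ) (Cz Cw : EdgeKernel.Contour), EdgeKernel.Admissible x₁ x₂ Cz Cw →
      -- the double contour integral converges absolutely
      (∀ u₁ u₂ : ℝ, 0 < u₁ → 0 < u₂ →
        EdgeKernel.DoubleIntegrable Cz Cw (EdgeKernel.contourIntegrand x₁ u₁ x₂ u₂)) ∧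
      -- the two forms of the kernel agree off the exceptional set
      (∀ u₁ u₂ : ℝ, 0 < u₁ → 0 < u₂ → ((x₁, u₁), (x₂, u₂)) ∉ EdgeKernel.exceptionalSet →
        EdgeKernel.contourKernel Cz Cw x₁ u₁ x₂ u₂ =
          (EdgeKernel.realKernel x₁ u₁ x₂ u₂ : ℂ)) ∧
      -- on the boundary the value of the double contour kernel is understood as a limit
      (∀ u₁ u₂ : ℝ, 0 ≤ u₁ → 0 ≤ u₂ → ((x₁, u₁), (x₂, u₂)) ∉ EdgeKernel.exceptionalSet →
        Tendsto (fun v : ℝ × ℝ => EdgeKernel.contourKernel Cz Cw x₁ v.1 x₂ v.2)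
          (𝓝[Set.Ioi 0 ×ˢ Set.Ioi 0] (u₁, u₂))
          (𝓝 (EdgeKernel.realKernel x₁ u₁ x₂ u₂ : ℂ)))) ∧
    -- the exceptional set is null
    (EdgeKernel.refMeasure.prod EdgeKernel.refMeasure) EdgeKernel.exceptionalSet = 0 := by
  refine ⟨EdgeKernel.exists_admissible, fun x₁ x₂ u₁ u₂ _ _ hx => ?_,
    fun x₁ x₂ Cz Cw h => ⟨fun u₁ u₂ hu₁ hu₂ => h.doubleIntegrable hu₁ hu₂,
      fun u₁ u₂ hu₁ hu₂ hex => h.contourKernel_eq hu₁ hu₂ hex,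
      fun u₁ u₂ hu₁ hu₂ hex => h.tendsto_contourKernel hu₁ hu₂ hex⟩,
    EdgeKernel.refMeasure_prod_exceptionalSet⟩
  have hk : x₁ - x₂ = ((x₁ - x₂ - 1).toNat : ℕ) + 1 := by omega
  rw [EdgeKernel.realKernel_of_lt hk]
  exact EdgeKernel.tendsto_integral_realIntegrand hk u₁ u₂
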